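/- Let $A$ be the mod 2 Steenrod algebra, let $A/A(\mathrm{Sq}^4,\mathrm{Sq}^5\mathrm{Sq}^1)$ be the quotient of $A$ by the left ideal generated by $\mathrm{Sq}^4$ and $\mathrm{Sq}^5\mathrm{Sq}^1$, regarded as a graded left $A$-module generated in degree $0$, and let $\mathrm{Ext}_A^{s,t}(-,\mathbb Z_2)=\mathrm{Ext}_A^{s}(-,\Sigma^t\mathbb Z_2)$ be formed in the category of graded left $A$-modules and degree-preserving maps. Place $\mathrm{Ext}_A^{s,t}$ in bidegree $(x,y)=(t-s,s)$. A symbol $a_{x,y}$ denotes a generator of bidegree $(x,y)$; the symbols $h_1$, $h_2$, $v_2^4$, $v_2^8$ have bidegrees $(1,1)$, $(3,1)$, $(24,4)$, $(48,8)$; and $R[v]\langle b_1,\ldots,b_r\rangle$ denotes the direct sum of one copy of $R$ for each $v^k b_i$ ($k\ge 0$, $1\le i\le r$), shifted by the bidegree of $v^kb_i$. Let $bo_*$ be the bigraded $\mathbb Z_2$-vector space with one basis element in each of the bidegrees $$(8i,4i+j),\quad (8i+1,4i+1),\quad (8i+2,4i+2),\quad (8i+4,4i+3+j)\qquad (i,j\ge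 0),$$ and let $bsp_*$ be the one with one basis element in each of the bidegrees $$(8i,4i+j),\quad (8i+4,4i+1+j),\quad (8i+5,4i+2),\quad (8i+6,4i+3)\qquad (i,j\ge0).$$ **Theorem.** As a bigraded abelian group, $\mathrm{Ext}_A^{*,*}(A/A(\mathrm{Sq}^4,\mathrm{Sq}^5\mathrm{Sq}^1),\mathbb Z_2)$ is isomorphic to $$\mathbb Z_2[v_2^8]\langle a_{0,0},\,h_2a_{0,0},\,a_{14,2},\,h_1a_{14,2},\,h_2a_{14,2},\,a_{31,5},\,h_2a_{31,5},\,a_{39,7}\rangle$$ $$\oplus\ \ker\bigl(bo_*[v_2^4]\langle a_{5,1},a_{21,3}\rangle\to\mathbb Z_2[v_2^8]\langle a_{21,3}\rangle\bigr)$$ $$\oplus\ bsp_*[v_2^4]\langle a_{9,2},a_{17,4}\rangle,$$ where the map in the second summand is the projection that sends $v_2^{8m}a_{21,3}$ to itself for every $m\ge0$ and all other basis elements to $0$. -/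

import Mathlib

open CategoryTheory CategoryTheory.Limits CategoryTheory.Abelian

/-! ### Graded modules over a graded ring, as an abelian category -/

section GradedModules

variable {k A : Type} [CommRing k] [Ring A] [Algebra k A]

/-- The integers, regarded as the set of objects of the preadditive category in which a morphism
`m ⟶ n` is a homogeneous element of degree `n - m` of the graded algebra `𝒜`
and composition is multiplication. -/
structure GradedIndex (𝒜 : ℤ → Submodule k A) where
  deg : ℤ

variable (𝒜 : ℤ → Submodule k A)

instance GradedIndex.category [SetLike.GradedMonoid 𝒜] : Category (GradedIndex 𝒜) where
  Hom m n := 𝒜 (n.deg - m.deg)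
  id m := ⟨1, by simpa using SetLike.one_mem_graded 𝒜⟩
  comp {m n p} a b := ⟨b.1 * a.1, by
    have h := SetLike.mul_mem_graded b.2 a.2
    rwa [sub_add_sub_cancel] at h⟩
  id_comp a := Subtype.ext (mul_one a.1)
  comp_id a := Subtype.ext (one_mul a.1)
  assoc a b c := Subtype.ext (mul_assoc c.1 b.1 a.1).symm

instance GradedIndex.preadditive [SetLike.GradedMonoid 𝒜] : Preadditive (GradedIndex 𝒜) where
  homGroup m n := inferInstanceAs (AddCommGroup (𝒜 (n.deg - m.deg)))
  add_comp _ _ _ a a' b := Subtype.ext (mul_add b.1 a.1 a'.1)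
  comp_add _ _ _ a b b' := Subtype.ext (add_mul b.1 b'.1 a.1)

/-- The category of `ℤ`-graded left modules over the graded algebra `𝒜` and degree-preserving
`𝒜`-linear maps: such a module is a family of abelian groups `M n`, together with biadditive,
unital and associative multiplications `𝒜 (n - m) × M m → M n`, that is, an additive functor to
abelian groups. -/
abbrev GradedModuleCat [SetLike.GradedMonoid 𝒜] : Type 1 :=
  GradedIndex 𝒜 ⥤+ AddCommGrpCat.{0}

section Closure

open scoped ZeroObject

variable (C D : Type*) [Category* C] [Category* D] [Preadditive C] [Abelian D]

instance : (additiveFunctor C D).IsClosedUnderSubobjects where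
  prop_of_mono {F G} i _ hG := by
    have : G.Additive := hG
    refine ⟨fun {X Y f g} => ?_⟩
    rw [← cancel_mono (i.app Y), Preadditive.add_comp, i.naturality, i.naturality, i.naturality,
      G.map_add, Preadditive.comp_add]

instance : (additiveFunctor C D).IsClosedUnderQuotients where
  prop_of_epi {F G} p _ hF := by
    have : F.Additive := hF
    refine ⟨fun {X Y f g} => ?_⟩
    rw [← cancel_epi (p.app X), Preadditive.comp_add, ← p.naturality, ← p.naturality,
      ← p.naturality, F.map_add, Preadditive.add_comp]

instance : (additiveFunctor C D).ContainsZero where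
  exists_zero := ⟨0, isZero_zero _, inferInstanceAs (Functor.Additive (0 : C ⥤ D))⟩

instance : (additiveFunctor C D).IsClosedUnderFiniteProducts where
  isClosedUnderLimitsOfShape J _ := ⟨by
    rintro F ⟨p⟩
    refine ⟨fun {X Y f g} => ?_⟩
    refine (isLimitOfPreserves ((evaluation C D).obj Y) p.isLimit).hom_ext fun j => ?_
    have hj : (p.diag.obj j).Additive := p.prop_diag_obj j
    have nat : ∀ u : X ⟶ Y, F.map u ≫ (p.π.app j).app Y =
        (p.π.app j).app X ≫ (p.diag.obj j).map u := fun u => (p.π.app j).naturality u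
    change F.map (f + g) ≫ (p.π.app j).app Y = (F.map f + F.map g) ≫ (p.π.app j).app Y
    rw [Preadditive.add_comp, nat, nat, nat, hj.map_add, Preadditive.comp_add]⟩

end Closure

noncomputable instance GradedModuleCat.abelian [SetLike.GradedMonoid 𝒜] :
    Abelian (GradedModuleCat 𝒜) :=
  inferInstanceAs (Abelian (additiveFunctor (GradedIndex 𝒜) AddCommGrpCat.{0}).FullSubcategory)

instance GradedModuleCat.hasExt [SetLike.GradedMonoid 𝒜] : HasExt.{1} (GradedModuleCat 𝒜) :=
  HasExt.standard _

/-- The functor `n ↦ ℳ n` attached to an `A`-module `M` with homogeneous parts `ℳ n`; the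
homogeneous elements of `A` act by scalar multiplication. -/
def GradedModuleCat.functorOf [SetLike.GradedMonoid 𝒜] {M : Type} [AddCommGroup M] [Module k M]
    [Module A M] (ℳ : ℤ → Submodule k M) [SetLike.GradedSMul 𝒜 ℳ] :
    GradedIndex 𝒜 ⥤ AddCommGrpCat.{0} where
  obj n := AddCommGrpCat.of (ℳ n.deg)
  map {m n} a := AddCommGrpCat.ofHom
    { toFun := fun x => ⟨a.1 • x.1, by
        have h : a.1 • x.1 ∈ ℳ ((n.deg - m.deg) +ᵥ m.deg) :=
          SetLike.GradedSMul.smul_mem a.2 x.2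
        rwa [vadd_eq_add, sub_add_cancel] at h⟩
      map_zero' := Subtype.ext (smul_zero a.1)
      map_add' := fun x y => Subtype.ext (smul_add a.1 x.1 y.1) }
  map_id n := by
    ext x
    exact one_smul A x.1
  map_comp a b := by
    ext x
    exact mul_smul b.1 a.1 x.1

instance GradedModuleCat.functorOf_additive [SetLike.GradedMonoid 𝒜] {M : Type} [AddCommGroup M]
    [Module k M] [Module A M] (ℳ : ℤ → Submodule k M) [SetLike.GradedSMul 𝒜 ℳ] :
    (GradedModuleCat.functorOf 𝒜 ℳ).Additive where
  map_add {m n a b} := by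
    ext x
    exact Subtype.ext (add_smul a.1 b.1 x.1)

/-- The object of `GradedModuleCat 𝒜` given by an `A`-module `M` with homogeneous
parts `ℳ n`. -/
def GradedModuleCat.of [SetLike.GradedMonoid 𝒜] {M : Type} [AddCommGroup M] [Module k M]
    [Module A M] (ℳ : ℤ → Submodule k M) [SetLike.GradedSMul 𝒜 ℳ] : GradedModuleCat 𝒜 :=
  AdditiveFunctor.of (GradedModuleCat.functorOf 𝒜 ℳ)

end GradedModules

/-! ### The mod 2 Steenrod algebra -/

/-- `Sq⁰ = 1` and the Adem relations. -/
inductive AdemRel : FreeAlgebra (ZMod 2) ℕ → FreeAlgebra (ZMod 2) ℕ → Prop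
  | sq_zero : AdemRel (FreeAlgebra.ι (ZMod 2) 0) 1
  | adem (a b : ℕ) (ha : 0 < a) (hab : a < 2 * b) :
      AdemRel (FreeAlgebra.ι (ZMod 2) a * FreeAlgebra.ι (ZMod 2) b)
        (∑ j ∈ Finset.range (a / 2 + 1), ((b - 1 - j).choose (a - 2 * j) : ZMod 2) •
          (FreeAlgebra.ι (ZMod 2) (a + b - j) * FreeAlgebra.ι (ZMod 2) j))

/-- The mod 2 Steenrod algebra `A`. -/
abbrev SteenrodAlgebra : Type := RingQuot AdemRel

namespace SteenrodAlgebra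

/-- The Steenrod square `Sqⁿ`. -/
noncomputable def Sq (n : ℕ) : SteenrodAlgebra :=
  RingQuot.mkAlgHom (ZMod 2) AdemRel (FreeAlgebra.ι (ZMod 2) n)

/-- The part of degree `n` of `A` (zero if `n < 0`): the span of the monomials
`Sq^{i₁} ⋯ Sq^{iᵣ}` with `i₁ + ⋯ + iᵣ = n`. -/
def grading (n : ℤ) : Submodule (ZMod 2) SteenrodAlgebra :=
  Submodule.span (ZMod 2) {x | ∃ l : List ℕ, ((l.sum : ℕ) : ℤ) = n ∧ x = (l.map Sq).prod}

instance : SetLike.GradedMonoid grading where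
  one_mem := Submodule.subset_span ⟨[], by simp, by simp⟩
  mul_mem := by
    intro i j x y hx hy
    have h := Submodule.mul_mem_mul hx hy
    rw [grading, grading, Submodule.span_mul_span] at h
    refine Submodule.span_mono ?_ h
    rintro _ ⟨_, ⟨l, hl, rfl⟩, _, ⟨l', hl', rfl⟩, rfl⟩
    exact ⟨l ++ l', by simp [← hl, ← hl'], by simp⟩

/-- The augmentation `A → ℤ/2`, which sends `Sqⁿ` to `0` for `n > 0`. -/
noncomputable def augmentation : SteenrodAlgebra →ₐ[ZMod 2] ZMod 2 :=
  RingQuot.liftAlgHom (ZMod 2) ⟨FreeAlgebra.lift (ZMod 2) fun n => if n = 0 then 1 else 0, by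
    intro x y h
    induction h with
    | sq_zero => simp
    | adem a b ha hab =>
      rw [map_mul, map_sum, FreeAlgebra.lift_ι_apply, if_neg ha.ne', zero_mul]
      refine (Finset.sum_eq_zero fun j hj => ?_).symm
      have hj' : a + b - j ≠ 0 := by
        have := Finset.mem_range.1 hj
        omega
      rw [map_smul, map_mul, FreeAlgebra.lift_ι_apply, if_neg hj', zero_mul, smul_zero]⟩

theorem augmentation_Sq (n : ℕ) : augmentation (Sq n) = if n = 0 then 1 else 0 := by
  simp [augmentation, Sq]

theorem augmentation_eq_zero {n : ℤ} (hn : n ≠ 0) {a : SteenrodAlgebra} (ha : a ∈ grading n) :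
    augmentation a = 0 := by
  have h : grading n ≤ LinearMap.ker augmentation.toLinearMap := by
    refine Submodule.span_le.2 ?_
    rintro _ ⟨l, hl, rfl⟩
    simp only [SetLike.mem_coe, LinearMap.mem_ker, AlgHom.toLinearMap_apply, map_list_prod,
      List.map_map]
    refine List.prod_eq_zero ?_
    have hs : l.sum ≠ 0 := fun h0 => hn (by rw [← hl, h0]; rfl)
    obtain ⟨i, hi, hi0⟩ : ∃ i ∈ l, i ≠ 0 := by
      by_contra! hc
      exact hs (List.sum_eq_zero hc)
    exact List.mem_map.2 ⟨i, hi, by simp [augmentation_Sq, hi0]⟩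
  exact h ha

/-- The field `ℤ/2` with the `A`-module structure given by the augmentation. -/
def TrivialModule : Type := ZMod 2

namespace TrivialModule

instance : AddCommGroup TrivialModule := inferInstanceAs (AddCommGroup (ZMod 2))

instance : Module (ZMod 2) TrivialModule := inferInstanceAs (Module (ZMod 2) (ZMod 2))

noncomputable instance : Module SteenrodAlgebra TrivialModule :=
  Module.compHom (ZMod 2) augmentation.toRingHom

/-- `ℤ/2` concentrated in degree `t`. -/
def grading (t n : ℤ) : Submodule (ZMod 2) TrivialModule := if n = t then ⊤ else ⊥

instance (t : ℤ) : SetLike.GradedSMul SteenrodAlgebra.grading (TrivialModule.grading t) where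
  smul_mem := by
    intro i j a x ha hx
    rw [vadd_eq_add]
    by_cases hj : j = t
    · by_cases hi : i = 0
      · simp [TrivialModule.grading, hi, hj]
      · have h0 : a • x = 0 := by
          change augmentation a • (x : ZMod 2) = (0 : ZMod 2)
          rw [augmentation_eq_zero hi ha, zero_smul]
          rfl
        rw [h0]
        exact Submodule.zero_mem _
    · have hx0 : x = 0 := by simpa [TrivialModule.grading, hj] using hx
      rw [hx0, smul_zero]
      exact Submodule.zero_mem _

end TrivialModule

/-- The graded `A`-module `Σᵗ ℤ/2`. -/
noncomputable def shiftedTrivialModule (t : ℤ) : GradedModuleCat grading :=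
  GradedModuleCat.of grading (TrivialModule.grading t)

/-- `Ext_A^{s,t}(M, ℤ/2) = Ext_A^s(M, Σᵗ ℤ/2)`, formed in the abelian category of graded
`A`-modules. -/
abbrev ExtA (M : GradedModuleCat grading) (s : ℕ) (t : ℤ) : Type 1 :=
  Ext.{1} M (shiftedTrivialModule t) s

/-- The homogeneous parts of the cyclic left module `A/I`: the images of those of `A`. -/
def quotientGrading (I : Submodule SteenrodAlgebra SteenrodAlgebra) (n : ℤ) :
    Submodule (ZMod 2) (SteenrodAlgebra ⧸ I) :=
  (grading n).map (I.mkQ.restrictScalars (ZMod 2))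

instance (I : Submodule SteenrodAlgebra SteenrodAlgebra) :
    SetLike.GradedSMul grading (quotientGrading I) where
  smul_mem := by
    rintro i j a _ ha ⟨x, hx, rfl⟩
    exact ⟨a * x, SetLike.mul_mem_graded ha hx, rfl⟩

/-- The graded left `A`-module `A/A(Sq⁴, Sq⁵Sq¹)`, generated in degree `0`. -/
noncomputable def moduleL : GradedModuleCat grading :=
  GradedModuleCat.of grading
    (quotientGrading (Submodule.span SteenrodAlgebra {Sq 4, Sq 5 * Sq 1}))

end SteenrodAlgebra

/-! ### The bigraded groups in the answer

A bigraded `ℤ/2`-vector space is given by a basis `ι` and the bidegrees `(x, y)` of its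
elements; in `Ext^{s,t}` one has `x = t - s` and `y = s`. -/

/-- The part of bidegree `p` of the vector space with basis `ι`, the basis elements having
bidegrees `d`. -/
def bigradedPart {ι : Type} (d : ι → ℤ × ℤ) (p : ℤ × ℤ) : Submodule (ZMod 2) (ι →₀ ZMod 2) :=
  Finsupp.supported (ZMod 2) (ZMod 2) {i | d i = p}

/-- The standard basis of `bo_*`. -/
inductive BoBasis
  /-- infinite towers in the stems `8 i` -/
  | tower₀ (i j : ℕ)
  | eta (i : ℕ)
  | etaSq (i : ℕ)
  /-- infinite towers in the stems `8 i + 4` -/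
  | tower₄ (i j : ℕ)

def BoBasis.bideg : BoBasis → ℤ × ℤ
  | tower₀ i j => (8 * i, 4 * i + j)
  | eta i => (8 * i + 1, 4 * i + 1)
  | etaSq i => (8 * i + 2, 4 * i + 2)
  | tower₄ i j => (8 * i + 4, 4 * i + 3 + j)

/-- The standard basis of `bsp_*`. -/
inductive BspBasis
  /-- infinite towers in the stems `8 i` -/
  | tower₀ (i j : ℕ)
  /-- infinite towers in the stems `8 i + 4` -/
  | tower₄ (i j : ℕ)
  | eta (i : ℕ)
  | etaSq (i : ℕ)

def BspBasis.bideg : BspBasis → ℤ × ℤ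
  | tower₀ i j => (8 * i, 4 * i + j)
  | tower₄ i j => (8 * i + 4, 4 * i + 1 + j)
  | eta i => (8 * i + 5, 4 * i + 2)
  | etaSq i => (8 * i + 6, 4 * i + 3)

/-- The bidegrees of the basis elements `b vᵏ gᵢ` of `R[v]⟨g₀, …, gᵣ₋₁⟩`, where `b` runs through a
basis `β` of `R`. -/
def polyFreeBideg {β : Type} (dR : β → ℤ × ℤ) (v : ℤ × ℤ) {r : ℕ} (g : Fin r → ℤ × ℤ) :
    β × ℕ × Fin r → ℤ × ℤ :=
  fun e => dR e.1 + e.2.1 • v + g e.2.2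

/-- The bidegree of the only basis element of `ℤ/2`. -/
def unitBideg : Unit → ℤ × ℤ := fun _ => (0, 0)

/-- `ℤ/2[v₂⁸]⟨a_{0,0}, h₂a_{0,0}, a_{14,2}, h₁a_{14,2}, h₂a_{14,2}, a_{31,5}, h₂a_{31,5},
a_{39,7}⟩` in bidegree `p`. -/
abbrev v28Part (p : ℤ × ℤ) : Submodule (ZMod 2) (Unit × ℕ × Fin 8 →₀ ZMod 2) :=
  bigradedPart (polyFreeBideg unitBideg (48, 8)
    ![(0, 0), (0, 0) + (3, 1), (14, 2), (14, 2) + (1, 1), (14, 2) + (3, 1), (31, 5),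
      (31, 5) + (3, 1), (39, 7)]) p

open Classical in
/-- The projection `bo_*[v₂⁴]⟨a_{5,1}, a_{21,3}⟩ → ℤ/2[v₂⁸]⟨a_{21,3}⟩`: it sends each
`v₂^{8m} a_{21,3}` to itself and every other basis element to zero. -/
noncomputable def boProjection :
    (BoBasis × ℕ × Fin 2 →₀ ZMod 2) →ₗ[ZMod 2] (Unit × ℕ × Fin 1 →₀ ZMod 2) :=
  Finsupp.linearCombination (ZMod 2) fun e =>
    if e.1 = BoBasis.tower₀ 0 0 ∧ Even e.2.1 ∧ e.2.2 = 1 then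
      Finsupp.single ((), e.2.1 / 2, 0) 1 else 0

/-- `ker(bo_*[v₂⁴]⟨a_{5,1}, a_{21,3}⟩ → ℤ/2[v₂⁸]⟨a_{21,3}⟩)` in bidegree `p`. -/
noncomputable abbrev boKernelPart (p : ℤ × ℤ) :
    Submodule (ZMod 2) (BoBasis × ℕ × Fin 2 →₀ ZMod 2) :=
  LinearMap.ker boProjection ⊓
    bigradedPart (polyFreeBideg BoBasis.bideg (24, 4) ![(5, 1), (21, 3)]) p

/-- `bsp_*[v₂⁴]⟨a_{9,2}, a_{17,4}⟩` in bidegree `p`. -/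
abbrev bspPart (p : ℤ × ℤ) : Submodule (ZMod 2) (BspBasis × ℕ × Fin 2 →₀ ZMod 2) :=
  bigradedPart (polyFreeBideg BspBasis.bideg (24, 4) ![(9, 2), (17, 4)]) p

/-!
The Ext groups are computed from short exact sequences `0 → Kᵢ₊₁ → Cᵢ → Kᵢ → 0` of graded
`A`-modules that begin with `K₀ = A/A(Sq⁴, Sq⁵ Sq¹)` and in which the `Ext` groups of the `Cᵢ` are
known (`coker`, `resGens`, `resMid`, `resMap`). Each `Cᵢ` is a direct sum of suspensions of the
modules `A`, `A/A(Sq¹, Sq²)`, `A/A(Sq¹, Sq² Sq¹ Sq²)`, and of a module on two generators. Their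
`Ext` groups are `ℤ/2`, `bo_*`, `bsp_*`, and `bo_*` without its bottom class, moved down by one
filtration (`extInfo_free`, `extInfo_bo`, `extInfo_bsp`, `extInfo_twoGen`); the last module is
responsible for the kernel in the second summand of the answer. Since `K₉` is the 56-fold suspension
of `K₁` (`coker_nine`), the sequences repeat with period 8, and a period is multiplication by the
class `v₂⁸` of bidegree `(48, 8)`.

Exactness of the sequences is a finite computation. All relations have coefficients in the
subalgebra `A(2)` generated by `Sq¹`, `Sq²`, `Sq⁴`, and `A` is free as a right module over `A(2)`
(`exists_basis_over_subalgebraA2`). The proof of freeness is that of Milnor and Moore: contraction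
of the coproduct of `A` with functionals on `A/A(Sq¹, Sq², Sq⁴)` separates the elements of a basis.
That the Adem relations are compatible with the coproduct follows from their reformulation by
Bullett and Macdonald as the symmetry of a generating function, which is multiplicative
(`isBM_of_adem`, `IsBM.adem`, `IsBM.conv`). Exactness is thereby a statement of linear algebra over
`A(2)`, which has a basis of 64 words in `Sq¹`, `Sq²`, `Sq⁴`. They span by a confluent system of
rewriting rules. They are independent since the top word acts nontrivially on a monomial in three
variables, and since the pairing of `A(2)` with itself by the coefficient of the top word in a
product is perfect (`testBit_eq_false_of_maskVal_eq_zero`). With vectors encoded as bit masks,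
Gaussian elimination, evaluated by the kernel of the proof checker, verifies exactness
(`checkExact`, `comap_rowSpan_of_checkExact`).

The long exact sequences break up into short ones, because restriction `Ext(Cᵢ) → Ext(Kᵢ₊₁)` is
zero; thus the classes of `Kᵢ` are those of `Cᵢ` and, one filtration higher, those of `Kᵢ₊₁`. By an
enumeration of bidegrees, a class of `Cᵢ` and a class of `Kᵢ₊₁` share a bidegree only if their stems
are 6 and 5 modulo 8 in the numbering of the answer (`Class.residue_eq_of_lt`). There `h₀` kills the
first class for degree reasons, while it acts injectively on the stems 5 modulo 8 of `Kᵢ₊₁`, which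
consist of infinite towers; as restriction commutes with `h₀`, it is zero
(`ExtInfo.restrictsToZero`). Injectivity of `h₀` is carried along with the bases of the `Ext` groups
(`ExtInfo`), starting from `A/A Sq¹` (`mulInjective_sqOne`). One family escapes this argument, the
classes `η²` in the summand `A/A(Sq¹, Sq²)` of `C₇`. The map from `K₈` to this summand factors
through a suspension of `A/A(Sq⁴, Sq⁵ Sq¹)` itself (`exists_factorization`), which has no `Ext` in
the bidegrees in question (`CokerInfo.seven`).

The whole argument is an induction on the filtration (`cokerInfo_four_and_one`), in which `C₃`,
being free, makes it possible to pass from one filtration to the next. The classes that the `Cᵢ`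
contribute are then matched with the basis of the answer (`Class.toAnswer`).
-/

/-! ### The Bullett–Macdonald form of the Adem relations -/

section BullettMacdonald

open MvPolynomial TensorProduct Finset

/-- The polynomial `(s² + st)ⁱ t²ʲ`, the coefficient of `Sqⁱ Sqʲ` in the Bullett–Macdonald
generating function. -/
noncomputable def bmPoly (i j : ℕ) : MvPolynomial (Fin 2) (ZMod 2) :=
  (X 0 ^ 2 + X 0 * X 1) ^ i * (X 1 ^ 2) ^ j

/-- The exchange of the two variables `s` and `t`. -/
noncomputable def bmSwap : MvPolynomial (Fin 2) (ZMod 2) →ₐ[ZMod 2] MvPolynomial (Fin 2) (ZMod 2) :=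
  rename (Equiv.swap 0 1)

theorem bmSwap_X_zero : bmSwap (X 0) = X 1 := by simp [bmSwap]

theorem bmSwap_X_one : bmSwap (X 1) = X 0 := by simp [bmSwap]

theorem bmPoly_mul (i j i' j' : ℕ) :
    bmPoly i j * bmPoly i' j' = bmPoly (i + i') (j + j') := by
  simp only [bmPoly, pow_add]
  ring

variable {M : Type} [AddCommMonoid M] [Module (ZMod 2) M]

/-- The part of total degree `n` of the Bullett–Macdonald generating function of a family
`e i j`, which stands for `Sqⁱ Sqʲ`. -/
noncomputable def bmSum (e : ℕ → ℕ → M) (n : ℕ) : MvPolynomial (Fin 2) (ZMod 2) ⊗[ZMod 2] M :=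
  ∑ x ∈ antidiagonal n, bmPoly x.1 x.2 ⊗ₜ e x.1 x.2

/-- The Bullett–Macdonald identity in degree `n`: the generating function is symmetric. -/
def IsBM (e : ℕ → ℕ → M) (n : ℕ) : Prop :=
  bmSwap.toLinearMap.rTensor M (bmSum e n) = bmSum e n

/-- The right hand side of the Adem relation for `Sqᵃ Sqᵇ`. -/
def ademSum (e : ℕ → ℕ → M) (a b : ℕ) : M :=
  ∑ j ∈ range (a / 2 + 1), ((b - 1 - j).choose (a - 2 * j) : ZMod 2) • e (a + b - j) j

/-- The linear functional that isolates `Sqᵃ Sqᵇ` in the Bullett–Macdonald identity: put `t = 1`,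
`u = s² + s`, and take the residue of `u^{-a-1} du`, that is, the coefficient of `sᵃ` after
multiplication by `(1 + s)^{-a-1}`. -/
noncomputable def bmResidue (a : ℕ) : MvPolynomial (Fin 2) (ZMod 2) →ₗ[ZMod 2] ZMod 2 :=
  (PowerSeries.coeff a).comp ((LinearMap.mulRight (ZMod 2)
    ((PowerSeries.invOneSubPow (ZMod 2) (a + 1) : (PowerSeries (ZMod 2))ˣ) :
      PowerSeries (ZMod 2))).comp
    (aeval (R := ZMod 2) ![(PowerSeries.X : PowerSeries (ZMod 2)), 1]).toLinearMap)

theorem bmResidue_apply (a : ℕ) (f : MvPolynomial (Fin 2) (ZMod 2)) :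
    bmResidue a f = PowerSeries.coeff a
      (aeval ![(PowerSeries.X : PowerSeries (ZMod 2)), 1] f *
        (PowerSeries.invOneSubPow (ZMod 2) (a + 1)).val) := rfl

theorem powerSeries_one_add_X :
    (1 + PowerSeries.X : PowerSeries (ZMod 2)) = 1 - PowerSeries.X := by
  have h2 : (2 : PowerSeries (ZMod 2)) = 0 := by
    rw [← map_ofNat (PowerSeries.C (R := ZMod 2)) 2, show (OfNat.ofNat 2 : ZMod 2) = 0 from rfl,
      map_zero]
  linear_combination PowerSeries.X * h2

theorem oneSub_pow_mul_inv (d i : ℕ) (h : i ≤ d) :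
    (1 - PowerSeries.X : PowerSeries (ZMod 2)) ^ i * (PowerSeries.invOneSubPow (ZMod 2) d).val =
      (PowerSeries.invOneSubPow (ZMod 2) (d - i)).val := by
  obtain ⟨c, rfl⟩ := Nat.exists_eq_add_of_le h
  rw [PowerSeries.invOneSubPow_add, Nat.add_sub_cancel_left, Units.val_mul, ← mul_assoc,
    ← PowerSeries.invOneSubPow_inv_eq_one_sub_pow]
  rw [(PowerSeries.invOneSubPow (ZMod 2) i).inv_val, one_mul]

theorem oneSub_pow_mul_inv' (d i : ℕ) (h : d ≤ i) :
    (1 - PowerSeries.X : PowerSeries (ZMod 2)) ^ i * (PowerSeries.invOneSubPow (ZMod 2) d).val =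
      (1 - PowerSeries.X) ^ (i - d) := by
  obtain ⟨c, rfl⟩ := Nat.exists_eq_add_of_le h
  rw [pow_add, mul_right_comm, oneSub_pow_mul_inv d d le_rfl, Nat.sub_self, Nat.add_sub_cancel_left,
    PowerSeries.invOneSubPow_zero, Units.val_one, one_mul]

/-- The residue of `uⁱ⁻ᵃ⁻¹ du` is `1` for `i = a`. For `i < a` it is a central binomial coefficient,
which is even. -/
theorem bmResidue_bmPoly (a i j : ℕ) : bmResidue a (bmPoly i j) = if i = a then 1 else 0 := by
  have h : aeval ![(PowerSeries.X : PowerSeries (ZMod 2)), 1] (bmPoly i j) =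
      PowerSeries.X ^ i * (1 - PowerSeries.X) ^ i := by
    rw [← powerSeries_one_add_X, ← mul_pow]
    simp only [bmPoly, map_mul, map_pow, map_add, aeval_X]
    simp
    ring
  rw [bmResidue_apply, h, mul_assoc, PowerSeries.coeff_X_pow_mul']
  rcases lt_trichotomy i a with hi | rfl | hi
  · rw [if_pos hi.le, if_neg hi.ne, oneSub_pow_mul_inv _ _ (by omega)]
    obtain ⟨k, rfl⟩ := Nat.exists_eq_add_of_lt hi
    rw [show i + k + 1 + 1 - i = (k + 1) + 1 by omega, show i + k + 1 - i = k + 1 by omega,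
      PowerSeries.invOneSubPow_val_succ_eq_mk_add_choose, PowerSeries.coeff_mk]
    have h2 := Nat.two_dvd_centralBinom_succ k
    rw [Nat.centralBinom, two_mul] at h2
    exact (ZMod.natCast_eq_zero_iff _ _).2 h2
  · rw [if_pos le_rfl, if_pos rfl, oneSub_pow_mul_inv _ _ (by omega), Nat.sub_self,
      Nat.add_sub_cancel_left, PowerSeries.invOneSubPow_val_succ_eq_mk_add_choose,
      PowerSeries.coeff_mk]
    simp
  · rw [if_neg (by omega), if_neg hi.ne']

/-- The residue of the polynomial with `s` and `t` exchanged is the binomial coefficient of the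
Adem relation. -/
theorem bmResidue_bmSwap_bmPoly (a i j : ℕ) (h : a < 2 * (i + j - a)) (ha : a ≤ i + j) :
    bmResidue a (bmSwap (bmPoly i j)) =
      if j ≤ a / 2 then ((i - a - 1).choose (a - 2 * j) : ZMod 2) else 0 := by
  have h : aeval ![(PowerSeries.X : PowerSeries (ZMod 2)), 1] (bmSwap (bmPoly i j)) =
      PowerSeries.X ^ (2 * j) * (1 - PowerSeries.X) ^ i := by
    rw [← powerSeries_one_add_X]
    simp only [bmPoly, map_mul, map_pow, map_add, bmSwap_X_zero, bmSwap_X_one, aeval_X]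
    simp
    ring
  rw [bmResidue_apply, h, mul_assoc, PowerSeries.coeff_X_pow_mul']
  by_cases hj : j ≤ a / 2
  · rw [if_pos (by omega), if_pos hj, oneSub_pow_mul_inv' _ _ (by omega), ← powerSeries_one_add_X,
      Nat.sub_add_eq]
    have := Polynomial.coeff_one_add_X_pow (ZMod 2) (i - a - 1) (a - 2 * j)
    rw [← this, ← Polynomial.coeff_coe]
    simp
  · rw [if_neg (by omega), if_neg hj]

/-- The Bullett–Macdonald identity implies the Adem relations. -/
theorem IsBM.adem {e : ℕ → ℕ → M} {a b : ℕ} (he : IsBM e (a + b)) (h : a < 2 * b) :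
    e a b = ademSum e a b := by
  have key := congr_arg (fun z => TensorProduct.lid (ZMod 2) M ((bmResidue a).rTensor M z)) he
  simp only [bmSum, map_sum, LinearMap.rTensor_tmul, TensorProduct.lid_tmul] at key
  have hr : ∑ x ∈ antidiagonal (a + b), bmResidue a (bmPoly x.1 x.2) • e x.1 x.2 = e a b := by
    rw [sum_eq_single (a, b)]
    · simp [bmResidue_bmPoly]
    · intro x hx hne
      rw [bmResidue_bmPoly, if_neg, zero_smul]
      intro hxa
      rw [HasAntidiagonal.mem_antidiagonal] at hx
      exact hne (Prod.ext hxa (by simp; omega))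
    · simp
  rw [hr] at key
  rw [← key, ademSum, ← Nat.sum_antidiagonal_swap, Nat.sum_antidiagonal_eq_sum_range_succ_mk]
  symm
  refine sum_subset_zero_on_sdiff ?_ ?_ ?_
  · exact range_subset_range.2 (by omega)
  · intro j hj
    simp only [mem_sdiff, mem_range] at hj
    have := bmResidue_bmSwap_bmPoly a (a + b - j) j (by omega) (by omega)
    simp only [Prod.swap, AlgHom.toLinearMap_apply]
    rw [this, if_neg (by omega), zero_smul]
  · intro j hj
    rw [mem_range] at hj
    have := bmResidue_bmSwap_bmPoly a (a + b - j) j (by omega) (by omega)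
    simp only [Prod.swap, AlgHom.toLinearMap_apply]
    rw [this, if_pos (by omega), show a + b - j - a - 1 = b - 1 - j by omega]

/-- Products of families that satisfy the Bullett–Macdonald identity satisfy it as well: this is
the compatibility of the Adem relations with the Cartan formula. -/
theorem IsBM.conv {M₁ M₂ : Type} [AddCommMonoid M₁] [Module (ZMod 2) M₁] [AddCommMonoid M₂]
    [Module (ZMod 2) M₂] (μ : M₁ →ₗ[ZMod 2] M₂ →ₗ[ZMod 2] M) {e : ℕ → ℕ → M₁} {f : ℕ → ℕ → M₂}
    (he : ∀ n, IsBM e n) (hf : ∀ n, IsBM f n) (n : ℕ) :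
    IsBM (fun i j => ∑ x ∈ antidiagonal i, ∑ y ∈ antidiagonal j, μ (e x.1 y.1) (f x.2 y.2)) n := by
  let R := MvPolynomial (Fin 2) (ZMod 2)
  let m : R ⊗[ZMod 2] M₁ →ₗ[ZMod 2] R ⊗[ZMod 2] M₂ →ₗ[ZMod 2] R ⊗[ZMod 2] M :=
    TensorProduct.map₂ (LinearMap.mul (ZMod 2) R) μ
  have hm : ∀ u v, bmSwap.toLinearMap.rTensor M (m u v) =
      m (bmSwap.toLinearMap.rTensor M₁ u) (bmSwap.toLinearMap.rTensor M₂ v) := by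
    intro u v
    induction u with
    | zero => simp
    | add u u' hu hu' => simp only [map_add, LinearMap.add_apply, hu, hu']
    | tmul p x =>
      induction v with
      | zero => simp
      | add v v' hv hv' => simp only [map_add, hv, hv']
      | tmul q y => simp [m]
  have hs : bmSum (fun i j => ∑ x ∈ antidiagonal i, ∑ y ∈ antidiagonal j,
      μ (e x.1 y.1) (f x.2 y.2)) n = ∑ x ∈ antidiagonal n, m (bmSum e x.1) (bmSum f x.2) := by
    simp only [bmSum, map_sum, LinearMap.sum_apply, TensorProduct.tmul_sum]
    simp only [m, TensorProduct.map₂_apply_tmul]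
    simp only [sum_sigma']
    refine sum_nbij'
      (fun z => ⟨(z.2.1.1 + z.2.2.1, z.2.1.2 + z.2.2.2), (z.2.1.2, z.2.2.2), (z.2.1.1, z.2.2.1)⟩)
      (fun z => ⟨(z.2.2.1 + z.2.1.1, z.2.2.2 + z.2.1.2), (z.2.2.1, z.2.1.1), (z.2.2.2, z.2.1.2)⟩)
      ?_ ?_ ?_ ?_ ?_
    all_goals
      rintro ⟨⟨i, j⟩, ⟨p, p'⟩, ⟨q, q'⟩⟩ h
      simp only [mem_sigma, HasAntidiagonal.mem_antidiagonal] at h ⊢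
    · simp only [and_true]
      omega
    · simp only [and_true]
      omega
    all_goals
      obtain ⟨h1, h2, h3⟩ := h
      subst h2 h3
    · rfl
    · rfl
    · rw [TensorProduct.map_tmul, LinearMap.mul_apply', bmPoly_mul]
  rw [IsBM, hs, map_sum]
  exact sum_congr rfl fun x _ => by rw [hm, he x.1, hf x.2]

/-- The functionals `C(n - 3α, j - α)` on `Sqⁿ⁻ʲ Sqʲ`: up to a sum over monomials, this is the
coefficient of `x₁⁴ ⋯ x_α⁴ x_{α+1}² ⋯ x_{n-2α}² x_{n-2α+1} ⋯` in `Sqⁿ⁻ʲ Sqʲ (x₁ x₂ ⋯)`. -/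
def testFamily (α i j : ℕ) : ZMod 2 :=
  if α ≤ j then ((i + j - 3 * α).choose (j - α) : ZMod 2) else 0

/-- The generating function is the symmetric polynomial
`(s t (s + t))^{2α} (s² + s t + t²)^{n - 3α}`. -/
theorem isBM_testFamily {α n : ℕ} (h : 3 * α ≤ n) : IsBM (testFamily α) n := by
  have hs : bmSum (testFamily α) n = ((X 0 * (X 0 + X 1) * X 1) ^ (2 * α) *
      (X 0 ^ 2 + X 0 * X 1 + X 1 ^ 2) ^ (n - 3 * α) : MvPolynomial (Fin 2) (ZMod 2)) ⊗ₜ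
        (1 : ZMod 2) := by
    obtain ⟨m, rfl⟩ := Nat.exists_eq_add_of_le h
    have h1 : ∀ x ∈ antidiagonal (3 * α + m), bmPoly x.1 x.2 ⊗ₜ testFamily α x.1 x.2 =
        ((if α ≤ x.2 then (m.choose (x.2 - α) : ZMod 2) else 0) • bmPoly x.1 x.2) ⊗ₜ[ZMod 2]
          (1 : ZMod 2) := by
      intro x hx
      rw [HasAntidiagonal.mem_antidiagonal] at hx
      rw [TensorProduct.smul_tmul, smul_eq_mul, mul_one, testFamily, hx, Nat.add_sub_cancel_left]
    rw [bmSum, sum_congr rfl h1, ← TensorProduct.sum_tmul]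
    congr 1
    rw [Nat.add_sub_cancel_left, add_pow, mul_sum, ← Nat.sum_antidiagonal_swap,
      Nat.sum_antidiagonal_eq_sum_range_succ_mk]
    simp only [Prod.swap]
    have h2 : ∀ k ∈ range (m + 1), ((X 0 * (X 0 + X 1) * X 1) ^ (2 * α) *
        ((X 0 ^ 2 + X 0 * X 1) ^ k * (X 1 ^ 2) ^ (m - k) *
          (m.choose k : MvPolynomial (Fin 2) (ZMod 2)))) =
        (m.choose (m - k) : ZMod 2) • bmPoly (2 * α + k) (α + (m - k)) := by
      intro k hk
      rw [mem_range] at hk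
      rw [Nat.choose_symm (by omega), Nat.cast_smul_eq_nsmul, nsmul_eq_mul, bmPoly,
        show (X 0 * (X 0 + X 1) * X 1 : MvPolynomial (Fin 2) (ZMod 2)) =
          (X 0 ^ 2 + X 0 * X 1) * X 1 by ring, mul_pow _ (X 1)]
      ring
    rw [sum_congr rfl h2]
    refine (sum_of_injOn (fun k => α + (m - k)) (fun a ha b hb hab => ?_)
      (fun k hk => ?_) (fun j hj hj' => ?_) fun k hk => ?_).symm
    · simp only [coe_range, Set.mem_Iio] at ha hb hab
      omega
    · simp only [coe_range, Set.mem_Iio] at hk ⊢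
      omega
    · rw [mem_range] at hj
      split_ifs with hαj
      · rw [Nat.choose_eq_zero_of_lt, Nat.cast_zero, zero_smul]
        by_contra hlt
        exact hj' ⟨m - (j - α), by simp only [coe_range, Set.mem_Iio]; omega, by simp only; omega⟩
      · exact zero_smul _ _
    · rw [mem_range] at hk
      rw [if_pos (Nat.le_add_right _ _), Nat.add_sub_cancel_left,
        show 2 * α + k = 3 * α + m - (α + (m - k)) by omega]
  rw [IsBM, hs, LinearMap.rTensor_tmul]
  congr 1
  simp only [AlgHom.toLinearMap_apply, map_mul, map_pow, map_add, bmSwap_X_zero, bmSwap_X_one]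
  ring

/-- The Adem relations imply the Bullett–Macdonald identity. Both sides reduce to combinations of
the admissible `e (n - j) j`, `3 j ≤ n`, with coefficients that do not depend on `e`; these are seen
to agree on the families `testFamily α`. -/
theorem isBM_of_adem {e : ℕ → ℕ → M} {n : ℕ}
    (he : ∀ a b, a + b = n → a < 2 * b → e a b = ademSum e a b) : IsBM e n := by
  have two : ∀ {M' : Type} [AddCommMonoid M'] [Module (ZMod 2) M'] (x : M'), x + x = 0 :=
    fun x => by rw [← two_smul (ZMod 2), show (2 : ZMod 2) = 0 from rfl, zero_smul]
  let D : ℕ → ℕ → MvPolynomial (Fin 2) (ZMod 2) := fun i j => bmSwap (bmPoly i j) + bmPoly i j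
  -- coefficients of the reduction of `e a b` to admissible terms
  let c : ℕ → ℕ → ℕ → ZMod 2 := fun a b j =>
    if a < 2 * b then (if j < a / 2 + 1 then ((b - 1 - j).choose (a - 2 * j) : ZMod 2) else 0)
    else if j = b then 1 else 0
  have red : ∀ {M' : Type} [AddCommMonoid M'] [Module (ZMod 2) M'] (f : ℕ → ℕ → M'),
      (∀ a b, a + b = n → a < 2 * b → f a b = ademSum f a b) → ∀ x ∈ antidiagonal n,
      f x.1 x.2 = ∑ j ∈ range (n / 3 + 1), c x.1 x.2 j • f (n - j) j := by
    rintro M' _ _ f hf ⟨a, b⟩ hx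
    rw [HasAntidiagonal.mem_antidiagonal] at hx
    simp only at hx ⊢
    by_cases hab : a < 2 * b
    · rw [hf a b hx hab, ademSum]
      refine sum_subset_zero_on_sdiff (range_subset_range.2 (by omega)) ?_ ?_
      · intro j hj
        rw [mem_sdiff, mem_range, mem_range] at hj
        simp only [c]
        rw [if_pos hab, if_neg hj.2, zero_smul]
      · intro j hj
        rw [mem_range] at hj
        simp only [c]
        rw [if_pos hab, if_pos hj, hx]
    · rw [sum_eq_single b]
      · simp only [c]
        rw [if_neg hab, if_pos trivial, one_smul, ← hx, Nat.add_sub_cancel]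
      · intro j _ hj
        simp only [c]
        rw [if_neg hab, if_neg hj, zero_smul]
      · intro hb
        rw [mem_range] at hb
        omega
  -- the coefficient of the `j`th admissible term in the defect of symmetry
  let D' : ℕ → MvPolynomial (Fin 2) (ZMod 2) := fun j =>
    ∑ x ∈ antidiagonal n, c x.1 x.2 j • D x.1 x.2
  have hD : ∀ {M' : Type} [AddCommMonoid M'] [Module (ZMod 2) M'] (f : ℕ → ℕ → M'),
      (∀ a b, a + b = n → a < 2 * b → f a b = ademSum f a b) →
      bmSwap.toLinearMap.rTensor M' (bmSum f n) + bmSum f n =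
        ∑ j ∈ range (n / 3 + 1), D' j ⊗ₜ f (n - j) j := by
    intro M' _ _ f hf
    simp only [bmSum, map_sum, LinearMap.rTensor_tmul, D', TensorProduct.sum_tmul]
    rw [← sum_add_distrib, sum_comm]
    refine sum_congr rfl fun x hx => ?_
    rw [← TensorProduct.add_tmul, AlgHom.toLinearMap_apply, red f hf x hx, TensorProduct.tmul_sum]
    refine sum_congr rfl fun j _ => ?_
    rw [TensorProduct.smul_tmul]
  -- The matrix `testFamily α (n - j) j` is unitriangular, so the defect coefficients vanish one
  -- after the other, from the largest `α` downwards.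
  have hzero : ∀ k, ∀ α, α + k = n / 3 → D' α = 0 := by
    intro k
    induction k using Nat.strong_induction_on with
    | _ k ih =>
      intro α hα
      have hbm := isBM_testFamily (α := α) (n := n) (by omega)
      have h := hD (testFamily α) fun a b hn hab => IsBM.adem (hn.symm ▸ hbm) hab
      rw [IsBM] at hbm
      rw [hbm, two, sum_eq_single α] at h
      · have h' := congr_arg (TensorProduct.rid (ZMod 2) _) h
        rw [map_zero, TensorProduct.rid_tmul, testFamily, if_pos le_rfl, Nat.sub_self,
          Nat.choose_zero_right, Nat.cast_one, one_smul] at h'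
        exact h'.symm
      · intro j hj hne
        rw [mem_range] at hj
        rcases lt_or_gt_of_ne hne with hlt | hgt
        · rw [testFamily, if_neg (by omega), TensorProduct.tmul_zero]
        · rw [ih (n / 3 - j) (by omega) j (by omega), TensorProduct.zero_tmul]
      · intro hα'
        rw [mem_range] at hα'
        omega
  have h := hD e he
  rw [sum_eq_zero fun j hj => by
    rw [mem_range] at hj
    rw [hzero (n / 3 - j) j (by omega), TensorProduct.zero_tmul]] at h
  rw [IsBM, ← add_zero (bmSwap.toLinearMap.rTensor M (bmSum e n)), ← two (bmSum e n), ← add_assoc,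
    h, zero_add]

end BullettMacdonald

/-! ### The coproduct and the homogeneous parts -/

namespace SteenrodAlgebra

open TensorProduct Finset

theorem Sq_zero : Sq 0 = 1 := by
  rw [Sq, RingQuot.mkAlgHom_rel (ZMod 2) AdemRel.sq_zero, map_one]

theorem adem {a b : ℕ} (ha : 0 < a) (hab : a < 2 * b) :
    Sq a * Sq b = ademSum (fun i j => Sq i * Sq j) a b := by
  have h := RingQuot.mkAlgHom_rel (ZMod 2) (AdemRel.adem a b ha hab)
  simp only [map_mul, map_sum, map_smul] at h
  exact h

/-- An algebra homomorphism out of the Steenrod algebra is given by elements that satisfy the Adem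
relations. -/
noncomputable def lift {E : Type} [Ring E] [Algebra (ZMod 2) E] (f : ℕ → E) (h0 : f 0 = 1)
    (h : ∀ a b, 0 < a → a < 2 * b → f a * f b = ademSum (fun i j => f i * f j) a b) :
    SteenrodAlgebra →ₐ[ZMod 2] E :=
  RingQuot.liftAlgHom (ZMod 2) ⟨FreeAlgebra.lift (ZMod 2) f, by
    intro x y hxy
    induction hxy with
    | sq_zero => rw [FreeAlgebra.lift_ι_apply, h0, map_one]
    | adem a b ha hab =>
      simp only [map_mul, map_sum, map_smul, FreeAlgebra.lift_ι_apply]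
      exact h a b ha hab⟩

theorem lift_Sq {E : Type} [Ring E] [Algebra (ZMod 2) E] (f : ℕ → E) (h0 : f 0 = 1)
    (h : ∀ a b, 0 < a → a < 2 * b → f a * f b = ademSum (fun i j => f i * f j) a b) (n : ℕ) :
    lift f h0 h (Sq n) = f n := by
  rw [lift, Sq, RingQuot.liftAlgHom_mkAlgHom_apply, FreeAlgebra.lift_ι_apply]

/-- A property of elements of `A` that holds for `1` and is preserved by sums and by left
multiplication by the squares holds for all of them. -/
@[elab_as_elim]
theorem induction_left {p : SteenrodAlgebra → Prop} (h1 : p 1) (hadd : ∀ x y, p x → p y → p (x + y))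
    (hmul : ∀ n x, p x → p (Sq n * x)) (x : SteenrodAlgebra) : p x := by
  have h0 : p 0 := by
    have h2 : (1 : SteenrodAlgebra) + 1 = 0 := by
      rw [← two_smul (ZMod 2), show (2 : ZMod 2) = 0 from rfl, zero_smul]
    rw [← h2]
    exact hadd _ _ h1 h1
  have hx : ∀ x : FreeAlgebra (ZMod 2) ℕ, ∀ y, p y →
      p (RingQuot.mkAlgHom (ZMod 2) AdemRel x * y) := by
    intro x
    induction x using FreeAlgebra.induction with
    | grade0 r =>
      intro y hy
      rw [AlgHom.commutes, ← Algebra.smul_def]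
      fin_cases r
      · change p ((0 : ZMod 2) • y)
        rwa [zero_smul]
      · change p ((1 : ZMod 2) • y)
        rwa [one_smul]
    | grade1 n => exact fun y hy => hmul n y hy
    | mul a b ha hb =>
      intro y hy
      rw [map_mul, mul_assoc]
      exact ha _ (hb _ hy)
    | add a b ha hb =>
      intro y hy
      rw [map_add, add_mul]
      exact hadd _ _ (ha _ hy) (hb _ hy)
  obtain ⟨z, rfl⟩ := RingQuot.mkAlgHom_surjective (ZMod 2) AdemRel x
  simpa using hx z 1 h1

/-- The relations with `a = 0`, which are not among the defining ones, hold trivially. -/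
theorem isBM_Sq (n : ℕ) : IsBM (fun i j => Sq i * Sq j) n := by
  refine isBM_of_adem fun a b _ hab => ?_
  rcases Nat.eq_zero_or_pos a with rfl | ha
  · simp [ademSum, Sq_zero]
  · exact adem ha hab

/-- The coproduct of the Steenrod algebra. -/
noncomputable def coproduct :
    SteenrodAlgebra →ₐ[ZMod 2] SteenrodAlgebra ⊗[ZMod 2] SteenrodAlgebra :=
  lift (fun n => ∑ x ∈ antidiagonal n, Sq x.1 ⊗ₜ[ZMod 2] Sq x.2)
    (by simp [Sq_zero, Algebra.TensorProduct.one_def]) (by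
      intro a b _ hab
      refine IsBM.adem (e := fun i j => (∑ x ∈ antidiagonal i, Sq x.1 ⊗ₜ[ZMod 2] Sq x.2) *
        ∑ x ∈ antidiagonal j, Sq x.1 ⊗ₜ[ZMod 2] Sq x.2) ?_ hab
      have h := IsBM.conv (TensorProduct.mk (ZMod 2) SteenrodAlgebra SteenrodAlgebra)
        isBM_Sq isBM_Sq (a + b)
      convert h using 3 with i j
      rw [sum_mul_sum]
      simp only [Algebra.TensorProduct.tmul_mul_tmul, TensorProduct.mk_apply])

theorem coproduct_Sq (n : ℕ) :
    coproduct (Sq n) = ∑ x ∈ antidiagonal n, Sq x.1 ⊗ₜ[ZMod 2] Sq x.2 := lift_Sq _ _ _ n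

open Polynomial in
/-- The algebra homomorphism `A → A[T]` that multiplies elements of degree `n` by `Tⁿ`. -/
noncomputable def degreeHom : SteenrodAlgebra →ₐ[ZMod 2] SteenrodAlgebra[X] :=
  lift (fun n => monomial n (Sq n)) (by rw [Sq_zero]; rfl) (by
    intro a b ha hab
    rw [ademSum, monomial_mul_monomial, adem ha hab, ademSum, map_sum]
    refine sum_congr rfl fun j hj => ?_
    rw [mem_range] at hj
    rw [monomial_mul_monomial, smul_monomial, Nat.sub_add_cancel (by omega)])

open Polynomial in
/-- The projection of `A` onto its part of degree `n`. -/
noncomputable def proj (n : ℕ) : SteenrodAlgebra →ₗ[ZMod 2] SteenrodAlgebra :=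
  ((lcoeff SteenrodAlgebra n).restrictScalars (ZMod 2)).comp degreeHom.toLinearMap

theorem grading_natCast_induction {n : ℕ} {p : SteenrodAlgebra → Prop} (h0 : p 0)
    (hadd : ∀ x y, p x → p y → p (x + y))
    (h : ∀ l : List ℕ, l.sum = n → p (l.map Sq).prod) {x : SteenrodAlgebra} (hx : x ∈ grading n) :
    p x := by
  induction hx using Submodule.span_induction with
  | mem x hx =>
    obtain ⟨l, hl, rfl⟩ := hx
    exact h l (by exact_mod_cast hl)
  | zero => exact h0
  | add x y _ _ hx hy => exact hadd x y hx hy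
  | smul a x _ hx =>
    fin_cases a
    · change p ((0 : ZMod 2) • x)
      rwa [zero_smul]
    · change p ((1 : ZMod 2) • x)
      rwa [one_smul]

theorem degreeHom_of_mem {n : ℕ} {x : SteenrodAlgebra} (hx : x ∈ grading n) :
    degreeHom x = Polynomial.monomial n x := by
  refine grading_natCast_induction (p := fun x => degreeHom x = Polynomial.monomial n x)
    ?_ ?_ ?_ hx
  · simp
  · intro x y hx hy
    rw [map_add, map_add, hx, hy]
  · rintro l rfl
    clear hx
    induction l with
    | nil => simp only [List.map_nil, List.prod_nil, List.sum_nil, map_one]; rfl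
    | cons k l ih =>
      rw [List.map_cons, List.prod_cons, map_mul, List.sum_cons, ih, degreeHom, lift_Sq,
        Polynomial.monomial_mul_monomial]

theorem proj_of_mem {n m : ℕ} {x : SteenrodAlgebra} (hx : x ∈ grading m) :
    proj n x = if m = n then x else 0 := by
  change (degreeHom x).coeff n = _
  rw [degreeHom_of_mem hx, Polynomial.coeff_monomial]

theorem grading_of_neg {n : ℤ} (hn : n < 0) : grading n = ⊥ := by
  rw [grading, Submodule.span_eq_bot]
  rintro _ ⟨l, hl, rfl⟩
  omega

theorem Sq_mem (n : ℕ) : Sq n ∈ grading n := Submodule.subset_span ⟨[n], by simp, by simp⟩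

theorem mul_mem_grading {m n : ℕ} {x y : SteenrodAlgebra} (hx : x ∈ grading m)
    (hy : y ∈ grading n) : x * y ∈ grading ((m + n : ℕ) : ℤ) := by
  have := SetLike.mul_mem_graded hx hy
  rwa [← Nat.cast_add] at this

theorem proj_Sq_mul (k n : ℕ) (x : SteenrodAlgebra) :
    proj n (Sq k * x) = if k ≤ n then Sq k * proj (n - k) x else 0 := by
  change (degreeHom (Sq k * x)).coeff n = if k ≤ n then Sq k * (degreeHom x).coeff (n - k) else 0
  rw [map_mul, degreeHom_of_mem (Sq_mem k), ← Polynomial.C_mul_X_pow_eq_monomial, mul_assoc,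
    Polynomial.X_pow_mul, Polynomial.coeff_C_mul, Polynomial.coeff_mul_X_pow', mul_ite, mul_zero]

theorem proj_mem (n : ℕ) (x : SteenrodAlgebra) : proj n x ∈ grading n := by
  induction x using induction_left generalizing n with
  | h1 =>
    rw [proj_of_mem (m := 0) (SetLike.one_mem_graded grading)]
    split_ifs with h
    · subst h
      exact SetLike.one_mem_graded grading
    · exact Submodule.zero_mem _
  | hadd x y hx hy =>
    rw [map_add]
    exact Submodule.add_mem _ (hx n) (hy n)
  | hmul k x hx =>
    rw [proj_Sq_mul]
    split_ifs with h
    · have := mul_mem_grading (Sq_mem k) (hx (n - k))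
      rwa [Nat.add_sub_cancel' h] at this
    · exact Submodule.zero_mem _

theorem proj_mul {m n : ℕ} (x : SteenrodAlgebra) {y : SteenrodAlgebra} (hy : y ∈ grading m)
    (h : m ≤ n) : proj n (x * y) = proj (n - m) x * y := by
  change (degreeHom (x * y)).coeff n = (degreeHom x).coeff (n - m) * y
  rw [map_mul, degreeHom_of_mem hy]
  obtain ⟨c, rfl⟩ := Nat.exists_eq_add_of_le' h
  rw [Nat.add_sub_cancel, Polynomial.coeff_mul_monomial]

theorem proj_mul_of_lt {m n : ℕ} (x : SteenrodAlgebra) {y : SteenrodAlgebra} (hy : y ∈ grading m)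
    (h : n < m) : proj n (x * y) = 0 := by
  change (degreeHom (x * y)).coeff n = 0
  rw [map_mul, degreeHom_of_mem hy, ← Polynomial.C_mul_X_pow_eq_monomial,
    ← Polynomial.X_pow_mul_C, ← mul_assoc, Polynomial.coeff_mul_C, Polynomial.coeff_mul_X_pow',
    if_neg (by omega), zero_mul]

/-- Every element of `A` is the sum of its homogeneous parts. -/
theorem exists_eq_sum_proj (x : SteenrodAlgebra) :
    ∃ N, ∀ M, N ≤ M → x = ∑ n ∈ range M, proj n x := by
  induction x using induction_left with
  | h1 =>
    refine ⟨1, fun M hM => ?_⟩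
    have h := fun n => proj_of_mem (n := n) (m := 0) (SetLike.one_mem_graded grading)
    simp only [h, sum_ite_eq, mem_range]
    rw [if_pos (by omega)]
  | hadd x y hx hy =>
    obtain ⟨N, hN⟩ := hx
    obtain ⟨N', hN'⟩ := hy
    refine ⟨max N N', fun M hM => ?_⟩
    simp only [map_add, sum_add_distrib]
    rw [← hN M (le_of_max_le_left hM), ← hN' M (le_of_max_le_right hM)]
  | hmul k x hx =>
    obtain ⟨N, hN⟩ := hx
    refine ⟨k + N, fun M hM => ?_⟩
    obtain ⟨c, rfl⟩ := Nat.exists_eq_add_of_le (show k ≤ M by omega)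
    rw [sum_range_add, sum_eq_zero, zero_add]
    · conv_lhs => rw [hN c (by omega), mul_sum]
      refine sum_congr rfl fun n _ => ?_
      rw [proj_Sq_mul, if_pos (by omega), Nat.add_sub_cancel_left]
    · intro n hn
      rw [mem_range] at hn
      rw [proj_Sq_mul, if_neg (by omega)]

end SteenrodAlgebra

/-! ### Freeness over `A(2)` -/

namespace SteenrodAlgebra

open TensorProduct Finset

theorem Sq_one_mul_Sq_two : Sq 1 * Sq 2 = Sq 3 := by
  rw [adem (by norm_num) (by norm_num)]
  simp [ademSum, Sq_zero]

/-- The left ideal generated by `Sq¹`, `Sq²`, `Sq⁴`. -/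
noncomputable def leftIdeal : Submodule SteenrodAlgebra SteenrodAlgebra :=
  Submodule.span SteenrodAlgebra {Sq 1, Sq 2, Sq 4}

theorem Sq_mem_leftIdeal {n : ℕ} (h0 : 0 < n) (h4 : n ≤ 4) : Sq n ∈ leftIdeal := by
  have h2 : Sq 2 ∈ leftIdeal := Submodule.subset_span (by simp)
  interval_cases n
  · exact Submodule.subset_span (by simp)
  · exact h2
  · rw [← Sq_one_mul_Sq_two]
    exact Submodule.smul_mem _ (Sq 1) h2
  · exact Submodule.subset_span (by simp)

theorem mem_leftIdeal_iff {x : SteenrodAlgebra} :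
    x ∈ leftIdeal ↔ ∃ u v w, x = u * Sq 1 + (v * Sq 2 + w * Sq 4) := by
  simp only [leftIdeal, Submodule.mem_span_insert, Submodule.mem_span_singleton, smul_eq_mul]
  constructor
  · rintro ⟨u, _, ⟨v, _, ⟨w, rfl⟩, rfl⟩, rfl⟩
    exact ⟨u, v, w, rfl⟩
  · rintro ⟨u, v, w, rfl⟩
    exact ⟨u, _, ⟨v, _, ⟨w, rfl⟩, rfl⟩, rfl⟩

/-- The subalgebra `A(2)` generated by `Sq¹`, `Sq²`, `Sq⁴`. -/
noncomputable def subalgebraA2 : Subalgebra (ZMod 2) SteenrodAlgebra :=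
  Algebra.adjoin (ZMod 2) {Sq 1, Sq 2, Sq 4}

/-- Contraction of the coproduct with a functional on the first factor. -/
noncomputable def contract (θ : SteenrodAlgebra →ₗ[ZMod 2] ZMod 2) :
    SteenrodAlgebra →ₗ[ZMod 2] SteenrodAlgebra :=
  (TensorProduct.lid (ZMod 2) SteenrodAlgebra).toLinearMap.comp
    ((θ.rTensor SteenrodAlgebra).comp coproduct.toLinearMap)

/-- Contraction with a functional that vanishes on the left ideal of `Sq¹`, `Sq²`, `Sq⁴` is linear
over `A(2)`. -/
theorem contract_mul {θ : SteenrodAlgebra →ₗ[ZMod 2] ZMod 2} (hθ : ∀ x ∈ leftIdeal, θ x = 0)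
    (x : SteenrodAlgebra) {b : SteenrodAlgebra} (hb : b ∈ subalgebraA2) :
    contract θ (x * b) = contract θ x * b := by
  induction hb using Algebra.adjoin_induction generalizing x with
  | mem b hb =>
    obtain ⟨n, hn, rfl⟩ : ∃ n ≤ 4, b = Sq n := by
      rcases hb with rfl | rfl | rfl
      exacts [⟨1, by norm_num, rfl⟩, ⟨2, by norm_num, rfl⟩, ⟨4, by norm_num, rfl⟩]
    have key : ∀ z : SteenrodAlgebra ⊗[ZMod 2] SteenrodAlgebra,
        TensorProduct.lid (ZMod 2) SteenrodAlgebra (θ.rTensor SteenrodAlgebra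
          (z * coproduct (Sq n))) =
        TensorProduct.lid (ZMod 2) SteenrodAlgebra (θ.rTensor SteenrodAlgebra z) * Sq n := by
      intro z
      induction z with
      | zero => simp
      | add z z' hz hz' => simp only [add_mul, map_add, hz, hz']
      | tmul x y =>
        simp only [coproduct_Sq, mul_sum, map_sum, Algebra.TensorProduct.tmul_mul_tmul,
          LinearMap.rTensor_tmul, TensorProduct.lid_tmul]
        rw [sum_eq_single (0, n)]
        · rw [Sq_zero, mul_one, smul_mul_assoc]
        · rintro ⟨p, q⟩ hpq hne
          rw [HasAntidiagonal.mem_antidiagonal] at hpq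
          simp only at hpq
          rw [hθ, zero_smul]
          refine Submodule.smul_mem _ x (Sq_mem_leftIdeal (Nat.pos_of_ne_zero fun h0 => hne ?_)
            (by omega))
          have h0' : p = 0 := h0
          rw [← hpq, h0', zero_add]
        · simp
    change TensorProduct.lid (ZMod 2) SteenrodAlgebra (θ.rTensor SteenrodAlgebra
      (coproduct (x * Sq n))) = _
    rw [map_mul, key]
    rfl
  | algebraMap r => rw [← Algebra.commutes, ← Algebra.commutes, ← Algebra.smul_def,
      ← Algebra.smul_def, map_smul]
  | add b b' _ _ hb hb' => rw [mul_add, map_add, hb, hb', mul_add]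
  | mul b b' _ _ hb hb' => rw [← mul_assoc, hb', hb, mul_assoc]

/-- The part of `A ⊗ A` on which the degree of the first factor is less than `n`. -/
noncomputable def firstDegreeLT (n : ℕ) :
    Submodule (ZMod 2) (SteenrodAlgebra ⊗[ZMod 2] SteenrodAlgebra) :=
  Submodule.span (ZMod 2) {z | ∃ i < n, ∃ x ∈ grading (i : ℕ), ∃ y, z = x ⊗ₜ y}

theorem mul_mem_firstDegreeLT {p n m : ℕ} {u : SteenrodAlgebra} (hu : u ∈ grading p)
    (v : SteenrodAlgebra) {z : SteenrodAlgebra ⊗[ZMod 2] SteenrodAlgebra}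
    (hz : z ∈ firstDegreeLT n) (hm : p + n ≤ m) : (u ⊗ₜ v) * z ∈ firstDegreeLT m := by
  induction hz using Submodule.span_induction with
  | mem z hz =>
    obtain ⟨i, hi, x, hx, y, rfl⟩ := hz
    rw [Algebra.TensorProduct.tmul_mul_tmul]
    exact Submodule.subset_span ⟨p + i, by omega, _, mul_mem_grading hu hx, _, rfl⟩
  | zero => rw [mul_zero]; exact Submodule.zero_mem _
  | add z z' _ _ hz hz' => rw [mul_add]; exact Submodule.add_mem _ hz hz'
  | smul a z _ hz => rw [mul_smul_comm]; exact Submodule.smul_mem _ _ hz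

/-- The coproduct of `x` is `x ⊗ 1` up to terms whose first factor has smaller degree. -/
theorem coproduct_of_mem {n : ℕ} {x : SteenrodAlgebra} (hx : x ∈ grading n) :
    ∃ r ∈ firstDegreeLT n, coproduct x = x ⊗ₜ 1 + r := by
  refine grading_natCast_induction
    (p := fun x => ∃ r ∈ firstDegreeLT n, coproduct x = x ⊗ₜ 1 + r) ?_ ?_ ?_ hx
  · exact ⟨0, Submodule.zero_mem _, by simp⟩
  · rintro x y ⟨r, hr, hxr⟩ ⟨r', hr', hyr⟩
    exact ⟨r + r', Submodule.add_mem _ hr hr', by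
      rw [map_add, hxr, hyr, TensorProduct.add_tmul]; abel⟩
  · rintro l rfl
    clear hx
    induction l with
    | nil =>
      exact ⟨0, Submodule.zero_mem _, by
        simp only [List.map_nil, List.prod_nil, map_one, add_zero]
        rfl⟩
    | cons k l ih =>
      obtain ⟨r, hr, h⟩ := ih
      have hl : (l.map Sq).prod ∈ grading (l.sum : ℕ) := Submodule.subset_span ⟨l, rfl, rfl⟩
      refine ⟨∑ i ∈ range k, (Sq i * (l.map Sq).prod) ⊗ₜ Sq (k - i) +
        coproduct (Sq k) * r, Submodule.add_mem _ (Submodule.sum_mem _ fun i hi => ?_) ?_, ?_⟩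
      · rw [mem_range] at hi
        exact Submodule.subset_span ⟨i + l.sum, by rw [List.sum_cons]; omega, _,
          mul_mem_grading (Sq_mem i) hl, _, rfl⟩
      · rw [coproduct_Sq, sum_mul]
        refine Submodule.sum_mem _ fun i hi => mul_mem_firstDegreeLT (Sq_mem _) _ hr ?_
        rw [HasAntidiagonal.mem_antidiagonal] at hi
        rw [List.sum_cons]
        omega
      · rw [List.map_cons, List.prod_cons, map_mul, h, mul_add, ← add_assoc]
        congr 1
        rw [coproduct_Sq, Nat.sum_antidiagonal_eq_sum_range_succ_mk, sum_mul, sum_range_succ,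
          add_comm]
        simp only [Algebra.TensorProduct.tmul_mul_tmul, mul_one, Nat.sub_self, Sq_zero]

/-- On elements of degree at most `N`, contraction with a functional concentrated in degree `N` is
evaluation. -/
theorem contract_of_mem {N n : ℕ} {θ : SteenrodAlgebra →ₗ[ZMod 2] ZMod 2}
    (hθ : ∀ m, m ≠ N → ∀ x ∈ grading (m : ℕ), θ x = 0) {x : SteenrodAlgebra} (hx : x ∈ grading n)
    (hn : n ≤ N) : contract θ x = θ x • 1 := by
  obtain ⟨r, hr, h⟩ := coproduct_of_mem hx
  have hr0 : θ.rTensor SteenrodAlgebra r = 0 := by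
    clear h
    induction hr using Submodule.span_induction with
    | mem z hz =>
      obtain ⟨i, hi, x, hx, y, rfl⟩ := hz
      rw [LinearMap.rTensor_tmul, hθ i (by omega) x hx, TensorProduct.zero_tmul]
    | zero => rw [map_zero]
    | add z z' _ _ hz hz' => rw [map_add, hz, hz', add_zero]
    | smul a z _ hz => rw [map_smul, hz, smul_zero]
  change TensorProduct.lid (ZMod 2) SteenrodAlgebra (θ.rTensor SteenrodAlgebra (coproduct x)) = _
  rw [h, map_add, hr0, add_zero, LinearMap.rTensor_tmul, TensorProduct.lid_tmul]

theorem proj_mem_leftIdeal (n : ℕ) {x : SteenrodAlgebra} (hx : x ∈ leftIdeal) :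
    proj n x ∈ leftIdeal := by
  obtain ⟨u, v, w, rfl⟩ := mem_leftIdeal_iff.1 hx
  have h : ∀ k, 0 < k → k ≤ 4 → ∀ u, proj n (u * Sq k) ∈ leftIdeal := by
    intro k h0 h4 u
    rcases le_or_gt k n with hk | hk
    · rw [proj_mul u (Sq_mem k) hk]
      exact Submodule.smul_mem _ _ (Sq_mem_leftIdeal h0 h4)
    · rw [proj_mul_of_lt u (Sq_mem k) hk]
      exact Submodule.zero_mem _
  rw [map_add, map_add]
  exact Submodule.add_mem _ (h 1 (by norm_num) (by norm_num) u) (Submodule.add_mem _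
    (h 2 (by norm_num) (by norm_num) v) (h 4 (by norm_num) (by norm_num) w))

/-- The Steenrod algebra is free as a right module over `A(2)`. A basis is obtained from homogeneous
elements `e j` whose classes form a basis of the quotient by the left ideal of `Sq¹`, `Sq²`, `Sq⁴`:
they generate by induction on the degree, and they are independent because contraction of the
coproduct with a functional on that quotient recovers the coefficient of an `e j` of top
degree. -/
theorem exists_basis_over_subalgebraA2 : ∃ (ι : Type) (e : ι → SteenrodAlgebra),
    (∀ f : ι →₀ SteenrodAlgebra, (∀ j, f j ∈ subalgebraA2) →
      (f.sum fun j b => e j * b) = 0 → f = 0) ∧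
    ∀ x, ∃ f : ι →₀ SteenrodAlgebra, (∀ j, f j ∈ subalgebraA2) ∧ x = f.sum fun j b => e j * b := by
  let q : SteenrodAlgebra →ₗ[ZMod 2] SteenrodAlgebra ⧸ leftIdeal :=
    leftIdeal.mkQ.restrictScalars (ZMod 2)
  have hq : ∀ x, q x = 0 ↔ x ∈ leftIdeal := fun x => Submodule.Quotient.mk_eq_zero _
  let T : Set (SteenrodAlgebra ⧸ leftIdeal) := {y | ∃ n : ℕ, ∃ x ∈ grading n, q x = y}
  obtain ⟨ι, hιT, hspan, hli⟩ := exists_linearIndependent (ZMod 2) T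
  have htop : ⊤ ≤ Submodule.span (ZMod 2) (Set.range ((↑) : ι → SteenrodAlgebra ⧸ leftIdeal)) := by
    rw [Subtype.range_coe, hspan]
    rintro y -
    obtain ⟨x, rfl⟩ := Submodule.mkQ_surjective _ y
    obtain ⟨N, hN⟩ := exists_eq_sum_proj x
    rw [hN N le_rfl]
    change q _ ∈ _
    rw [map_sum]
    exact Submodule.sum_mem _ fun n _ => Submodule.subset_span ⟨n, _, proj_mem n x, rfl⟩
  let bas := Module.Basis.mk hli htop
  have hT : ∀ j : ι, ∃ n : ℕ, ∃ x ∈ grading n, q x = j := fun j => hιT j.2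
  choose d e hed heq using hT
  have hbas : ∀ j, bas j = q (e j) := fun j => by rw [heq, Module.Basis.mk_apply]
  refine ⟨ι, e, fun f hf h0 => ?_, fun x => ?_⟩
  · by_contra hne
    obtain ⟨j, hj, hmax⟩ := exists_max_image f.support d (Finsupp.support_nonempty_iff.2 hne)
    -- `θ` is the coordinate of `e j`, restricted to degree `d j`; contraction with it sends `e j`
    -- to `1` and every other `e i` of degree at most `d j` to `0`.
    let θ : SteenrodAlgebra →ₗ[ZMod 2] ZMod 2 := (bas.coord j).comp (q.comp (proj (d j)))
    have hθ1 : ∀ x ∈ leftIdeal, θ x = 0 := fun x hx => by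
      change bas.coord j (q (proj (d j) x)) = 0
      rw [(hq _).2 (proj_mem_leftIdeal _ hx), map_zero]
    have hθ2 : ∀ m, m ≠ d j → ∀ x ∈ grading (m : ℕ), θ x = 0 := fun m hm x hx => by
      change bas.coord j (q (proj (d j) x)) = 0
      rw [proj_of_mem hx, if_neg hm, map_zero, map_zero]
    have h1 := congr_arg (contract θ) h0
    rw [map_zero, Finsupp.sum, map_sum, sum_eq_single j] at h1
    · rw [contract_mul hθ1 _ (hf j), contract_of_mem hθ2 (hed j) le_rfl] at h1
      have : θ (e j) = 1 := by
        change bas.coord j (q (proj (d j) (e j))) = 1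
        rw [proj_of_mem (hed j), if_pos rfl, ← hbas, Module.Basis.coord_apply,
          Module.Basis.repr_self, Finsupp.single_eq_same]
      rw [this, one_smul, one_mul] at h1
      exact Finsupp.mem_support_iff.1 hj h1
    · intro i hi hij
      rw [contract_mul hθ1 _ (hf i), contract_of_mem hθ2 (hed i) (hmax i hi)]
      have : θ (e i) = 0 := by
        change bas.coord j (q (proj (d j) (e i))) = 0
        rw [proj_of_mem (hed i)]
        split_ifs
        · rw [← hbas, Module.Basis.coord_apply, Module.Basis.repr_self,
            Finsupp.single_eq_of_ne hij.symm]
        · rw [map_zero, map_zero]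
      rw [this, zero_smul, zero_mul]
    · exact fun h => absurd hj h
  · let Φ : (ι →₀ subalgebraA2) →ₗ[ZMod 2] SteenrodAlgebra := Finsupp.lsum (ZMod 2) fun j =>
      (LinearMap.mulLeft (ZMod 2) (e j)).comp subalgebraA2.val.toLinearMap
    have hΦ : ∀ f, Φ f = f.sum fun j b => e j * (b : SteenrodAlgebra) := fun f => rfl
    have hmul : ∀ x ∈ LinearMap.range Φ, ∀ b ∈ subalgebraA2, x * b ∈ LinearMap.range Φ := by
      rintro _ ⟨f, rfl⟩ b hb
      refine ⟨f.mapRange (fun c => c * ⟨b, hb⟩) (zero_mul _), ?_⟩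
      rw [hΦ, hΦ, Finsupp.sum_mapRange_index (by simp), Finsupp.sum, Finsupp.sum, sum_mul]
      exact sum_congr rfl fun j _ => (mul_assoc _ _ _).symm
    have he : ∀ j, e j ∈ LinearMap.range Φ := fun j =>
      ⟨Finsupp.single j 1, by rw [hΦ, Finsupp.sum_single_index (by simp)]; simp⟩
    have hgr : ∀ n : ℕ, ∀ x ∈ grading n, x ∈ LinearMap.range Φ := by
      intro n
      induction n using Nat.strong_induction_on with
      | _ n ih =>
        intro x hx
        have hc : q (x - (bas.repr (q x)).sum fun j c => c • e j) = 0 := by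
          rw [map_sub, sub_eq_zero]
          conv_lhs => rw [← bas.linearCombination_repr (q x)]
          rw [Finsupp.linearCombination_apply, Finsupp.sum, Finsupp.sum, map_sum]
          exact sum_congr rfl fun j _ => by rw [map_smul, hbas]
        obtain ⟨u, v, w, h⟩ := mem_leftIdeal_iff.1 ((hq _).1 hc)
        have h' := congr_arg (proj n) h
        rw [map_sub, proj_of_mem hx, if_pos rfl, sub_eq_iff_eq_add] at h'
        have hk : ∀ k, 0 < k → Sq k ∈ subalgebraA2 → ∀ u,
            proj n (u * Sq k) ∈ LinearMap.range Φ := by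
          intro k h0 hk u
          rcases le_or_gt k n with hkn | hkn
          · rw [proj_mul u (Sq_mem k) hkn]
            exact hmul _ (ih (n - k) (by omega) _ (proj_mem _ _)) _ hk
          · rw [proj_mul_of_lt u (Sq_mem k) hkn]
            exact Submodule.zero_mem _
        rw [h', map_add, map_add, Finsupp.sum, map_sum]
        refine Submodule.add_mem _ (Submodule.add_mem _ ?_ (Submodule.add_mem _ ?_ ?_))
          (Submodule.sum_mem _ fun j _ => ?_)
        · exact hk 1 (by norm_num) (Algebra.subset_adjoin (by simp)) u
        · exact hk 2 (by norm_num) (Algebra.subset_adjoin (by simp)) v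
        · exact hk 4 (by norm_num) (Algebra.subset_adjoin (by simp)) w
        · rw [map_smul, proj_of_mem (hed j)]
          refine Submodule.smul_mem _ _ ?_
          split_ifs
          · exact he j
          · exact Submodule.zero_mem _
    obtain ⟨N, hN⟩ := exists_eq_sum_proj x
    have hx : x ∈ LinearMap.range Φ := by
      rw [hN N le_rfl]
      exact Submodule.sum_mem _ fun n _ => hgr n _ (proj_mem n x)
    obtain ⟨f, rfl⟩ := hx
    refine ⟨f.mapRange Subtype.val rfl, fun j => (f j).2, ?_⟩
    rw [hΦ, Finsupp.sum_mapRange_index (by simp)]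

end SteenrodAlgebra

/-! ### The relations of `A(2)` -/

namespace SteenrodAlgebra

theorem add_self (x : SteenrodAlgebra) : x + x = 0 := by
  rw [← two_smul (ZMod 2), show (2 : ZMod 2) = 0 from rfl, zero_smul]

/-- The relations of `A(2)` that follow from its defining relations by overlapping them. -/
theorem relations_of_char_two {R : Type*} [Ring R] (h2 : ∀ x : R, x + x = 0) (a b c : R)
    (haa : a * a = 0) (hbb : b * b = a * b * a) (hca : c * a = a * c + b * a * b)
    (hcc : c * c = a * b * c * a + b * c * b + a * c * a * b) :
    b * (a * (b * a)) = a * (b * (a * b)) ∧ c * c = a * (b * (a * c)) + b * (c * b) ∧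
    c * (b * (a * b)) = a * (b * (c * b)) + (b * (a * (b * c)) + b * (c * (b * a))) ∧
    c * (b * (c * b)) = a * (b * (a * (b * (c * b)))) +
      (a * (c * (b * (a * c))) + b * (c * (b * c))) ∧
    c * (b * (a * (c * (b * a)))) = a * (b * (a * (c * (b * c)))) +
      (a * (c * (b * (a * (c * b)))) + b * (a * (c * (b * (a * c))))) := by
  have two : ∀ x y : R, x + (x + y) = y := fun x y => by rw [← add_assoc, h2, zero_add]
  have eq_of : ∀ {x y z : R}, x + y = z → x = z + y := fun {x y z} h => by
    rw [← h, add_assoc, h2, add_zero]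
  have haa' : ∀ x, a * (a * x) = 0 := fun x => by rw [← mul_assoc, haa, zero_mul]
  have hbb₁ : b * b = a * (b * a) := by rw [hbb, mul_assoc]
  have hbb' : ∀ x, b * (b * x) = a * (b * (a * x)) := fun x => by
    rw [← mul_assoc, hbb₁]; simp only [mul_assoc]
  have hca₁ : c * a = a * c + b * (a * b) := by rw [hca, mul_assoc b]
  have hca' : ∀ x, c * (a * x) = a * (c * x) + b * (a * (b * x)) := fun x => by
    rw [← mul_assoc, hca₁]; simp only [mul_assoc, add_mul]
  -- from the overlap `b b b`
  have h1 : b * (a * (b * a)) = a * (b * (a * b)) := by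
    rw [← hbb₁, ← mul_assoc, hbb₁]; simp only [mul_assoc]
  have h1' : ∀ x, b * (a * (b * (a * x))) = a * (b * (a * (b * x))) := fun x => by
    have := congr_arg (· * x) h1
    simpa only [mul_assoc] using this
  have h3 : c * c = a * (b * (a * c)) + b * (c * b) := by
    rw [hcc]
    simp only [mul_assoc, hca₁, mul_add, hbb', haa', mul_zero, add_zero, zero_add, hbb₁]
  have h3' : ∀ x, c * (c * x) = a * (b * (a * (c * x))) + b * (c * (b * x)) := fun x => by
    rw [← mul_assoc, h3]; simp only [mul_assoc, add_mul]
  -- from the overlap `c c a`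
  have h4 : c * (b * (a * b)) = a * (b * (c * b)) + (b * (a * (b * c)) + b * (c * (b * a))) := by
    have e : c * (c * a) = c * c * a := (mul_assoc _ _ _).symm
    rw [h3, hca₁] at e
    simp only [mul_assoc, hca₁, hca', mul_add, add_mul, h1', haa', h3, mul_zero, zero_add,
      hbb₁] at e
    rw [add_comm] at e
    rw [eq_of e]
    abel
  -- from the overlap `c c c`
  have h5 : c * (b * (c * b)) = a * (b * (a * (b * (c * b)))) +
      (a * (c * (b * (a * c))) + b * (c * (b * c))) := by
    have e : c * (c * c) = c * c * c := (mul_assoc _ _ _).symm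
    rw [h3] at e
    simp only [mul_assoc, hca', mul_add, add_mul, hbb', haa', h3, mul_zero, add_zero,
      zero_add] at e
    rw [add_comm] at e
    rw [eq_of e]
    abel
  refine ⟨h1, h3, h4, h5, ?_⟩
  -- from the overlap of `h5` with `b b`
  have e := congr_arg (· * b) h5
  simp only [mul_assoc, hca', add_mul, hbb', haa', h1', mul_zero, add_zero, zero_add,
    hbb₁] at e
  simp only [h5, mul_add, hbb', h1', haa', mul_zero, zero_add] at e
  rw [e]
  abel

end SteenrodAlgebra

namespace SteenrodAlgebra

/-! ### A basis of words for `A(2)` and its multiplication table -/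

/-- The value in `A` of a word in the indices of the squares. -/
noncomputable def wordVal (w : List ℕ) : SteenrodAlgebra := (w.map Sq).prod

theorem wordVal_nil : wordVal [] = 1 := rfl

theorem wordVal_cons (k : ℕ) (w : List ℕ) : wordVal (k :: w) = Sq k * wordVal w := by
  rw [wordVal, List.map_cons, List.prod_cons, wordVal]

theorem wordVal_append (v w : List ℕ) : wordVal (v ++ w) = wordVal v * wordVal w := by
  rw [wordVal, List.map_append, List.prod_append, wordVal, wordVal]

/-- The words in `1`, `2`, `4` without the left hand side of a rule of `rules` as a subword,
ordered by degree. -/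
def normalWords : List (List ℕ) := [
    [], [1], [2], [1, 2], [2, 1], [1, 2, 1], [4], [1, 4], [2, 1, 2], [1, 2, 1, 2], [2, 4], [4, 2],
    [1, 2, 4], [1, 4, 2], [2, 1, 4], [4, 2, 1], [1, 2, 1, 4], [1, 4, 2, 1], [2, 4, 2],
    [1, 2, 4, 2], [2, 1, 2, 4], [2, 1, 4, 2], [2, 4, 2, 1], [1, 2, 1, 2, 4], [1, 2, 1, 4, 2],
    [1, 2, 4, 2, 1], [2, 1, 4, 2, 1], [4, 2, 4], [1, 2, 1, 4, 2, 1], [1, 4, 2, 4],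
    [2, 1, 2, 4, 2], [4, 2, 1, 4], [1, 2, 1, 2, 4, 2], [1, 4, 2, 1, 4], [2, 1, 2, 4, 2, 1],
    [2, 4, 2, 4], [1, 2, 1, 2, 4, 2, 1], [1, 2, 4, 2, 4], [2, 1, 4, 2, 4], [2, 4, 2, 1, 4],
    [4, 2, 1, 4, 2], [1, 2, 1, 4, 2, 4], [1, 2, 4, 2, 1, 4], [1, 4, 2, 1, 4, 2],
    [2, 1, 4, 2, 1, 4], [1, 2, 1, 4, 2, 1, 4], [2, 1, 2, 4, 2, 4], [2, 4, 2, 1, 4, 2],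
    [1, 2, 1, 2, 4, 2, 4], [1, 2, 4, 2, 1, 4, 2], [2, 1, 2, 4, 2, 1, 4], [2, 1, 4, 2, 1, 4, 2],
    [1, 2, 1, 2, 4, 2, 1, 4], [1, 2, 1, 4, 2, 1, 4, 2], [4, 2, 1, 4, 2, 4], [1, 4, 2, 1, 4, 2, 4],
    [2, 1, 2, 4, 2, 1, 4, 2], [1, 2, 1, 2, 4, 2, 1, 4, 2], [2, 4, 2, 1, 4, 2, 4],
    [1, 2, 4, 2, 1, 4, 2, 4], [2, 1, 4, 2, 1, 4, 2, 4], [1, 2, 1, 4, 2, 1, 4, 2, 4],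
    [2, 1, 2, 4, 2, 1, 4, 2, 4], [1, 2, 1, 2, 4, 2, 1, 4, 2, 4]]

/-- A confluent system of rewriting rules for the subalgebra generated by `Sq¹`, `Sq²`, `Sq⁴`: a
word and the words whose sum it is. -/
def rules : List (List ℕ × List (List ℕ)) :=
  [([1, 1], []), ([2, 2], [[1, 2, 1]]), ([4, 1], [[1, 4], [2, 1, 2]]),
    ([2, 1, 2, 1], [[1, 2, 1, 2]]), ([4, 4], [[1, 2, 1, 4], [2, 4, 2]]),
    ([4, 2, 1, 2], [[1, 2, 4, 2], [2, 1, 2, 4], [2, 4, 2, 1]]),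
    ([4, 2, 4, 2], [[1, 2, 1, 2, 4, 2], [1, 4, 2, 1, 4], [2, 4, 2, 4]]),
    ([4, 2, 1, 4, 2, 1], [[1, 2, 1, 4, 2, 4], [1, 4, 2, 1, 4, 2], [2, 1, 4, 2, 1, 4]])]

/-- The sum of the values of the words of a list. -/
noncomputable def sumVal (p : List (List ℕ)) : SteenrodAlgebra := (p.map wordVal).sum

theorem wordVal_of_mem_rules : ∀ r ∈ rules, wordVal r.1 = sumVal r.2 := by
  have hadem : ∀ {a b : ℕ}, 0 < a → a < 2 * b →
      Sq a * Sq b = ademSum (fun i j => Sq i * Sq j) a b := fun ha hb => adem ha hb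
  have h13 : Sq 1 * Sq 2 = Sq 3 := Sq_one_mul_Sq_two
  have three : (3 : ZMod 2) = 1 := rfl
  have five : (5 : ZMod 2) = 1 := rfl
  have haa : Sq 1 * Sq 1 = 0 := by
    rw [hadem one_pos (by norm_num)]
    simp [ademSum]
  have h22 : Sq 2 * Sq 2 = Sq 3 * Sq 1 := by
    rw [hadem two_pos (by norm_num)]
    simp [ademSum, Finset.sum_range_succ, Sq_zero, Nat.choose]
  have h23 : Sq 2 * Sq 3 = Sq 5 + Sq 4 * Sq 1 := by
    rw [hadem two_pos (by norm_num)]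
    simp [ademSum, Finset.sum_range_succ, Sq_zero]
  have h14 : Sq 1 * Sq 4 = Sq 5 := by
    rw [hadem one_pos (by norm_num)]
    simp [ademSum, Sq_zero, three]
  have h24 : Sq 2 * Sq 4 = Sq 6 + Sq 5 * Sq 1 := by
    rw [hadem two_pos (by norm_num)]
    simp [ademSum, Finset.sum_range_succ, Sq_zero, three]
  have h16 : Sq 1 * Sq 6 = Sq 7 := by
    rw [hadem one_pos (by norm_num)]
    simp [ademSum, Sq_zero, five]
  have h44 : Sq 4 * Sq 4 = Sq 7 * Sq 1 + Sq 6 * Sq 2 := by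
    rw [hadem four_pos (by norm_num)]
    simp [ademSum, Finset.sum_range_succ, Nat.choose, Sq_zero]
  have eq_of : ∀ {x y z : SteenrodAlgebra}, x = z + y → z = x + y := fun {x y z} h => by
    rw [h, add_assoc, add_self, add_zero]
  have hbb : Sq 2 * Sq 2 = Sq 1 * Sq 2 * Sq 1 := by rw [h22, h13]
  have hca : Sq 4 * Sq 1 = Sq 1 * Sq 4 + Sq 2 * Sq 1 * Sq 2 := by
    rw [mul_assoc (Sq 2), h13, h23, h14, ← add_assoc, add_self, zero_add]
  have h6 : Sq 6 = Sq 2 * Sq 4 + Sq 1 * Sq 4 * Sq 1 := by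
    rw [h14]
    exact eq_of h24
  have hcc : Sq 4 * Sq 4 = Sq 1 * Sq 2 * Sq 4 * Sq 1 + Sq 2 * Sq 4 * Sq 2 +
      Sq 1 * Sq 4 * Sq 1 * Sq 2 := by
    rw [h44, ← h16, h6]
    simp only [mul_add, add_mul, mul_assoc, haa, mul_zero, add_zero]
    simp only [← mul_assoc]
    rw [add_assoc]
  obtain ⟨h1, h2, h3, h4, h5⟩ := relations_of_char_two add_self _ _ _ haa hbb hca hcc
  simp only [rules, List.forall_mem_cons, sumVal, List.map_cons, List.map_nil, List.sum_cons,
    List.sum_nil, wordVal_cons, wordVal_nil, mul_one, add_zero]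
  exact ⟨haa, by rw [hbb, mul_assoc], by rw [hca, mul_assoc (Sq 2)], h1, h2, h3, h4, h5, by simp⟩

/-- Row `i` lists the positions of the normal words whose sum is `Sq¹` times the `i`th one. -/
def tableOne : List (List ℕ) := [
    [1], [], [3], [], [5], [], [7], [], [9], [], [12], [13], [], [], [16], [17], [], [], [19], [],
    [23], [24], [25], [], [], [], [28], [29], [], [], [32], [33], [], [], [36], [37], [], [],
    [41], [42], [43], [], [], [], [45], [], [48], [49], [], [], [52], [53], [], [], [55], [],
    [57], [], [59], [], [61], [], [63], []]

/-- Row `i` lists the positions of the normal words whose sum is `Sq²` times the `i`th one. -/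
def tableTwo : List (List ℕ) := [
    [2], [4], [5], [8], [], [9], [10], [14], [], [], [16], [18], [20], [21], [], [22], [23], [26],
    [24], [30], [], [], [28], [], [32], [34], [], [35], [36], [38], [], [39], [], [44], [], [41],
    [], [46], [], [45], [47], [48], [50], [51], [], [52], [], [53], [], [56], [], [], [], [57],
    [58], [60], [], [], [61], [62], [], [63], [], []]

/-- Row `i` lists the positions of the normal words whose sum is `Sq⁴` times the `i`th one. -/
def tableFour : List (List ℕ) := [
    [6], [7, 8], [11], [13], [15], [17], [16, 18], [19, 20], [19, 20, 22], [23, 25], [27],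
    [24, 26], [29], [28, 30], [31], [28], [33], [34], [32, 33, 35], [37], [37, 39], [40],
    [36, 39], [42], [43], [42], [41, 43, 44], [41, 44], [45], [45, 46], [45, 47], [45], [49],
    [50], [48, 51], [48, 49, 50, 51], [53], [52, 53], [54], [53], [53], [55], [], [56], [55, 56],
    [57], [57, 58], [], [59], [], [60], [59], [61], [], [61], [62], [62], [63], [], [], [], [],
    [], []]

/-- A table as a number: row `i` becomes the number with the bits `64 i + j`, for `j` in the
row. -/
def encodeTable (t : List (List ℕ)) : ℕ :=
  t.foldr (fun r n => n <<< 64 ^^^ r.foldr (fun j m => 2 ^ j ^^^ m) 0) 0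

/-- Row `i` of the table of left multiplication by `Sqᵏ`, as a bit mask. -/
def tableRow (k i : ℕ) : ℕ :=
  (encodeTable (if k = 1 then tableOne else if k = 2 then tableTwo else tableFour) >>> (64 * i)) %
    2 ^ 64

/-- The linear operator on bit masks that acts by `row` in each block of 64 bits; `fuel` is a bound
for the number of bits. -/
def act (row : ℕ → ℕ) : ℕ → ℕ → ℕ
  | 0, _ => 0
  | fuel + 1, v => if v = 0 then 0 else
      (row (v.log2 % 64) <<< (64 * (v.log2 / 64))) ^^^ act row fuel (v ^^^ 2 ^ v.log2)

/-- The bit mask of the product of the word `u` with the `j`th normal word, computed from the rows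
of the table that come before row `i` for `Sqᵏ`. -/
def actBefore (k i : ℕ) : List ℕ → ℕ → Option ℕ
  | [], j => some (2 ^ j)
  | l :: u, j => (actBefore k i u j).bind fun v =>
      if l < k ∨ l = k ∧ v < 2 ^ i then some (act (tableRow l) 64 v) else none

/-- The sum of the products of the words of a list with the `j`th normal word. -/
def sumActBefore (k i : ℕ) (p : List (List ℕ)) (j : ℕ) : Option ℕ :=
  p.foldr (fun u o => (actBefore k i u j).bind fun v => o.map fun w => v ^^^ w) (some 0)

/-- Row `i` for `Sqᵏ` is correct: the word is normal, or a rule applies to it. -/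
def rowOK (k i : ℕ) : Bool :=
  let w := k :: normalWords.getD i []
  (normalWords.contains w &&
    tableRow k i == 2 ^ normalWords.idxOf w) ||
  rules.any fun r => r.1.isPrefixOf w && normalWords.contains (w.drop r.1.length) &&
    sumActBefore k i r.2 (normalWords.idxOf (w.drop r.1.length)) == some (tableRow k i)

theorem rowOK_all : ∀ k ∈ [1, 2, 4], ∀ i < 64, rowOK k i = true := by
  decide +kernel

end SteenrodAlgebra

/-! ### Bit masks for elements of `A(2)` -/

namespace SteenrodAlgebra

/-- The element of `A` with a given bit mask: the sum of the normal words whose positions are the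
bits of `v` below `64`. -/
noncomputable def maskVal (v : ℕ) : SteenrodAlgebra :=
  ∑ i ∈ Finset.range 64, if v.testBit i then wordVal (normalWords.getD i []) else 0

theorem maskVal_xor (v w : ℕ) : maskVal (v ^^^ w) = maskVal v + maskVal w := by
  rw [maskVal, maskVal, maskVal, ← Finset.sum_add_distrib]
  refine Finset.sum_congr rfl fun i _ => ?_
  rw [Nat.testBit_xor]
  cases v.testBit i <;> cases w.testBit i <;> simp [add_self]

theorem maskVal_zero : maskVal 0 = 0 := by simp [maskVal]

theorem maskVal_two_pow {i : ℕ} (hi : i < 64) :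
    maskVal (2 ^ i) = wordVal (normalWords.getD i []) := by
  rw [maskVal, Finset.sum_eq_single i]
  · simp
  · intro j _ hj
    rw [Nat.testBit_two_pow_of_ne (Ne.symm hj)]
    simp
  · intro h
    exact absurd (Finset.mem_range.2 hi) h

theorem maskVal_shiftLeft (v n : ℕ) (h : 64 ≤ n) : maskVal (v <<< n) = 0 := by
  refine Finset.sum_eq_zero fun i hi => ?_
  have := Finset.mem_range.1 hi
  rw [Nat.testBit_shiftLeft]
  simp only [show ¬ n ≤ i by omega, decide_false, Bool.false_and]
  simp

/-- The vector over `A` with a given bit mask: each coordinate occupies 64 bits. -/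
noncomputable def maskVec (g : ℕ) (v : ℕ) : Fin g → SteenrodAlgebra :=
  fun j => maskVal (v >>> (64 * (j : ℕ)))

theorem maskVec_xor (g v w : ℕ) : maskVec g (v ^^^ w) = maskVec g v + maskVec g w := by
  funext j
  rw [Pi.add_apply, maskVec, maskVec, maskVec, Nat.shiftRight_xor_distrib, maskVal_xor]

theorem maskVec_zero (g : ℕ) : maskVec g 0 = 0 := by
  funext j
  rw [Pi.zero_apply, maskVec, Nat.zero_shiftRight, maskVal_zero]

theorem maskVec_shiftLeft (g v q : ℕ) (hv : v < 2 ^ 64) :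
    maskVec g (v <<< (64 * q)) = fun j : Fin g => if (j : ℕ) = q then maskVal v else 0 := by
  funext j
  rw [maskVec]
  split_ifs with h
  · rw [h, Nat.shiftLeft_shiftRight]
  · rcases lt_or_gt_of_ne h with h | h
    · obtain ⟨c, hc⟩ : ∃ c, 64 * q = c + 64 * (j : ℕ) := ⟨64 * q - 64 * j, by omega⟩
      rw [hc, Nat.shiftLeft_add, Nat.shiftLeft_shiftRight]
      exact maskVal_shiftLeft _ _ (by omega)
    · obtain ⟨c, hc⟩ : ∃ c, 64 * (j : ℕ) = 64 * q + (64 + c) :=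
        ⟨64 * (j : ℕ) - 64 * q - 64, by omega⟩
      rw [hc, Nat.shiftRight_add, Nat.shiftLeft_shiftRight, Nat.shiftRight_add,
        Nat.shiftRight_eq_div_pow v 64, Nat.div_eq_of_lt hv, Nat.zero_shiftRight, maskVal_zero]

theorem maskVec_two_pow (g i : ℕ) :
    maskVec g (2 ^ i) = fun j : Fin g =>
      if (j : ℕ) = i / 64 then wordVal (normalWords.getD (i % 64) []) else 0 := by
  have h := Nat.mod_add_div i 64
  have h64 := Nat.mod_lt i (show 64 > 0 by norm_num)
  conv_lhs => rw [← h, pow_add, ← Nat.shiftLeft_eq]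
  rw [maskVec_shiftLeft g _ _ (Nat.pow_lt_pow_right one_lt_two h64), maskVal_two_pow h64]

theorem xor_two_pow_log2_lt {v : ℕ} (hv : v ≠ 0) : v ^^^ 2 ^ v.log2 < 2 ^ v.log2 := by
  refine Nat.lt_pow_two_of_testBit _ fun i hi => ?_
  rw [Nat.testBit_xor]
  rcases hi.eq_or_lt with rfl | hi
  · rw [Nat.testBit_log2 hv, Nat.testBit_two_pow_self]
    rfl
  · rw [Nat.testBit_two_pow_of_ne hi.ne, Nat.testBit_lt_two_pow
      (lt_of_lt_of_le Nat.lt_log2_self (Nat.pow_le_pow_right two_pos hi))]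
    rfl

/-- An additive map on bit masks is determined by its values on powers of two. -/
theorem mask_induction {P : ℕ → Prop} (h0 : P 0)
    (h : ∀ v, v ≠ 0 → P (v ^^^ 2 ^ v.log2) → P v) (v : ℕ) : P v := by
  induction v using Nat.strong_induction_on with
  | _ v ih =>
    rcases eq_or_ne v 0 with rfl | hv
    · exact h0
    · exact h v hv (ih _ ((xor_two_pow_log2_lt hv).trans_le (Nat.log2_self_le hv)))

/-- `act` computes left multiplication, if its rows do for the normal words that occur. -/
theorem maskVec_act (g : ℕ) {row : ℕ → ℕ} {x : SteenrodAlgebra} {fuel : ℕ} {v : ℕ}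
    (hrow : ∀ i, v.testBit i → row (i % 64) < 2 ^ 64 ∧
      maskVal (row (i % 64)) = x * wordVal (normalWords.getD (i % 64) []))
    (hv : v < 2 ^ fuel) : maskVec g (act row fuel v) = x • maskVec g v := by
  induction fuel generalizing v with
  | zero =>
    obtain rfl : v = 0 := by simpa using hv
    rw [act, maskVec_zero, smul_zero]
  | succ f ih =>
    rw [act]
    split_ifs with h0
    · rw [h0, maskVec_zero, smul_zero]
    have hlog : v.log2 < f + 1 := (Nat.log2_lt h0).2 hv
    obtain ⟨hr, hr'⟩ := hrow _ (Nat.testBit_log2 h0)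
    have hx : maskVec g (act row f (v ^^^ 2 ^ v.log2)) = x • maskVec g (v ^^^ 2 ^ v.log2) := by
      refine ih (fun i hi => hrow i ?_)
        ((xor_two_pow_log2_lt h0).trans_le (Nat.pow_le_pow_right two_pos (by omega)))
      have hi' : i < v.log2 := by
        by_contra hc
        rw [Nat.testBit_lt_two_pow ((xor_two_pow_log2_lt h0).trans_le
          (Nat.pow_le_pow_right two_pos (not_lt.1 hc)))] at hi
        exact absurd hi (by simp)
      rwa [Nat.testBit_xor, Nat.testBit_two_pow_of_ne hi'.ne', Bool.xor_false] at hi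
    have hv' : v = 2 ^ v.log2 ^^^ (v ^^^ 2 ^ v.log2) := by
      rw [Nat.xor_comm, Nat.xor_assoc, Nat.xor_self, Nat.xor_zero]
    have e : maskVec g v = maskVec g (2 ^ v.log2) + maskVec g (v ^^^ 2 ^ v.log2) := by
      rw [← maskVec_xor, ← hv']
    rw [maskVec_xor, hx, e, smul_add, maskVec_shiftLeft _ _ _ hr, maskVec_two_pow]
    congr 1
    funext j
    rw [Pi.smul_apply, smul_eq_mul, hr']
    split_ifs
    · rfl
    · rw [mul_zero]

theorem maskVec_one_zero (v : ℕ) : maskVec 1 v 0 = maskVal v := by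
  simp [maskVec]

theorem tableRow_lt (k i : ℕ) : tableRow k i < 2 ^ 64 := Nat.mod_lt _ (by norm_num)

theorem act_lt {row : ℕ → ℕ} (hrow : ∀ i, row i < 2 ^ 64) {g v : ℕ} (hv : v < 2 ^ (64 * g))
    (fuel : ℕ) : act row fuel v < 2 ^ (64 * g) := by
  induction fuel generalizing v with
  | zero => exact Nat.two_pow_pos _
  | succ f ih =>
    rw [act]
    split_ifs with h0
    · exact Nat.two_pow_pos _
    have hlog : v.log2 < 64 * g := (Nat.log2_lt h0).2 hv
    refine Nat.xor_lt_two_pow ?_ (ih ((xor_two_pow_log2_lt h0).trans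
      (Nat.pow_lt_pow_right one_lt_two hlog)))
    rw [Nat.shiftLeft_eq]
    calc _ < 2 ^ 64 * 2 ^ (64 * (v.log2 / 64)) :=
          Nat.mul_lt_mul_of_pos_right (hrow _) (Nat.two_pow_pos _)
      _ = 2 ^ (64 + 64 * (v.log2 / 64)) := (pow_add _ _ _).symm
      _ ≤ _ := Nat.pow_le_pow_right two_pos (by omega)

theorem lt_of_testBit {n v i : ℕ} (hv : v < 2 ^ n) (h : v.testBit i = true) : i < n := by
  by_contra hc
  rw [Nat.testBit_lt_two_pow (hv.trans_le (Nat.pow_le_pow_right two_pos (not_lt.1 hc)))] at h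
  exact absurd h (by simp)

section TableCorrect

/-- The entry `(k, i)` of the multiplication table is correct. -/
def RowCorrect (k i : ℕ) : Prop :=
  maskVal (tableRow k i) = Sq k * wordVal (normalWords.getD i [])

variable {k i : ℕ}

theorem maskVal_actBefore (hlt : ∀ l < k, l ∈ [1, 2, 4] → ∀ j < 64, RowCorrect l j)
    (hk : ∀ j < i, RowCorrect k j) {u : List ℕ} (hu : ∀ l ∈ u, l ∈ [1, 2, 4])
    {j v : ℕ} (hj : j < 64) (h : actBefore k i u j = some v) :
    v < 2 ^ 64 ∧ maskVal v = wordVal u * wordVal (normalWords.getD j []) := by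
  induction u generalizing v with
  | nil =>
    obtain rfl : 2 ^ j = v := by simpa [actBefore] using h
    exact ⟨Nat.pow_lt_pow_right one_lt_two hj, by
      rw [maskVal_two_pow hj, wordVal_nil, one_mul]⟩
  | cons l u ih =>
    simp only [actBefore, Option.bind_eq_some_iff] at h
    obtain ⟨w, hw, h⟩ := h
    obtain ⟨hw64, hw'⟩ := ih (fun m hm => hu m (List.mem_cons_of_mem _ hm)) hw
    split_ifs at h with hc
    obtain rfl : act (tableRow l) 64 w = v := by simpa using h
    refine ⟨act_lt (g := 1) (tableRow_lt l) hw64 64, ?_⟩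
    rw [← maskVec_one_zero, maskVec_act 1 (x := Sq l) _ hw64, Pi.smul_apply, maskVec_one_zero, hw',
      wordVal_cons, smul_eq_mul, mul_assoc]
    intro m hm
    refine ⟨tableRow_lt _ _, ?_⟩
    rcases hc with hc | ⟨rfl, hc⟩
    · exact hlt l hc (hu l List.mem_cons_self) _ (Nat.mod_lt _ (by norm_num))
    · have h64 := lt_of_testBit hw64 hm
      rw [Nat.mod_eq_of_lt h64]
      exact hk _ (lt_of_testBit hc hm)

theorem maskVal_sumActBefore (hlt : ∀ l < k, l ∈ [1, 2, 4] → ∀ j < 64, RowCorrect l j)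
    (hk : ∀ j < i, RowCorrect k j) {p : List (List ℕ)} (hp : ∀ u ∈ p, ∀ l ∈ u, l ∈ [1, 2, 4])
    {j v : ℕ} (hj : j < 64) (h : sumActBefore k i p j = some v) :
    maskVal v = sumVal p * wordVal (normalWords.getD j []) := by
  induction p generalizing v with
  | nil =>
    obtain rfl : 0 = v := by simpa [sumActBefore] using h
    simp [sumVal, maskVal_zero]
  | cons u p ih =>
    simp only [sumActBefore, List.foldr_cons, Option.bind_eq_some_iff, Option.map_eq_some_iff] at h
    obtain ⟨x, hx, y, hy, rfl⟩ := h
    rw [maskVal_xor, ih (fun u' hu' => hp u' (List.mem_cons_of_mem _ hu')) hy,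
      (maskVal_actBefore hlt hk (hp u List.mem_cons_self) hj hx).2, ← add_mul]
    rfl

theorem letters_of_mem_rules : ∀ r ∈ rules, ∀ u ∈ r.2, ∀ l ∈ u, l ∈ [1, 2, 4] := by
  decide

theorem getD_idxOf_normalWords {w : List ℕ} (h : w ∈ normalWords) :
    normalWords.idxOf w < 64 ∧ normalWords.getD (normalWords.idxOf w) [] = w := by
  have hlt := List.idxOf_lt_length_of_mem h
  refine ⟨hlt, ?_⟩
  rw [List.getD_eq_getElem _ _ hlt, List.getElem_idxOf]

theorem rowCorrect_of_rowOK (hlt : ∀ l < k, l ∈ [1, 2, 4] → ∀ j < 64, RowCorrect l j)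
    (hk : ∀ j < i, RowCorrect k j) (h : rowOK k i = true) : RowCorrect k i := by
  simp only [rowOK, Bool.or_eq_true, Bool.and_eq_true, List.any_eq_true, beq_iff_eq,
    List.contains_iff_mem, List.isPrefixOf_iff_prefix] at h
  rw [RowCorrect, ← wordVal_cons]
  rcases h with ⟨h, h'⟩ | ⟨r, hr, ⟨⟨z, hz⟩, h⟩, h'⟩
  · obtain ⟨hj, e⟩ := getD_idxOf_normalWords h
    rw [h', maskVal_two_pow hj, e]
  · rw [← hz, List.drop_left] at h h'
    obtain ⟨hj, e⟩ := getD_idxOf_normalWords h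
    rw [maskVal_sumActBefore hlt hk (letters_of_mem_rules r hr) hj h', e, ← hz, wordVal_append,
      wordVal_of_mem_rules r hr]

/-- The multiplication table of `A(2)` is correct. -/
theorem maskVal_tableRow (hk : k ∈ [1, 2, 4]) (hi : i < 64) :
    maskVal (tableRow k i) = Sq k * wordVal (normalWords.getD i []) := by
  change RowCorrect k i
  induction k using Nat.strong_induction_on generalizing i with
  | _ k ihk =>
    induction i using Nat.strong_induction_on with
    | _ i ihi =>
      exact rowCorrect_of_rowOK (fun l hl hl' j hj => ihk l hl hl' hj)
        (fun j hj => ihi j hj (hj.trans hi)) (rowOK_all k hk i hi)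

end TableCorrect

/-- Left multiplication of a bit mask by a word. -/
def actWord (g : ℕ) (w : List ℕ) (v : ℕ) : ℕ := w.foldr (fun k => act (tableRow k) (64 * g)) v

theorem actWord_lt {g v : ℕ} (hv : v < 2 ^ (64 * g)) (w : List ℕ) :
    actWord g w v < 2 ^ (64 * g) := by
  induction w with
  | nil => exact hv
  | cons k w ih => exact act_lt (tableRow_lt k) ih _

theorem maskVec_act_tableRow {k g v : ℕ} (hk : k ∈ [1, 2, 4]) (hv : v < 2 ^ (64 * g)) :
    maskVec g (act (tableRow k) (64 * g) v) = Sq k • maskVec g v :=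
  maskVec_act g (fun _ _ => ⟨tableRow_lt _ _,
    maskVal_tableRow hk (Nat.mod_lt _ (by norm_num))⟩) hv

theorem maskVec_actWord {w : List ℕ} (hw : ∀ k ∈ w, k ∈ [1, 2, 4]) {g v : ℕ}
    (hv : v < 2 ^ (64 * g)) : maskVec g (actWord g w v) = wordVal w • maskVec g v := by
  induction w with
  | nil => rw [wordVal_nil, one_smul]; rfl
  | cons k w ih =>
    rw [wordVal_cons, mul_smul, ← ih fun l hl => hw l (List.mem_cons_of_mem _ hl),
      ← maskVec_act_tableRow (hw k List.mem_cons_self) (actWord_lt hv w)]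
    rfl

theorem letters_of_mem_normalWords : ∀ w ∈ normalWords, ∀ k ∈ w, k ∈ [1, 2, 4] := by
  decide +kernel

/-- Every element of `A(2)` has a bit mask. -/
theorem exists_maskVal_of_mem {x : SteenrodAlgebra} (hx : x ∈ subalgebraA2) :
    ∃ v < 2 ^ 64, maskVal v = x := by
  have hSq : ∀ k ∈ [1, 2, 4], ∀ y : SteenrodAlgebra, (∃ v < 2 ^ 64, maskVal v = y) →
      ∃ v < 2 ^ 64, maskVal v = Sq k * y := by
    rintro k hk _ ⟨v, hv, rfl⟩
    refine ⟨_, act_lt (g := 1) (tableRow_lt k) hv 64, ?_⟩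
    rw [← maskVec_one_zero, maskVec_act_tableRow (g := 1) hk hv, Pi.smul_apply, maskVec_one_zero,
      smul_eq_mul]
  have key : ∀ y : SteenrodAlgebra, (∃ v < 2 ^ 64, maskVal v = y) →
      ∃ v < 2 ^ 64, maskVal v = x * y := by
    induction hx using Algebra.adjoin_induction with
    | mem z hz =>
      intro y hy
      rcases hz with rfl | rfl | rfl
      · exact hSq 1 (by simp) y hy
      · exact hSq 2 (by simp) y hy
      · exact hSq 4 (by simp) y hy
    | algebraMap r =>
      rintro _ ⟨v, hv, rfl⟩
      rw [← Algebra.smul_def]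
      fin_cases r
      · exact ⟨0, by norm_num, by rw [maskVal_zero]; exact (zero_smul (ZMod 2) _).symm⟩
      · exact ⟨v, hv, (one_smul (ZMod 2) _).symm⟩
    | add a b _ _ ha hb =>
      intro y hy
      obtain ⟨v, hv, hv'⟩ := ha y hy
      obtain ⟨w, hw, hw'⟩ := hb y hy
      exact ⟨v ^^^ w, Nat.xor_lt_two_pow hv hw, by rw [maskVal_xor, hv', hw', add_mul]⟩
    | mul a b _ _ ha hb =>
      intro y hy
      rw [mul_assoc]
      exact ha _ (hb y hy)
  simpa using key 1 ⟨1, by norm_num, by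
    rw [← pow_zero 2, maskVal_two_pow (by norm_num)]; rfl⟩

theorem maskVal_mem (v : ℕ) : maskVal v ∈ subalgebraA2 := by
  have hw : ∀ w : List ℕ, (∀ k ∈ w, k ∈ [1, 2, 4]) → wordVal w ∈ subalgebraA2 := by
    intro w hw
    refine list_prod_mem fun x hx => ?_
    obtain ⟨k, hk, rfl⟩ := List.mem_map.1 hx
    refine Algebra.subset_adjoin ?_
    have := hw k hk
    simp only [List.mem_cons, List.not_mem_nil, or_false] at this
    rcases this with rfl | rfl | rfl <;> simp
  refine sum_mem fun i hi => ?_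
  split_ifs
  · refine hw _ (letters_of_mem_normalWords _ ?_)
    rw [List.getD_eq_getElem _ _ (Finset.mem_range.1 hi)]
    exact List.getElem_mem _
  · exact zero_mem _

end SteenrodAlgebra

/-! ### Linear independence of the words -/

section PolynomialAction

open MvPolynomial TensorProduct Finset

/-- The coefficients of `Sqⁱ Sqʲ Xᵖ = binom(p, j) binom(p + j, i) X^{p+i+j}` satisfy the
Bullett–Macdonald identity, by induction on `p`: the total square is multiplicative. -/
theorem isBM_choose (p n : ℕ) :
    IsBM (fun i j => ((p.choose j * (p + j).choose i : ℕ) : ZMod 2)) n := by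
  have two : (2 : ZMod 2) = 0 := rfl
  have h1 : ∀ n, IsBM (fun i j => (((1 : ℕ).choose j * (1 + j).choose i : ℕ) : ZMod 2)) n := by
    intro n
    obtain rfl | rfl | rfl | rfl | hn : n = 0 ∨ n = 1 ∨ n = 2 ∨ n = 3 ∨ 4 ≤ n := by omega
    · simp [IsBM, bmSum, bmPoly]
    · have h : bmSum (fun i j => (((1 : ℕ).choose j * (1 + j).choose i : ℕ) : ZMod 2)) 1 =
          (bmPoly 0 1 + bmPoly 1 0) ⊗ₜ 1 := by
        rw [bmSum, Finset.Nat.sum_antidiagonal_eq_sum_range_succ_mk, TensorProduct.add_tmul]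
        simp [sum_range_succ]
      rw [IsBM, h, LinearMap.rTensor_tmul]
      congr 1
      simp only [AlgHom.toLinearMap_apply, bmPoly, map_add, map_mul, map_pow, bmSwap_X_zero,
        bmSwap_X_one]
      ring
    · have h : bmSum (fun i j => (((1 : ℕ).choose j * (1 + j).choose i : ℕ) : ZMod 2)) 2 = 0 := by
        rw [bmSum, Finset.Nat.sum_antidiagonal_eq_sum_range_succ_mk]
        simp [sum_range_succ, two]
      rw [IsBM, h, map_zero]
    · have h : bmSum (fun i j => (((1 : ℕ).choose j * (1 + j).choose i : ℕ) : ZMod 2)) 3 =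
          bmPoly 2 1 ⊗ₜ 1 := by
        rw [bmSum, Finset.Nat.sum_antidiagonal_eq_sum_range_succ_mk]
        simp [sum_range_succ, Nat.choose]
      rw [IsBM, h, LinearMap.rTensor_tmul]
      congr 1
      simp only [AlgHom.toLinearMap_apply, bmPoly, map_add, map_mul, map_pow, bmSwap_X_zero,
        bmSwap_X_one]
      ring
    · have h : bmSum (fun i j => (((1 : ℕ).choose j * (1 + j).choose i : ℕ) : ZMod 2)) n = 0 := by
        refine sum_eq_zero fun x hx => ?_
        rw [HasAntidiagonal.mem_antidiagonal] at hx
        rcases Nat.lt_or_ge 1 x.2 with h | h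
        · simp [Nat.choose_eq_zero_of_lt h]
        · simp [Nat.choose_eq_zero_of_lt (show 1 + x.2 < x.1 by omega)]
      rw [IsBM, h, map_zero]
  induction p generalizing n with
  | zero =>
    rcases Nat.eq_zero_or_pos n with rfl | hn
    · simp [IsBM, bmSum, bmPoly]
    · have h : bmSum (fun i j => (((0 : ℕ).choose j * (0 + j).choose i : ℕ) : ZMod 2)) n = 0 := by
        refine sum_eq_zero fun x hx => ?_
        rw [HasAntidiagonal.mem_antidiagonal] at hx
        rcases Nat.eq_zero_or_pos x.2 with h | h
        · simp [h, Nat.choose_eq_zero_of_lt (show 0 < x.1 by omega)]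
        · simp [Nat.choose_eq_zero_of_lt h]
      rw [IsBM, h, map_zero]
  | succ p ih =>
    have h := IsBM.conv (LinearMap.mul (ZMod 2) (ZMod 2)) ih h1 n
    refine Eq.mp (congrArg (fun e => IsBM e n) (funext₂ fun i j => ?_)) h
    simp only [LinearMap.mul_apply', ← Nat.cast_mul, ← Nat.cast_sum]
    refine congrArg _ (Eq.symm ?_)
    rw [sum_comm, Nat.add_choose_eq, sum_mul]
    refine sum_congr rfl fun y hy => ?_
    rw [HasAntidiagonal.mem_antidiagonal] at hy
    rw [show p + 1 + j = p + y.1 + (1 + y.2) by omega, Nat.add_choose_eq, mul_sum]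
    exact sum_congr rfl fun x _ => by ring

namespace SteenrodAlgebra

/-- `Sqⁿ` on the polynomial ring in one variable, with basis `Xᵖ`. -/
noncomputable def powerOp (n : ℕ) : Module.End (ZMod 2) (ℕ →₀ ZMod 2) :=
  Finsupp.linearCombination (ZMod 2) fun p => Finsupp.single (p + n) (p.choose n : ZMod 2)

theorem powerOp_single (n p : ℕ) :
    powerOp n (Finsupp.single p 1) = Finsupp.single (p + n) (p.choose n : ZMod 2) := by
  rw [powerOp, Finsupp.linearCombination_single, one_smul]

/-- The action of `A` on the polynomial ring in one variable. -/
noncomputable def powerAction : SteenrodAlgebra →ₐ[ZMod 2] Module.End (ZMod 2) (ℕ →₀ ZMod 2) :=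
  lift powerOp (by
    refine Finsupp.lhom_ext' fun p => LinearMap.ext_ring ?_
    rw [LinearMap.comp_apply, Finsupp.lsingle_apply, powerOp_single]
    simp) (by
    intro a b _ hab
    have hc : ∀ i j p, (powerOp i * powerOp j) (Finsupp.single p 1) =
        Finsupp.single (p + (i + j)) ((p.choose j * (p + j).choose i : ℕ) : ZMod 2) := by
      intro i j p
      have hs : Finsupp.single (p + j) (p.choose j : ZMod 2) =
          (p.choose j : ZMod 2) • Finsupp.single (p + j) 1 := by
        rw [Finsupp.smul_single, smul_eq_mul, mul_one]
      rw [Module.End.mul_apply, powerOp_single, hs, map_smul, powerOp_single,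
        Finsupp.smul_single, smul_eq_mul, Nat.cast_mul, add_assoc, add_comm j]
    refine Finsupp.lhom_ext' fun p => LinearMap.ext_ring ?_
    rw [LinearMap.comp_apply, LinearMap.comp_apply, Finsupp.lsingle_apply, hc,
      (isBM_choose p (a + b)).adem hab]
    simp only [ademSum, LinearMap.sum_apply, LinearMap.smul_apply, hc]
    rw [Finsupp.single_finsetSum]
    refine sum_congr rfl fun j hj => ?_
    rw [mem_range] at hj
    rw [Finsupp.smul_single, Nat.sub_add_cancel (by omega)])

theorem powerAction_Sq (n p : ℕ) : powerAction (Sq n) (Finsupp.single p 1) =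
    (p.choose n : ZMod 2) • Finsupp.single (p + n) 1 := by
  rw [powerAction, lift_Sq, powerOp_single, Finsupp.smul_single, smul_eq_mul, mul_one]

/-- The action of `A` on a tensor product of two modules, through the coproduct. -/
noncomputable def tensorAction {M N : Type} [AddCommGroup M] [Module (ZMod 2) M] [AddCommGroup N]
    [Module (ZMod 2) N] (f : SteenrodAlgebra →ₐ[ZMod 2] Module.End (ZMod 2) M)
    (g : SteenrodAlgebra →ₐ[ZMod 2] Module.End (ZMod 2) N) :
    SteenrodAlgebra →ₐ[ZMod 2] Module.End (ZMod 2) (M ⊗[ZMod 2] N) :=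
  (Module.endTensorEndAlgHom (R := ZMod 2) (S := ZMod 2) (A := ZMod 2)).comp
    ((Algebra.TensorProduct.map f g).comp coproduct)

theorem tensorAction_Sq {M N : Type} [AddCommGroup M] [Module (ZMod 2) M] [AddCommGroup N]
    [Module (ZMod 2) N] (f : SteenrodAlgebra →ₐ[ZMod 2] Module.End (ZMod 2) M)
    (g : SteenrodAlgebra →ₐ[ZMod 2] Module.End (ZMod 2) N) (n : ℕ) (x : M) (y : N) :
    tensorAction f g (Sq n) (x ⊗ₜ y) =
      ∑ i ∈ antidiagonal n, f (Sq i.1) x ⊗ₜ[ZMod 2] g (Sq i.2) y := by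
  simp only [tensorAction, AlgHom.comp_apply, coproduct_Sq, map_sum, LinearMap.sum_apply,
    Algebra.TensorProduct.map_tmul, Module.endTensorEndAlgHom_apply]
  rfl

/-- The action of `A` on the polynomial ring in three variables. -/
noncomputable def polyAction :
    SteenrodAlgebra →ₐ[ZMod 2] Module.End (ZMod 2)
      (((ℕ →₀ ZMod 2) ⊗[ZMod 2] (ℕ →₀ ZMod 2)) ⊗[ZMod 2] (ℕ →₀ ZMod 2)) :=
  tensorAction (tensorAction powerAction powerAction) powerAction

/-- The monomial `Xᵖ Y^q Zʳ`. -/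
noncomputable def mon (m : ℕ × ℕ × ℕ) :
    ((ℕ →₀ ZMod 2) ⊗[ZMod 2] (ℕ →₀ ZMod 2)) ⊗[ZMod 2] (ℕ →₀ ZMod 2) :=
  (Finsupp.single m.1 1 ⊗ₜ Finsupp.single m.2.1 1) ⊗ₜ Finsupp.single m.2.2 1

/-- Addition of a monomial to a sum of distinct monomials over `ℤ/2`. -/
def toggle (m : ℕ × ℕ × ℕ) (l : List (ℕ × ℕ × ℕ)) : List (ℕ × ℕ × ℕ) :=
  if m ∈ l then l.erase m else m :: l

/-- The list of all `(i, j, k)` with `i + j + k = n`. -/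
def triples (n : ℕ) : List (ℕ × ℕ × ℕ) :=
  (List.range (n + 1)).flatMap fun d => (List.range (d + 1)).map fun i => (i, d - i, n - d)

/-- `binom(p, i)` modulo 2, in a form that is quick to evaluate. -/
def oddChoose (p i : ℕ) : Bool := (p.descFactorial i / i.factorial) % 2 == 1

/-- `Sqⁿ` of a sum of monomials. -/
def sqMons (n : ℕ) (l : List (ℕ × ℕ × ℕ)) : List (ℕ × ℕ × ℕ) :=
  l.foldr (fun m acc => (triples n).foldr (fun e acc =>
    if oddChoose m.1 e.1 && oddChoose m.2.1 e.2.1 && oddChoose m.2.2 e.2.2 then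
      toggle (m.1 + e.1, m.2.1 + e.2.1, m.2.2 + e.2.2) acc else acc) acc) []

/-- The action of a word on `X⁷ Y³ Z`. -/
def wordMons (w : List ℕ) : List (ℕ × ℕ × ℕ) := w.foldr sqMons [(7, 3, 1)]

/-- The top word, of degree `23`, sends `X⁷ Y³ Z` to a polynomial that contains `X²⁴ Y⁶ Z⁴`. The
other normal words have smaller degree. -/
theorem wordMons_normalWords : ∀ i < 64,
    (wordMons (normalWords.getD i [])).count (24, 6, 4) % 2 = if i = 63 then 1 else 0 := by
  decide +kernel

/-- The sum of the monomials of a list. -/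
noncomputable def monsVal (l : List (ℕ × ℕ × ℕ)) :
    ((ℕ →₀ ZMod 2) ⊗[ZMod 2] (ℕ →₀ ZMod 2)) ⊗[ZMod 2] (ℕ →₀ ZMod 2) :=
  (l.map mon).sum

theorem monsVal_toggle (m : ℕ × ℕ × ℕ) (l : List (ℕ × ℕ × ℕ)) :
    monsVal (toggle m l) = mon m + monsVal l := by
  rw [toggle]
  split_ifs with h
  · have e : monsVal l = mon m + monsVal (l.erase m) := by
      rw [monsVal, (List.perm_cons_erase h).map mon |>.sum_eq]
      rfl
    rw [e, ← add_assoc, ← two_smul (ZMod 2) (mon m), show (2 : ZMod 2) = 0 from rfl, zero_smul,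
      zero_add]
  · rfl

theorem oddChoose_smul {M : Type} [AddCommMonoid M] [Module (ZMod 2) M] (p i : ℕ) (x : M) :
    (p.choose i : ZMod 2) • x = if oddChoose p i then x else 0 := by
  rw [oddChoose, ← Nat.choose_eq_descFactorial_div_factorial]
  rcases Nat.mod_two_eq_zero_or_one (p.choose i) with h | h
  · rw [(ZMod.natCast_eq_zero_iff _ _).2 (Nat.dvd_of_mod_eq_zero h), h, zero_smul]
    rfl
  · rw [← ZMod.natCast_mod, h, Nat.cast_one, one_smul]
    rfl

theorem polyAction_mon (n : ℕ) (m : ℕ × ℕ × ℕ) (acc : List (ℕ × ℕ × ℕ)) :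
    monsVal ((triples n).foldr (fun e acc =>
      if oddChoose m.1 e.1 && oddChoose m.2.1 e.2.1 && oddChoose m.2.2 e.2.2 then
        toggle (m.1 + e.1, m.2.1 + e.2.1, m.2.2 + e.2.2) acc else acc) acc) =
      polyAction (Sq n) (mon m) + monsVal acc := by
  have key : ∀ l : List (ℕ × ℕ × ℕ), monsVal (l.foldr (fun e acc =>
      if oddChoose m.1 e.1 && oddChoose m.2.1 e.2.1 && oddChoose m.2.2 e.2.2 then
        toggle (m.1 + e.1, m.2.1 + e.2.1, m.2.2 + e.2.2) acc else acc) acc) =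
      (l.map fun e => (m.1.choose e.1 : ZMod 2) • (m.2.1.choose e.2.1 : ZMod 2) •
        (m.2.2.choose e.2.2 : ZMod 2) • mon (m.1 + e.1, m.2.1 + e.2.1, m.2.2 + e.2.2)).sum +
        monsVal acc := by
    intro l
    induction l with
    | nil => simp
    | cons e l ih =>
      rw [List.foldr_cons, List.map_cons, List.sum_cons, add_assoc, ← ih, oddChoose_smul,
        oddChoose_smul, oddChoose_smul]
      cases oddChoose m.1 e.1 <;> cases oddChoose m.2.1 e.2.1 <;> cases oddChoose m.2.2 e.2.2 <;>
        simp [monsVal_toggle]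
  rw [key]
  congr 1
  have hsum : ∀ (f : ℕ → ((ℕ →₀ ZMod 2) ⊗[ZMod 2] (ℕ →₀ ZMod 2)) ⊗[ZMod 2] (ℕ →₀ ZMod 2)) n,
      ((List.range n).map f).sum = ∑ i ∈ range n, f i := fun _ _ => rfl
  rw [triples, List.map_flatMap, List.flatMap_def, List.sum_flatten, List.map_map, hsum, mon,
    polyAction, tensorAction_Sq,
    Finset.Nat.sum_antidiagonal_eq_sum_range_succ_mk]
  refine sum_congr rfl fun d _ => ?_
  rw [Function.comp_apply, List.map_map, hsum, tensorAction_Sq,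
    Finset.Nat.sum_antidiagonal_eq_sum_range_succ_mk,
    TensorProduct.sum_tmul]
  refine sum_congr rfl fun i _ => ?_
  simp only [powerAction_Sq, Function.comp_apply, mon, TensorProduct.smul_tmul',
    TensorProduct.tmul_smul]
  rw [smul_comm (m.1.choose i : ZMod 2), smul_comm (m.2.2.choose (n - d) : ZMod 2),
    smul_comm (m.2.2.choose (n - d) : ZMod 2)]

theorem monsVal_sqMons (n : ℕ) (l : List (ℕ × ℕ × ℕ)) :
    monsVal (sqMons n l) = polyAction (Sq n) (monsVal l) := by
  induction l with
  | nil => simp [sqMons, monsVal]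
  | cons m l ih =>
    rw [sqMons, List.foldr_cons, polyAction_mon]
    rw [sqMons] at ih
    rw [ih, ← map_add]
    rfl

theorem monsVal_wordMons (w : List ℕ) :
    monsVal (wordMons w) = polyAction (wordVal w) (mon (7, 3, 1)) := by
  induction w with
  | nil => rw [wordVal_nil, map_one, Module.End.one_apply]; simp [wordMons, monsVal]
  | cons k w ih =>
    rw [wordVal_cons, map_mul, Module.End.mul_apply, ← ih, ← monsVal_sqMons]
    rfl

/-- The coefficient of `X²⁴ Y⁶ Z⁴`. -/
noncomputable def topCoeff :
    ((ℕ →₀ ZMod 2) ⊗[ZMod 2] (ℕ →₀ ZMod 2)) ⊗[ZMod 2] (ℕ →₀ ZMod 2) →ₗ[ZMod 2] ZMod 2 :=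
  LinearMap.mul' (ZMod 2) (ZMod 2) ∘ₗ TensorProduct.map
    (LinearMap.mul' (ZMod 2) (ZMod 2) ∘ₗ TensorProduct.map (Finsupp.lapply 24) (Finsupp.lapply 6))
    (Finsupp.lapply 4)

theorem topCoeff_mon (m : ℕ × ℕ × ℕ) : topCoeff (mon m) = if m = (24, 6, 4) then 1 else 0 := by
  obtain ⟨p, q, r⟩ := m
  simp only [topCoeff, mon, LinearMap.comp_apply, TensorProduct.map_tmul, LinearMap.mul'_apply,
    Finsupp.lapply_apply, Finsupp.single_apply, Prod.mk.injEq]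
  split_ifs <;> simp_all

theorem topCoeff_monsVal (l : List (ℕ × ℕ × ℕ)) :
    topCoeff (monsVal l) = (l.count (24, 6, 4) : ZMod 2) := by
  induction l with
  | nil => simp [monsVal]
  | cons m l ih =>
    have h : monsVal (m :: l) = mon m + monsVal l := rfl
    rw [h, map_add, ih, topCoeff_mon, List.count_cons]
    split_ifs with h1 h2 h2 <;> simp_all [add_comm]

/-- A linear functional that isolates the top normal word. -/
noncomputable def topFunctional : SteenrodAlgebra →ₗ[ZMod 2] ZMod 2 :=
  topCoeff ∘ₗ (LinearMap.applyₗ (mon (7, 3, 1))) ∘ₗ polyAction.toLinearMap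

theorem topFunctional_maskVal (v : ℕ) :
    topFunctional (maskVal v) = if v.testBit 63 then 1 else 0 := by
  have h : ∀ i < 64, topFunctional (wordVal (normalWords.getD i [])) = if i = 63 then 1 else 0 := by
    intro i hi
    have e : topFunctional (wordVal (normalWords.getD i [])) =
        topCoeff (polyAction (wordVal (normalWords.getD i [])) (mon (7, 3, 1))) := rfl
    rw [e, ← monsVal_wordMons, topCoeff_monsVal, ← ZMod.natCast_mod, wordMons_normalWords i hi]
    split_ifs <;> simp
  rw [maskVal, map_sum, Finset.sum_eq_single 63]
  · split_ifs
    · rw [h 63 (by norm_num), if_pos rfl]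
    · rw [map_zero]
  · intro i hi hne
    split_ifs
    · rw [h i (mem_range.1 hi), if_neg hne]
    · rw [map_zero]
  · simp

/-- Row `i` lists the positions of normal words whose sum `d` is dual to the `i`th normal word `w`:
the coefficient of the top word is `1` in `d w`, and `0` in the product of `d` with any other
normal word. -/
def dualRows : List (List ℕ) := [
    [63], [62], [61], [59], [60], [58], [57], [56], [55, 56], [52, 54], [52], [53], [48], [49],
    [50], [48, 51], [46], [47], [45], [43], [41, 43], [42], [41, 43, 44], [36, 38, 40], [36, 37],
    [36, 40], [36, 39], [36], [32, 33, 34, 35], [32], [33], [34], [28, 29], [28, 30], [28, 31],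
    [28], [23, 24, 25, 26, 27], [24], [23], [26], [23, 25], [20, 22], [21], [19, 20, 22], [22],
    [18], [16], [17], [12, 15], [13], [14], [15], [9, 10], [11], [9], [8], [7, 8], [6], [5], [3],
    [4], [2], [1], [0]]

/-- The bit mask of the product of the sum of some normal words with a bit mask. -/
def mulRow (r : List ℕ) (v : ℕ) : ℕ :=
  r.foldr (fun b acc => actWord 1 (normalWords.getD b []) v ^^^ acc) 0

/-- Poincaré duality for `A(2)`: the pairing by the coefficient of the top word in a product is
perfect. -/
theorem dualRows_spec : ∀ i < 64, ∀ j < 64,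
    (mulRow (dualRows.getD i []) (2 ^ j)).testBit 63 = decide (j = i) := by
  decide +kernel

/-- The sum of the normal words in the given positions. -/
noncomputable def rowVal (r : List ℕ) : SteenrodAlgebra :=
  (r.map fun b => wordVal (normalWords.getD b [])).sum

theorem letters_of_getD_normalWords (b : ℕ) : ∀ k ∈ normalWords.getD b [], k ∈ [1, 2, 4] := by
  rcases lt_or_ge b normalWords.length with h | h
  · rw [List.getD_eq_getElem _ _ h]
    exact letters_of_mem_normalWords _ (List.getElem_mem _)
  · rw [List.getD_eq_default _ _ h]
    simp

theorem maskVal_mulRow (r : List ℕ) {v : ℕ} (hv : v < 2 ^ 64) :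
    maskVal (mulRow r v) = rowVal r * maskVal v := by
  induction r with
  | nil => simp [mulRow, rowVal, maskVal_zero]
  | cons b r ih =>
    have e : mulRow (b :: r) v = actWord 1 (normalWords.getD b []) v ^^^ mulRow r v := rfl
    rw [e, maskVal_xor, ih, ← maskVec_one_zero (actWord _ _ _),
      maskVec_actWord (letters_of_getD_normalWords b) (by simpa using hv), Pi.smul_apply,
      maskVec_one_zero, smul_eq_mul, rowVal, rowVal, List.map_cons, List.sum_cons, add_mul]

/-- The normal words are linearly independent in `A`. -/
theorem testBit_eq_false_of_maskVal_eq_zero {v : ℕ} (hv : maskVal v = 0) {i : ℕ} (hi : i < 64) :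
    v.testBit i = false := by
  have h : topFunctional (rowVal (dualRows.getD i []) * maskVal v) =
      if v.testBit i then 1 else 0 := by
    have hj : ∀ j < 64, topFunctional
        (rowVal (dualRows.getD i []) * wordVal (normalWords.getD j [])) =
          if j = i then 1 else 0 := by
      intro j hj
      rw [← maskVal_two_pow hj, ← maskVal_mulRow _ (Nat.pow_lt_pow_right one_lt_two hj),
        topFunctional_maskVal, dualRows_spec i hi j hj]
      simp
    rw [maskVal, mul_sum, map_sum, Finset.sum_eq_single i]
    · split_ifs
      · rw [hj i hi, if_pos rfl]
      · rw [mul_zero, map_zero]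
    · intro j hj' hne
      split_ifs
      · rw [hj j (mem_range.1 hj'), if_neg hne]
      · rw [mul_zero, map_zero]
    · exact fun hc => absurd (mem_range.2 hi) hc
  rw [hv, mul_zero, map_zero] at h
  by_contra hc
  rw [Bool.not_eq_false] at hc
  rw [hc, if_pos rfl] at h
  exact zero_ne_one h

theorem eq_zero_of_maskVec_eq_zero {g v : ℕ} (hv : v < 2 ^ (64 * g)) (h : maskVec g v = 0) :
    v = 0 := by
  refine Nat.eq_of_testBit_eq fun i => ?_
  rw [Nat.zero_testBit]
  rcases lt_or_ge i (64 * g) with hi | hi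
  · have hj : i / 64 < g := by omega
    have := testBit_eq_false_of_maskVal_eq_zero (congrFun h ⟨i / 64, hj⟩)
      (Nat.mod_lt i (show 64 > 0 by norm_num))
    rwa [Nat.testBit_shiftRight, Nat.div_add_mod] at this
  · exact Nat.testBit_lt_two_pow (hv.trans_le (Nat.pow_le_pow_right two_pos hi))

theorem exists_maskVec_of_mem {g : ℕ} {x : Fin g → SteenrodAlgebra}
    (hx : ∀ i, x i ∈ subalgebraA2) : ∃ v < 2 ^ (64 * g), maskVec g v = x := by
  induction g with
  | zero => exact ⟨0, by simp, Subsingleton.elim _ _⟩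
  | succ g ih =>
    obtain ⟨v, hv, hv'⟩ := ih fun i => hx i.castSucc
    obtain ⟨w, hw, hw'⟩ := exists_maskVal_of_mem (hx (Fin.last g))
    refine ⟨v ^^^ w <<< (64 * g), Nat.xor_lt_two_pow (hv.trans_le
      (Nat.pow_le_pow_right two_pos (by omega))) ?_, ?_⟩
    · rw [Nat.shiftLeft_eq, mul_add, mul_one, pow_add, mul_comm]
      exact Nat.mul_lt_mul_of_pos_left hw (Nat.two_pow_pos _)
    · funext i
      rw [maskVec_xor, maskVec_shiftLeft _ _ _ hw, Pi.add_apply]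
      refine Fin.lastCases ?_ (fun i => ?_) i
      · simp only [Fin.val_last, if_true, hw', maskVec, Nat.shiftRight_eq_div_pow,
          Nat.div_eq_of_lt hv, maskVal_zero, zero_add]
      · rw [← congrFun hv' i]
        simp [maskVec, i.2.ne]

end SteenrodAlgebra

end PolynomialAction

/-! ### Verifying presentations by linear algebra over `ℤ/2` -/

namespace SteenrodAlgebra

/-- A vector over `A`, written as a sum of words (in the letters `1`, `2`, `4`), each in one of the
coordinates. -/
abbrev Row : Type := List (ℕ × List ℕ)

/-- The bit mask of a vector. -/
def rowMask (g : ℕ) (r : Row) : ℕ :=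
  r.foldr (fun e acc => actWord g e.2 (2 ^ (64 * e.1)) ^^^ acc) 0

/-- The bit masks of the products of the normal words with a vector. -/
def orbit (g v : ℕ) : List ℕ := (List.range 64).map fun i => actWord g (normalWords.getD i []) v

/-- Clear the leading bit of `e` in `v`, by adding `e` if necessary. -/
def clearBit (e v : ℕ) : ℕ :=
  Nat.xor v (Nat.mul e (Nat.land (Nat.shiftRight v (Nat.log2 e)) 1))

/-- Reduce `v` by the vectors of an echelon list; the vector added last comes first. -/
def reduceBy (E : List ℕ) (v : ℕ) : ℕ := E.foldr clearBit v

/-- Extend an echelon list by a vector, unless this would give a leading bit below `b`. -/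
def extend (b : ℕ) (E : List ℕ) (v : ℕ) : List ℕ :=
  if reduceBy E v < 2 ^ b then E else reduceBy E v :: E

/-- The generator `n` of the graph of the map given by the rows `φ`: the image of the `n`th basis
vector stands above the `64 h` bits of that vector. -/
def graphMask (g : ℕ) (φ : List Row) (n : ℕ) : ℕ :=
  (actWord g (normalWords.getD (n % 64) []) (rowMask g (φ.getD (n / 64) [])) <<<
    (64 * φ.length)) ^^^ 2 ^ n

/-- The vector has `g` coordinates, and its words are in the letters `1`, `2`, `4`. -/
def rowOk (g : ℕ) (r : Row) : Bool :=
  r.all fun e => decide (e.1 < g) && e.2.all fun k => decide (k ∈ [1, 2, 4])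

/-- The bit mask of the image of a vector under the map with rows `φ`. -/
def imageMask (g : ℕ) (φ : List Row) (s : Row) : ℕ :=
  s.foldr (fun e acc => actWord g e.2 (rowMask g (φ.getD e.1 [])) ^^^ acc) 0

/-- The verification, over `A(2)`, that the vectors which the map with rows `φ` sends into the span
of `R` are those in the span of `S`: the rows of `S` are sent into the span of `R`, and elimination
on the graph of the map reduces all relations to the span of `S`. -/
def checkExact (g : ℕ) (φ R S : List Row) : Bool :=
  -- echelon lists of the spans of `S` and `R`, and of the graph of the map modulo the span of `R`
  let E₀ := (S.flatMap fun s => orbit φ.length (rowMask φ.length s)).foldl (extend 0) []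
  let L := R.flatMap fun r => orbit g (rowMask g r)
  let E₁ := L.foldl (extend 0) []
  let G := (List.range (64 * φ.length)).map (graphMask g φ)
  let E₂ := G.foldl (extend (64 * φ.length)) (E₁.map (· <<< (64 * φ.length)))
  φ.all (rowOk g) && R.all (rowOk g) && S.all (rowOk φ.length) &&
  S.all (fun s => reduceBy E₁ (imageMask g φ s) == 0) &&
  E₂.all (fun e => decide (2 ^ (64 * φ.length) ≤ e)) &&
  L.all (fun v => reduceBy E₀ (reduceBy E₂ (v <<< (64 * φ.length))) == 0) &&
  G.all (fun v => reduceBy E₀ (reduceBy E₂ v) == 0)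


end SteenrodAlgebra

/-! ### Soundness of the verification -/

namespace SteenrodAlgebra

theorem clearBit_eq (e v : ℕ) : clearBit e v = if v.testBit e.log2 then v ^^^ e else v := by
  have h : Nat.land (Nat.shiftRight v (Nat.log2 e)) 1 = (v.testBit e.log2).toNat := by
    rw [Nat.toNat_testBit, ← Nat.shiftRight_eq_div_pow]
    exact Nat.and_one_is_mod _
  have h' : clearBit e v = v ^^^ (e * (v.testBit e.log2).toNat) := by rw [← h]; rfl
  rw [h']
  cases v.testBit e.log2 <;> simp

theorem clearBit_xor (e v w : ℕ) : clearBit e (v ^^^ w) = clearBit e v ^^^ clearBit e w := by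
  simp only [clearBit_eq, Nat.testBit_xor]
  cases v.testBit e.log2 <;> cases w.testBit e.log2 <;>
    simp [Nat.xor_comm, Nat.xor_left_comm]

theorem reduceBy_xor (E : List ℕ) (v w : ℕ) :
    reduceBy E (v ^^^ w) = reduceBy E v ^^^ reduceBy E w := by
  induction E with
  | nil => rfl
  | cons e E ih =>
    change clearBit e (reduceBy E (v ^^^ w)) =
      clearBit e (reduceBy E v) ^^^ clearBit e (reduceBy E w)
    rw [ih, clearBit_xor]

theorem reduceBy_zero (E : List ℕ) : reduceBy E 0 = 0 := by
  have := reduceBy_xor E 0 0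
  rwa [Nat.xor_self, Nat.xor_self] at this

/-- Reduction does not touch a vector that lies below all leading bits. -/
theorem reduceBy_of_lt {E : List ℕ} {b v : ℕ} (hE : ∀ e ∈ E, 2 ^ b ≤ e) (hv : v < 2 ^ b) :
    reduceBy E v = v := by
  induction E with
  | nil => rfl
  | cons e E ih =>
    change clearBit e (reduceBy E v) = v
    have he := hE e List.mem_cons_self
    have he0 : e ≠ 0 := ((Nat.two_pow_pos b).trans_le he).ne'
    rw [ih fun x hx => hE x (List.mem_cons_of_mem _ hx), clearBit_eq, Nat.testBit_lt_two_pow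
      (hv.trans_le (Nat.pow_le_pow_right two_pos ((Nat.le_log2 he0).2 he)))]
    rfl

section Span

variable {g : ℕ} (Q : Submodule SteenrodAlgebra (Fin g → SteenrodAlgebra))

theorem maskVec_reduceBy_mem_iff {E : List ℕ} (hE : ∀ e ∈ E, maskVec g e ∈ Q) (v : ℕ) :
    maskVec g (reduceBy E v) ∈ Q ↔ maskVec g v ∈ Q := by
  induction E with
  | nil => rfl
  | cons e E ih =>
    change maskVec g (clearBit e (reduceBy E v)) ∈ Q ↔ _
    rw [← ih fun x hx => hE x (List.mem_cons_of_mem _ hx), clearBit_eq]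
    split_ifs
    · rw [maskVec_xor]
      exact Q.add_mem_iff_left (hE e List.mem_cons_self)
    · rfl

theorem maskVec_foldl_extend_mem {b : ℕ} {L E : List ℕ} (hE : ∀ e ∈ E, maskVec g e ∈ Q)
    (hL : ∀ v ∈ L, maskVec g v ∈ Q) : ∀ e ∈ L.foldl (extend b) E, maskVec g e ∈ Q := by
  induction L generalizing E with
  | nil => exact hE
  | cons v L ih =>
    refine ih (fun e he => ?_) fun w hw => hL w (List.mem_cons_of_mem _ hw)
    rw [extend] at he
    split_ifs at he
    · exact hE e he
    · rcases List.mem_cons.1 he with rfl | he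
      · exact (maskVec_reduceBy_mem_iff Q hE v).2 (hL v List.mem_cons_self)
      · exact hE e he

end Span

/-- The vector over `A` given by a row. -/
noncomputable def rowVec (g : ℕ) (r : Row) : Fin g → SteenrodAlgebra :=
  (r.map fun e => fun i : Fin g => if (i : ℕ) = e.1 then wordVal e.2 else 0).sum

/-- The submodule of `A^g` spanned by a list of rows. -/
noncomputable def rowSpan (g : ℕ) (L : List Row) :
    Submodule SteenrodAlgebra (Fin g → SteenrodAlgebra) :=
  Submodule.span SteenrodAlgebra (Set.range fun k : Fin L.length => rowVec g L[k])

/-- The map from a free module given by the images of its basis. -/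
noncomputable def rowMap (g : ℕ) (φ : List Row) :
    (Fin φ.length → SteenrodAlgebra) →ₗ[SteenrodAlgebra] (Fin g → SteenrodAlgebra) :=
  Fintype.linearCombination SteenrodAlgebra fun k : Fin φ.length => rowVec g φ[k]

theorem rowVec_mem_rowSpan {g : ℕ} {L : List Row} {r : Row} (hr : r ∈ L) :
    rowVec g r ∈ rowSpan g L := by
  obtain ⟨k, hk, rfl⟩ := List.getElem_of_mem hr
  exact Submodule.subset_span ⟨⟨k, hk⟩, rfl⟩

theorem rowSpan_le {g : ℕ} {L : List Row}
    {Q : Submodule SteenrodAlgebra (Fin g → SteenrodAlgebra)} (h : ∀ r ∈ L, rowVec g r ∈ Q) :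
    rowSpan g L ≤ Q := by
  refine Submodule.span_le.2 ?_
  rintro _ ⟨k, rfl⟩
  exact h _ (List.getElem_mem _)

theorem rowMap_single {g : ℕ} {φ : List Row} (k : Fin φ.length) (x : SteenrodAlgebra) :
    rowMap g φ (Pi.single k x) = x • rowVec g φ[k] := by
  rw [rowMap, Fintype.linearCombination_apply_single]

theorem range_rowMap (g : ℕ) (φ : List Row) : LinearMap.range (rowMap g φ) = rowSpan g φ := by
  rw [rowMap, Fintype.range_linearCombination, rowSpan]

theorem rowSpan_append (g : ℕ) (L L' : List Row) :
    rowSpan g (L ++ L') = rowSpan g L ⊔ rowSpan g L' := by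
  refine le_antisymm (rowSpan_le fun r hr => ?_) (sup_le (rowSpan_le fun r hr => ?_)
    (rowSpan_le fun r hr => ?_))
  · rcases List.mem_append.1 hr with hr | hr
    · exact Submodule.mem_sup_left (rowVec_mem_rowSpan hr)
    · exact Submodule.mem_sup_right (rowVec_mem_rowSpan hr)
  · exact rowVec_mem_rowSpan (List.mem_append_left _ hr)
  · exact rowVec_mem_rowSpan (List.mem_append_right _ hr)

theorem rowOk_cons {g : ℕ} {e : ℕ × List ℕ} {r : Row} (h : rowOk g (e :: r) = true) :
    (e.1 < g ∧ ∀ k ∈ e.2, k ∈ [1, 2, 4]) ∧ rowOk g r = true := by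
  simpa only [rowOk, List.all_cons, Bool.and_eq_true, decide_eq_true_eq, List.all_eq_true] using h

theorem two_pow_mul_lt {p g : ℕ} (h : p < g) : 2 ^ (64 * p) < 2 ^ (64 * g) :=
  Nat.pow_lt_pow_right one_lt_two (by omega)

theorem maskVec_two_pow_mul {g p : ℕ} (w : List ℕ) :
    wordVal w • maskVec g (2 ^ (64 * p)) =
      fun i : Fin g => if (i : ℕ) = p then wordVal w else 0 := by
  rw [maskVec_two_pow]
  funext i
  have h1 : 64 * p / 64 = p := by omega
  have h2 : 64 * p % 64 = 0 := by omega
  rw [h1, h2, Pi.smul_apply, smul_eq_mul]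
  split_ifs
  · exact mul_one _
  · exact mul_zero _

theorem maskVec_rowMask {g : ℕ} {r : Row} (h : rowOk g r = true) :
    rowMask g r < 2 ^ (64 * g) ∧ maskVec g (rowMask g r) = rowVec g r := by
  induction r with
  | nil => exact ⟨Nat.two_pow_pos _, maskVec_zero g⟩
  | cons e r ih =>
    obtain ⟨⟨he, hw⟩, hr⟩ := rowOk_cons h
    obtain ⟨h1, h2⟩ := ih hr
    refine ⟨Nat.xor_lt_two_pow (actWord_lt (two_pow_mul_lt he) _) h1, ?_⟩
    change maskVec g (actWord g e.2 (2 ^ (64 * e.1)) ^^^ rowMask g r) = _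
    rw [maskVec_xor, h2, maskVec_actWord hw (two_pow_mul_lt he), maskVec_two_pow_mul]
    rfl

theorem rowVec_apply_mem {g : ℕ} {r : Row} (h : rowOk g r = true) (i : Fin g) :
    rowVec g r i ∈ subalgebraA2 := by
  rw [← (maskVec_rowMask h).2]
  exact maskVal_mem _

theorem maskVec_imageMask {g : ℕ} {φ : List Row} (hφ : ∀ r ∈ φ, rowOk g r = true) {s : Row}
    (hs : rowOk φ.length s = true) :
    maskVec g (imageMask g φ s) = rowMap g φ (rowVec φ.length s) := by
  induction s with
  | nil => exact (maskVec_zero g).trans (map_zero _).symm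
  | cons e s ih =>
    obtain ⟨⟨he, hw⟩, hr⟩ := rowOk_cons hs
    change maskVec g (actWord g e.2 (rowMask g (φ.getD e.1 [])) ^^^ imageMask g φ s) = _
    have hmem := List.getElem_mem he
    have hsum : rowVec φ.length (e :: s) =
        Pi.single (⟨e.1, he⟩ : Fin φ.length) (wordVal e.2) + rowVec φ.length s := by
      refine congrArg (· + _) (funext fun i => ?_)
      rw [Pi.single_apply]
      exact if_congr (by rw [Fin.ext_iff]) rfl rfl
    rw [maskVec_xor, ih hr, List.getD_eq_getElem _ _ he, hsum, map_add, rowMap_single,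
      maskVec_actWord hw (maskVec_rowMask (hφ _ hmem)).1, (maskVec_rowMask (hφ _ hmem)).2]
    rfl

theorem maskVec_mem_of_mem_orbits {g : ℕ} {L : List Row} (hL : ∀ r ∈ L, rowOk g r = true) :
    ∀ v ∈ L.flatMap fun r => orbit g (rowMask g r), maskVec g v ∈ rowSpan g L := by
  intro v hv
  obtain ⟨r, hr, hv⟩ := List.mem_flatMap.1 hv
  obtain ⟨i, -, rfl⟩ := List.mem_map.1 hv
  obtain ⟨h1, h2⟩ := maskVec_rowMask (hL r hr)
  rw [maskVec_actWord (letters_of_getD_normalWords i) h1, h2]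
  exact Submodule.smul_mem _ _ (rowVec_mem_rowSpan hr)

section Soundness

variable {g : ℕ} {φ R S : List Row}

/-- Over `A(2)`, the verification shows that a vector sent into the span of `R` lies in the span of
`S`. -/
theorem mem_rowSpan_of_checkExact (h : checkExact g φ R S = true)
    {x : Fin φ.length → SteenrodAlgebra} (hx : ∀ i, x i ∈ subalgebraA2)
    {c : Fin R.length → SteenrodAlgebra} (hc : ∀ k, c k ∈ subalgebraA2)
    (hxc : rowMap g φ x = ∑ k, c k • rowVec g R[k]) : x ∈ rowSpan φ.length S := by
  simp only [checkExact, Bool.and_eq_true, List.all_eq_true, beq_iff_eq, decide_eq_true_eq] at h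
  obtain ⟨⟨⟨⟨⟨⟨hφ, hR⟩, hS⟩, -⟩, hE₂⟩, hrel⟩, hgraph⟩ := h
  have hE₀ := maskVec_foldl_extend_mem (rowSpan φ.length S) (b := 0) (E := []) (by simp)
    (maskVec_mem_of_mem_orbits hS)
  generalize (S.flatMap fun s => orbit φ.length (rowMask φ.length s)).foldl (extend 0) [] = E₀
    at hE₀ hrel hgraph
  generalize List.foldl (extend (64 * φ.length)) _ _ = E₂ at hE₂ hrel hgraph
  have hlt : ∀ k < 64 * φ.length, 2 ^ k < 2 ^ (64 * φ.length) := fun k hk =>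
    Nat.pow_lt_pow_right one_lt_two hk
  let ρ : ℕ → ℕ := fun v => reduceBy E₀ (reduceBy E₂ v)
  have hρ : ∀ v w, ρ (v ^^^ w) = ρ v ^^^ ρ w := fun v w => by
    simp only [ρ, reduceBy_xor]
  have hρ0 : ρ 0 = 0 := by simp only [ρ, reduceBy_zero]
  -- the vectors over `A(2)` whose masks, put above the masks of the source, reduce to zero
  let Good : (Fin g → SteenrodAlgebra) → Prop := fun y =>
    ∃ m < 2 ^ (64 * g), maskVec g m = y ∧ ρ (m <<< (64 * φ.length)) = 0
  have hgood0 : Good 0 := ⟨0, Nat.two_pow_pos _, maskVec_zero g, by rw [Nat.zero_shiftLeft, hρ0]⟩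
  have hgoodadd : ∀ y z, Good y → Good z → Good (y + z) := by
    rintro _ _ ⟨m, hm, rfl, hm'⟩ ⟨n, hn, rfl, hn'⟩
    exact ⟨m ^^^ n, Nat.xor_lt_two_pow hm hn, maskVec_xor g m n, by
      rw [Nat.shiftLeft_xor_distrib, hρ, hm', hn', Nat.xor_self]⟩
  have hgoodsum : ∀ {ι : Type} (t : Finset ι) (f : ι → Fin g → SteenrodAlgebra),
      (∀ k ∈ t, Good (f k)) → Good (∑ k ∈ t, f k) := fun t f ht =>
    Finset.sum_induction f Good hgoodadd hgood0 ht
  have hgoodR : ∀ r ∈ R, ∀ b ∈ subalgebraA2, Good (b • rowVec g r) := by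
    intro r hr b hb
    obtain ⟨v, -, rfl⟩ := exists_maskVal_of_mem hb
    rw [maskVal, Finset.sum_smul]
    refine hgoodsum _ _ fun i hi => ?_
    split_ifs
    · obtain ⟨h1, h2⟩ := maskVec_rowMask (hR r hr)
      refine ⟨_, actWord_lt h1 (normalWords.getD i []), ?_, hrel _ (List.mem_flatMap.2
        ⟨r, hr, List.mem_map.2 ⟨i, List.mem_range.2 (Finset.mem_range.1 hi), rfl⟩⟩)⟩
      rw [maskVec_actWord (letters_of_getD_normalWords i) h1, h2]
    · rwa [zero_smul]
  obtain ⟨m, hm, hm', hmρ⟩ : Good (rowMap g φ x) := by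
    rw [hxc]
    exact hgoodsum _ _ fun k _ => hgoodR _ (List.getElem_mem _) _ (hc k)
  obtain ⟨v, hv, rfl⟩ := exists_maskVec_of_mem hx
  have hgr : ∀ v : ℕ, v < 2 ^ (64 * φ.length) → ∃ n < 2 ^ (64 * g),
      maskVec g n = rowMap g φ (maskVec φ.length v) ∧
        ρ (n <<< (64 * φ.length) ^^^ v) = 0 := by
    intro v
    induction v using mask_induction with
    | h0 => exact fun _ => ⟨0, Nat.two_pow_pos _, by rw [maskVec_zero, maskVec_zero, map_zero], by
        rw [Nat.zero_shiftLeft, Nat.xor_self, hρ0]⟩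
    | h v hv0 ih =>
      intro hv
      obtain ⟨n, hn, hn', hnρ⟩ := ih
        ((xor_two_pow_log2_lt hv0).trans_le ((Nat.log2_self_le hv0).trans hv.le))
      generalize hk : v.log2 = k at *
      have hk' : k < 64 * φ.length := by rw [← hk]; exact (Nat.log2_lt hv0).2 hv
      have hkφ : k / 64 < φ.length := by omega
      have hmem := List.getElem_mem hkφ
      obtain ⟨h1, h2⟩ := maskVec_rowMask (hφ _ hmem)
      refine ⟨actWord g (normalWords.getD (k % 64) []) (rowMask g φ[k / 64]) ^^^ n,
        Nat.xor_lt_two_pow (actWord_lt h1 _) hn, ?_, ?_⟩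
      · have hv' : v = 2 ^ k ^^^ (v ^^^ 2 ^ k) := by
          rw [Nat.xor_comm, Nat.xor_assoc, Nat.xor_self, Nat.xor_zero]
        conv_rhs => rw [hv', maskVec_xor, map_add, ← hn']
        rw [maskVec_xor, maskVec_actWord (letters_of_getD_normalWords _) h1, h2]
        congr 1
        have hs : maskVec φ.length (2 ^ k) = Pi.single (⟨k / 64, hkφ⟩ : Fin φ.length)
            (wordVal (normalWords.getD (k % 64) [])) := by
          rw [maskVec_two_pow]
          funext i
          rw [Pi.single_apply]
          exact if_congr (by rw [Fin.ext_iff]) rfl rfl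
        rw [hs, rowMap_single]
        rfl
      · have hgk := hgraph _ (List.mem_map.2 ⟨k, List.mem_range.2 hk', rfl⟩)
        change ρ _ = 0 at hgk
        rw [graphMask, List.getD_eq_getElem _ _ hkφ] at hgk
        rw [Nat.shiftLeft_xor_distrib]
        have e : ∀ a b c d : ℕ, a ^^^ b ^^^ c = (a ^^^ d) ^^^ (b ^^^ (c ^^^ d)) := by
          intro a b c d
          simp [Nat.xor_comm, Nat.xor_left_comm]
        rw [e _ _ _ (2 ^ k), hρ, hgk, hnρ, Nat.xor_self]
  obtain ⟨n, hn, hn', hnρ⟩ := hgr v hv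
  obtain rfl : m = n := by
    have h0 := eq_zero_of_maskVec_eq_zero (Nat.xor_lt_two_pow hm hn) (by
      rw [maskVec_xor, hm', hn', ← two_smul (ZMod 2), show (2 : ZMod 2) = 0 from rfl, zero_smul])
    exact Nat.xor_eq_zero_iff.1 h0
  rw [hρ, hmρ, Nat.zero_xor] at hnρ
  have hvρ : reduceBy E₀ v = 0 := by
    rwa [← reduceBy_of_lt hE₂ hv]
  rw [← maskVec_reduceBy_mem_iff _ hE₀, hvρ, maskVec_zero]
  exact zero_mem _

theorem rowMap_mem_of_checkExact (h : checkExact g φ R S = true)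
    {x : Fin φ.length → SteenrodAlgebra} (hx : x ∈ rowSpan φ.length S) :
    rowMap g φ x ∈ rowSpan g R := by
  simp only [checkExact, Bool.and_eq_true, List.all_eq_true, beq_iff_eq, decide_eq_true_eq] at h
  obtain ⟨⟨⟨⟨⟨⟨hφ, hR⟩, hS⟩, himg⟩, -⟩, -⟩, -⟩ := h
  suffices rowSpan φ.length S ≤ (rowSpan g R).comap (rowMap g φ) from this hx
  refine rowSpan_le fun s hs => ?_
  rw [Submodule.mem_comap, ← maskVec_imageMask hφ (hS s hs),
    ← maskVec_reduceBy_mem_iff _ (maskVec_foldl_extend_mem _ (b := 0) (E := []) (by simp)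
      (maskVec_mem_of_mem_orbits hR)), himg s hs, maskVec_zero]
  exact zero_mem _

/-- The map with rows `φ` identifies the quotient of the free module by the span of `S` with the
submodule generated by the rows in the quotient by the span of `R`: the statement over `A(2)`
extends to `A`, which is free over `A(2)`. -/
theorem comap_rowSpan_of_checkExact (h : checkExact g φ R S = true) :
    (rowSpan g R).comap (rowMap g φ) = rowSpan φ.length S := by
  refine le_antisymm (fun y hy => ?_) fun y hy => rowMap_mem_of_checkExact h hy
  obtain ⟨c, hc⟩ := (Submodule.mem_span_range_iff_exists_fun _).1 hy
  obtain ⟨ι, e, he, hspan⟩ := exists_basis_over_subalgebraA2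
  choose f hf hf' using hspan
  have h' := h
  simp only [checkExact, Bool.and_eq_true, List.all_eq_true, beq_iff_eq, decide_eq_true_eq] at h'
  obtain ⟨⟨⟨⟨⟨⟨hφ, hR⟩, -⟩, -⟩, -⟩, -⟩, -⟩ := h'
  have hcoord : ∀ j, rowMap g φ (fun k => f (y k) j) = ∑ k, f (c k) j • rowVec g R[k] := by
    intro j
    funext i
    let F : ι →₀ SteenrodAlgebra :=
      (∑ k, (f (y k)).mapRange (· * rowVec g φ[k] i) (zero_mul _)) -
        ∑ k, (f (c k)).mapRange (· * rowVec g R[k] i) (zero_mul _)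
    have hF : ∀ j, F j = (∑ k, f (y k) j * rowVec g φ[k] i) -
        ∑ k, f (c k) j * rowVec g R[k] i := fun j => by
      simp only [F, Finsupp.sub_apply, Finsupp.finsetSum_apply, Finsupp.mapRange_apply]
    have hF0 : F = 0 := by
      refine he F (fun j => ?_) ?_
      · rw [hF]
        refine sub_mem (sum_mem fun k _ => mul_mem (hf _ _) ?_)
          (sum_mem fun k _ => mul_mem (hf _ _) ?_)
        · exact rowVec_apply_mem (hφ _ (List.getElem_mem _)) i
        · exact rowVec_apply_mem (hR _ (List.getElem_mem _)) i
      · have hlin : ∀ G : ι →₀ SteenrodAlgebra, (G.sum fun j b => e j * b) =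
            Finsupp.liftAddHom (fun j => AddMonoidHom.mulLeft (e j)) G := fun G => rfl
        have hmr : ∀ (G : ι →₀ SteenrodAlgebra) (a : SteenrodAlgebra),
            Finsupp.liftAddHom (fun j => AddMonoidHom.mulLeft (e j))
              (G.mapRange (· * a) (zero_mul _)) =
            (Finsupp.liftAddHom (fun j => AddMonoidHom.mulLeft (e j)) G) * a := by
          intro G a
          rw [← hlin, ← hlin, Finsupp.sum_mapRange_index (fun j => mul_zero _), Finsupp.sum_mul]
          simp only [mul_assoc]
        have hy' : ∀ x, Finsupp.liftAddHom (fun j => AddMonoidHom.mulLeft (e j)) (f x) = x :=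
          fun x => by rw [← hlin, ← hf']
        rw [hlin, map_sub, map_sum, map_sum]
        simp only [hmr, hy']
        have := congrFun hc i
        rw [rowMap, Fintype.linearCombination_apply] at this
        simp only [Finset.sum_apply, Pi.smul_apply, smul_eq_mul] at this
        rw [← this, sub_self]
    have := hF j
    rw [hF0, Finsupp.zero_apply, eq_comm, sub_eq_zero] at this
    rw [rowMap, Fintype.linearCombination_apply]
    simpa only [Finset.sum_apply, Pi.smul_apply, smul_eq_mul] using this
  have hmem : ∀ j, (fun k => f (y k) j) ∈ rowSpan φ.length S := fun j =>
    mem_rowSpan_of_checkExact h (fun k => hf _ _) (fun k => hf _ _) (hcoord j)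
  classical
  let s : Finset ι := Finset.univ.biUnion fun k => (f (y k)).support
  have hy : y = ∑ j ∈ s, e j • fun k => f (y k) j := by
    funext k
    rw [Finset.sum_apply]
    conv_lhs => rw [hf' (y k)]
    refine Finset.sum_subset (Finset.subset_biUnion_of_mem (fun k => (f (y k)).support)
      (Finset.mem_univ k)) fun j _ hj => ?_
    simp only [Finsupp.notMem_support_iff.1 hj, mul_zero]
  rw [hy]
  exact Submodule.sum_mem _ fun j _ => Submodule.smul_mem _ _ (hmem j)

end Soundness

end SteenrodAlgebra

/-! ### Short exact sequences of graded modules -/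

namespace GradedModuleCat

section

variable {k A : Type} [CommRing k] [Ring A] [Algebra k A] {𝒜 : ℤ → Submodule k A}
  [SetLike.GradedMonoid 𝒜]

theorem mono_of_injective {X Y : GradedModuleCat 𝒜} (f : X ⟶ Y)
    (hf : ∀ n, Function.Injective (f.hom.app n)) : Mono f := by
  have : ∀ n, Mono (f.hom.app n) := fun n => (AddCommGrpCat.mono_iff_injective _).2 (hf n)
  have : Mono f.hom := NatTrans.mono_of_mono_app _
  exact (ObjectProperty.ι _).mono_of_mono_map this

theorem epi_of_surjective {X Y : GradedModuleCat 𝒜} (f : X ⟶ Y)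
    (hf : ∀ n, Function.Surjective (f.hom.app n)) : Epi f := by
  have : ∀ n, Epi (f.hom.app n) := fun n => (AddCommGrpCat.epi_iff_surjective _).2 (hf n)
  have : Epi f.hom := NatTrans.epi_of_epi_app _
  exact (ObjectProperty.ι _).epi_of_epi_map this

theorem surjective_of_epi {X Y : GradedModuleCat 𝒜} (f : X ⟶ Y) [Epi f] (n : GradedIndex 𝒜) :
    Function.Surjective (f.hom.app n) := by
  have := ObjectProperty.preservesEpimorphisms_ι_of_isNormalMonoCategory
    (additiveFunctor (GradedIndex 𝒜) AddCommGrpCat.{0})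
  have h : Epi f.hom := this.preserves f
  rw [NatTrans.epi_iff_epi_app] at h
  exact (AddCommGrpCat.epi_iff_surjective _).1 (h n)

/-- Short exactness in the category of graded modules is tested degree by degree. -/
theorem shortExact_of_app (S : ShortComplex (GradedModuleCat 𝒜))
    (hf : ∀ n, Function.Injective (S.f.hom.app n))
    (hg : ∀ n, Function.Surjective (S.g.hom.app n))
    (hfg : ∀ n (y : S.X₂.obj.obj n), S.g.hom.app n y = 0 → ∃ x, S.f.hom.app n x = y) :
    S.ShortExact := by
  have hm := mono_of_injective S.f hf
  have he := epi_of_surjective S.g hg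
  have key : ∀ {W : GradedModuleCat 𝒜} (q : W ⟶ S.X₂), q ≫ S.g = 0 →
      ∀ n (w : W.obj.obj n), ∃ x, S.f.hom.app n x = q.hom.app n w := by
    intro W q hq n w
    refine hfg n _ ?_
    have := congr_arg (fun r : W ⟶ S.X₃ => r.hom.app n w) hq
    exact this
  refine ShortComplex.ShortExact.mk (ShortComplex.exact_of_f_is_kernel _ ?_)
  refine KernelFork.IsLimit.ofι' _ _ fun {W} q hq => ?_
  choose u hu using key q hq
  refine ⟨ObjectProperty.homMk
    { app := fun n => AddCommGrpCat.ofHom (AddMonoidHom.mk' (u n) fun a b => hf n ?_)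
      naturality := fun m n a => ?_ }, ?_⟩
  · rw [map_add, hu, hu, hu, map_add]
  · ext w
    refine hf n ?_
    change S.f.hom.app n (u n (W.obj.map a w)) = S.f.hom.app n (S.X₁.obj.map a (u m w))
    have h1 := ConcreteCategory.congr_hom (S.f.hom.naturality a) (u m w)
    have h2 := ConcreteCategory.congr_hom (q.hom.naturality a) w
    rw [hu]
    refine Eq.trans h2 (Eq.trans ?_ h1.symm)
    change S.X₂.obj.map a (q.hom.app m w) = S.X₂.obj.map a (S.f.hom.app m (u m w))
    rw [hu]
  · ext n w
    exact hu n w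

variable {M N P : Type} [AddCommGroup M] [Module k M] [Module A M]
  [AddCommGroup N] [Module k N] [Module A N] [AddCommGroup P] [Module k P] [Module A P]
  (ℳ : ℤ → Submodule k M) [SetLike.GradedSMul 𝒜 ℳ]
  (𝒩 : ℤ → Submodule k N) [SetLike.GradedSMul 𝒜 𝒩]
  (𝒬 : ℤ → Submodule k P) [SetLike.GradedSMul 𝒜 𝒬]

/-- The morphism of graded modules given by an `A`-linear map that preserves degrees. -/
def homOf (f : M →ₗ[A] N) (hf : ∀ n, ∀ x ∈ ℳ n, f x ∈ 𝒩 n) :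
    GradedModuleCat.of 𝒜 ℳ ⟶ GradedModuleCat.of 𝒜 𝒩 :=
  ObjectProperty.homMk
    { app := fun n => AddCommGrpCat.ofHom
        (AddMonoidHom.mk' (fun x : ℳ n.deg => (⟨f x.1, hf _ _ x.2⟩ : 𝒩 n.deg))
          fun a b => Subtype.ext (map_add f a.1 b.1))
      naturality := fun m n a => by
        ext x
        exact Subtype.ext (map_smul f a.1 x.1) }

theorem homOf_comp_eq_zero (f : M →ₗ[A] N) (hf : ∀ n, ∀ x ∈ ℳ n, f x ∈ 𝒩 n) (g : N →ₗ[A] P)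
    (hg : ∀ n, ∀ x ∈ 𝒩 n, g x ∈ 𝒬 n) (h : ∀ x, g (f x) = 0) :
    (homOf ℳ 𝒩 f hf : of 𝒜 ℳ ⟶ of 𝒜 _) ≫ homOf 𝒩 𝒬 g hg = 0 := by
  ext n x
  exact Subtype.ext (h x.1)

theorem homOf_comp_eq_id (f : M →ₗ[A] N) (hf : ∀ n, ∀ x ∈ ℳ n, f x ∈ 𝒩 n) (g : N →ₗ[A] M)
    (hg : ∀ n, ∀ x ∈ 𝒩 n, g x ∈ ℳ n) (h : ∀ x, g (f x) = x) :
    (homOf ℳ 𝒩 f hf : of 𝒜 ℳ ⟶ of 𝒜 _) ≫ homOf 𝒩 ℳ g hg = 𝟙 _ := by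
  ext n x
  exact Subtype.ext (h x.1)

theorem homOf_comp_add_eq_id (f : M →ₗ[A] N) (hf : ∀ n, ∀ x ∈ ℳ n, f x ∈ 𝒩 n) (g : N →ₗ[A] M)
    (hg : ∀ n, ∀ x ∈ 𝒩 n, g x ∈ ℳ n) (f' : M →ₗ[A] P) (hf' : ∀ n, ∀ x ∈ ℳ n, f' x ∈ 𝒬 n)
    (g' : P →ₗ[A] M) (hg' : ∀ n, ∀ x ∈ 𝒬 n, g' x ∈ ℳ n) (h : ∀ x, g (f x) + g' (f' x) = x) :
    (homOf ℳ 𝒩 f hf : of 𝒜 ℳ ⟶ of 𝒜 _) ≫ homOf 𝒩 ℳ g hg +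
      (homOf ℳ 𝒬 f' hf' : of 𝒜 ℳ ⟶ of 𝒜 _) ≫ homOf 𝒬 ℳ g' hg' = 𝟙 _ := by
  ext n x
  exact Subtype.ext (h x.1)

theorem shortExact_homOf (f : M →ₗ[A] N) (hf : ∀ n, ∀ x ∈ ℳ n, f x ∈ 𝒩 n) (g : N →ₗ[A] P)
    (hg : ∀ n, ∀ x ∈ 𝒩 n, g x ∈ 𝒬 n) (h : ∀ x, g (f x) = 0) (hinj : Function.Injective f)
    (hsurj : ∀ n, ∀ z ∈ 𝒬 n, ∃ y ∈ 𝒩 n, g y = z)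
    (hex : ∀ n, ∀ y ∈ 𝒩 n, g y = 0 → ∃ x ∈ ℳ n, f x = y) :
    (ShortComplex.mk (homOf ℳ 𝒩 f hf : of 𝒜 ℳ ⟶ of 𝒜 _) (homOf 𝒩 𝒬 g hg)
      (homOf_comp_eq_zero ℳ 𝒩 𝒬 f hf g hg h)).ShortExact := by
  refine shortExact_of_app _ (fun n x y hxy => ?_) (fun n z => ?_) fun n y hy => ?_
  · exact Subtype.ext (hinj (congr_arg Subtype.val hxy))
  · obtain ⟨y, hy, h⟩ := hsurj n.deg z.1 z.2
    exact ⟨⟨y, hy⟩, Subtype.ext h⟩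
  · obtain ⟨x, hx, h⟩ := hex n.deg y.1 y.2 (congr_arg Subtype.val hy)
    exact ⟨⟨x, hx⟩, Subtype.ext h⟩

end

end GradedModuleCat

/-! ### Bases of Ext groups -/

/-- An extension of vector spaces over `ℤ/2` with bases `I` and `J` has the basis `I ⊕ J`. -/
theorem nonempty_addEquiv_of_exact {V E W I J : Type*} [AddCommGroup V] [AddCommGroup E]
    [AddCommGroup W] (hE : ∀ x : E, 2 • x = 0) (f : V →+ E) (g : E →+ W)
    (hf : Function.Injective f) (hg : Function.Surjective g)
    (hfg : ∀ y, g y = 0 ↔ ∃ x, f x = y) (v : V ≃+ (J →₀ ZMod 2)) (w : W ≃+ (I →₀ ZMod 2)) :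
    Nonempty (E ≃+ (I ⊕ J →₀ ZMod 2)) := by
  have hV : ∀ x : V, 2 • x = 0 := fun x => hf (by rw [map_nsmul, hE, map_zero])
  have hW : ∀ x : W, 2 • x = 0 := fun x => by
    obtain ⟨y, rfl⟩ := hg x
    rw [← map_nsmul, hE, map_zero]
  let := AddCommGroup.zmodModule (n := 2) hV
  let := AddCommGroup.zmodModule (n := 2) hE
  let := AddCommGroup.zmodModule (n := 2) hW
  obtain ⟨l, hl⟩ := (g.toZModLinearMap 2).exists_rightInverse_of_surjective
    (LinearMap.range_eq_top.2 hg)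
  have hl' : ∀ x, g (l x) = x := fun x => LinearMap.congr_fun hl x
  let e : V × W →+ E := AddMonoidHom.coprod f l.toAddMonoidHom
  have he : Function.Bijective e := by
    refine ⟨(injective_iff_map_eq_zero _).2 ?_, fun y => ?_⟩
    · rintro ⟨a, b⟩ h
      have h' : f a + l b = 0 := h
      have hb : b = 0 := by
        have := congr_arg g h'
        rwa [map_add, (hfg _).2 ⟨a, rfl⟩, zero_add, hl', map_zero] at this
      subst hb
      rw [map_zero, add_zero] at h'
      rw [hf (h'.trans (map_zero f).symm)]
      rfl
    · obtain ⟨x, hx⟩ := (hfg (y - l (g y))).1 (by rw [map_sub, hl', sub_self])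
      refine ⟨(x, g y), ?_⟩
      change f x + l (g y) = y
      rw [hx, sub_add_cancel]
  exact ⟨(AddEquiv.ofBijective e he).symm.trans
    ((v.prodCongr w).trans (AddEquiv.prodComm.trans Finsupp.sumFinsuppAddEquivProdFinsupp.symm))⟩

section ExtBasis

universe w v u

variable {C : Type u} [Category.{v} C] [Abelian C] [HasExt.{w} C] (Y : ℤ → C)

/-- The groups `Ext^s(X, Y t)`, for `s < N` and all `t`, are `ℤ/2`-vector spaces on the elements
of degree `(s, t)` of the graded set `ι`. -/
def HasExtBasis (X : C) (N : ℕ) {ι : Type} (d : ι → ℕ × ℤ) : Prop :=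
  ∀ s < N, ∀ t, Nonempty (Ext.{w} X (Y t) s ≃+ ({i // d i = (s, t)} →₀ ZMod 2))

/-- The degrees in `Ext` of the classes of `Mo` in a short exact sequence `0 → K → C → Mo → 0`
that restricts to zero in `Ext`, from those of `C` and `K`. -/
def extDeg {ι κ : Type} (d : ι → ℕ × ℤ) (d' : κ → ℕ × ℤ) : ι ⊕ κ → ℕ × ℤ :=
  Sum.elim d fun k => ((d' k).1 + 1, (d' k).2)

variable {Y}

theorem HasExtBasis.mono {X : C} {N N' : ℕ} {ι : Type} {d : ι → ℕ × ℤ}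
    (h : HasExtBasis Y X N d) (hN : N' ≤ N) : HasExtBasis Y X N' d :=
  fun s hs t => h s (hs.trans_le hN) t

theorem HasExtBasis.reindex {X : C} {N : ℕ} {ι κ : Type} {d : ι → ℕ × ℤ} {d' : κ → ℕ × ℤ}
    (h : HasExtBasis Y X N d) (e : ι ≃ κ) (he : ∀ i, d' (e i) = d i) : HasExtBasis Y X N d' := by
  intro s hs t
  obtain ⟨f⟩ := h s hs t
  refine ⟨f.trans (Finsupp.domCongr (e.subtypeEquiv fun i => ?_))⟩
  rw [he]

theorem HasExtBasis.of_iso {X X' : C} {N : ℕ} {ι : Type} {d : ι → ℕ × ℤ}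
    (h : HasExtBasis Y X N d) (i : X ≅ X') : HasExtBasis Y X' N d := by
  intro s hs t
  obtain ⟨f⟩ := h s hs t
  refine ⟨AddEquiv.trans (AddEquiv.mk' ⟨fun x => (Ext.mk₀ i.hom).comp x (zero_add s),
    fun x => (Ext.mk₀ i.inv).comp x (zero_add s), fun x => ?_, fun x => ?_⟩ fun x y => ?_) f⟩
  · dsimp only
    rw [Ext.mk₀_comp_mk₀_assoc, i.inv_hom_id, Ext.mk₀_id_comp]
  · dsimp only
    rw [Ext.mk₀_comp_mk₀_assoc, i.hom_inv_id, Ext.mk₀_id_comp]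
  · exact Ext.comp_add _ _ _ (zero_add s)

theorem HasExtBasis.eq_zero {X : C} {N : ℕ} {ι : Type} {d : ι → ℕ × ℤ}
    (h : HasExtBasis Y X N d) {s : ℕ} (hs : s < N) {t : ℤ} (hd : ∀ i, d i ≠ (s, t))
    (x : Ext.{w} X (Y t) s) : x = 0 := by
  obtain ⟨f⟩ := h s hs t
  have : IsEmpty {i // d i = (s, t)} := ⟨fun i => hd i.1 i.2⟩
  exact f.injective (Subsingleton.elim _ _)

variable (Y) in
/-- Restriction along the first map of a short complex vanishes on `Ext^s(-, Y t)`. -/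
def RestrictsToZero (S : ShortComplex C) (s : ℕ) (t : ℤ) : Prop :=
  ∀ x : Ext.{w} S.X₂ (Y t) s, (Ext.mk₀ S.f).comp x (zero_add s) = 0

theorem Ext.two_nsmul_eq_zero (hY : ∀ t, 𝟙 (Y t) + 𝟙 (Y t) = 0) {X : C} {s : ℕ} {t : ℤ}
    (x : Ext.{w} X (Y t) s) : 2 • x = 0 := by
  rw [two_nsmul]
  conv_lhs => rw [← Ext.comp_mk₀_id x]
  rw [← Ext.comp_add, ← Ext.mk₀_add, hY, Ext.mk₀_zero, Ext.comp_zero]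

theorem Ext.eq_zero_of_comp_eq_zero {X X' Z : C} (g : X ⟶ X') [Epi g] (x : Ext.{w} X' Z 0)
    (hx : (Ext.mk₀ g).comp x (zero_add 0) = 0) : x = 0 :=
  (injective_iff_map_eq_zero ((Ext.mk₀ g).precomp Z (zero_add 0))).1
    (Ext.precomp_mk₀_injective_of_epi Z g) x hx

section step

variable {S : ShortComplex C} (hS : S.ShortExact)

include hS

/-- If restriction vanishes, the long exact sequence breaks up into the sequences
`0 → Ext^{s-1}(K) → Ext^s(Mo) → Ext^s(C) → 0`. -/
theorem hasExtBasis_of_restrictsToZero (hY : ∀ t, 𝟙 (Y t) + 𝟙 (Y t) = 0) {N : ℕ} {ι κ : Type}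
    {d : ι → ℕ × ℤ} {d' : κ → ℕ × ℤ} (h₂ : HasExtBasis Y S.X₂ N d)
    (h₁ : HasExtBasis Y S.X₁ (N - 1) d') (h0 : ∀ s < N, ∀ t, RestrictsToZero.{w} Y S s t) :
    HasExtBasis Y S.X₃ N (extDeg d d') := by
  intro s hs t
  obtain ⟨f₂⟩ := h₂ s hs t
  let e : {i // extDeg d d' i = (s, t)} ≃
    {i // d i = (s, t)} ⊕ {k // ((d' k).1 + 1, (d' k).2) = (s, t)} := Equiv.subtypeSum
  let g : Ext S.X₃ (Y t) s →+ Ext S.X₂ (Y t) s := AddMonoidHom.mk'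
    (fun x => (Ext.mk₀ S.g).comp x (zero_add s)) fun x y => Ext.comp_add _ _ _ _
  have hg : Function.Surjective g := fun x => Ext.contravariant_sequence_exact₂ hS _ x (h0 s hs t x)
  cases s with
  | zero =>
    have : IsEmpty {k // ((d' k).1 + 1, (d' k).2) = (0, t)} :=
      ⟨fun k => absurd (congr_arg Prod.fst k.2) (Nat.succ_ne_zero _)⟩
    have := hS.epi_g
    have hi : Function.Injective g := Ext.precomp_mk₀_injective_of_epi (Y t) S.g
    exact ⟨(AddEquiv.ofBijective g ⟨hi, hg⟩).trans
      (f₂.trans (Finsupp.domCongr ((Equiv.sumEmpty _ _).symm.trans e.symm)))⟩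
  | succ s =>
    obtain ⟨f₁⟩ := h₁ s (by omega) t
    let f : Ext S.X₁ (Y t) s →+ Ext S.X₃ (Y t) (s + 1) := AddMonoidHom.mk'
      (fun x => hS.extClass.comp x (add_comm 1 s)) fun x y => Ext.comp_add _ _ _ _
    have hf : Function.Injective f := by
      refine (injective_iff_map_eq_zero _).2 fun x hx => ?_
      obtain ⟨y, rfl⟩ := Ext.contravariant_sequence_exact₁ hS _ x (add_comm 1 s) hx
      exact h0 s (by omega) t y
    let e' : {k // d' k = (s, t)} ≃ {k // ((d' k).1 + 1, (d' k).2) = (s + 1, t)} :=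
      Equiv.subtypeEquivRight fun k => by simp [Prod.ext_iff]
    obtain ⟨r⟩ := nonempty_addEquiv_of_exact (Ext.two_nsmul_eq_zero hY) f g hf hg
      (fun y => ⟨fun hy => Ext.contravariant_sequence_exact₃ hS _ y hy (add_comm 1 s), by
        rintro ⟨x, rfl⟩
        exact hS.comp_extClass_assoc x (add_comm 1 s)⟩)
      (f₁.trans (Finsupp.domCongr e')) f₂
    exact ⟨r.trans (Finsupp.domCongr e.symm)⟩

/-- A split short exact sequence gives a direct sum of `Ext` groups. -/
theorem hasExtBasis_of_retraction (hY : ∀ t, 𝟙 (Y t) + 𝟙 (Y t) = 0) (r : S.X₂ ⟶ S.X₁)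
    (hr : S.f ≫ r = 𝟙 _) {N : ℕ} {ι κ : Type} {d : ι → ℕ × ℤ} {d' : κ → ℕ × ℤ}
    (h₁ : HasExtBasis Y S.X₁ N d) (h₃ : HasExtBasis Y S.X₃ N d') :
    HasExtBasis Y S.X₂ N (Sum.elim d d') := by
  intro s hs t
  obtain ⟨f₁⟩ := h₁ s hs t
  obtain ⟨f₃⟩ := h₃ s hs t
  have hsur : ∀ (s : ℕ) (x : Ext S.X₁ (Y t) s),
      (Ext.mk₀ S.f).comp ((Ext.mk₀ r).comp x (zero_add s)) (zero_add s) = x := fun s x => by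
    rw [Ext.mk₀_comp_mk₀_assoc, hr, Ext.mk₀_id_comp]
  let f : Ext S.X₃ (Y t) s →+ Ext S.X₂ (Y t) s := AddMonoidHom.mk'
    (fun x => (Ext.mk₀ S.g).comp x (zero_add s)) fun x y => Ext.comp_add _ _ _ _
  let g : Ext S.X₂ (Y t) s →+ Ext S.X₁ (Y t) s := AddMonoidHom.mk'
    (fun x => (Ext.mk₀ S.f).comp x (zero_add s)) fun x y => Ext.comp_add _ _ _ _
  have hf : Function.Injective f := by
    refine (injective_iff_map_eq_zero _).2 fun x hx => ?_
    cases s with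
    | zero =>
      have := hS.epi_g
      exact Ext.eq_zero_of_comp_eq_zero S.g x hx
    | succ s =>
      obtain ⟨y, rfl⟩ := Ext.contravariant_sequence_exact₃ hS _ x hx (add_comm 1 s)
      rw [← hsur s y, hS.extClass_comp_assoc]
  obtain ⟨e⟩ := nonempty_addEquiv_of_exact (Ext.two_nsmul_eq_zero hY) f g hf
    (fun x => ⟨_, hsur s x⟩) (fun y => ⟨Ext.contravariant_sequence_exact₂ hS _ y, by
      rintro ⟨x, rfl⟩
      change (Ext.mk₀ S.f).comp ((Ext.mk₀ S.g).comp x (zero_add s)) (zero_add s) = 0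
      rw [Ext.mk₀_comp_mk₀_assoc, S.zero, Ext.mk₀_zero, Ext.zero_comp]⟩) f₃ f₁
  let e' : {i // Sum.elim d d' i = (s, t)} ≃ {i // d i = (s, t)} ⊕ {k // d' k = (s, t)} :=
    Equiv.subtypeSum
  exact ⟨e.trans (Finsupp.domCongr e'.symm)⟩

end step

section linear

variable (h : ∀ t, Ext.{w} (Y t) (Y (t + 1)) 1)

/-- Multiplication by the classes `h` is injective on `Ext^s(X, Y t)`. -/
def MulInjective (X : C) (s : ℕ) (t : ℤ) : Prop :=
  ∀ x : Ext.{w} X (Y t) s, x.comp (h t) (rfl : s + 1 = s + 1) = 0 → x = 0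

variable {h}

theorem MulInjective.of_forall_eq_zero {X : C} {s : ℕ} {t : ℤ}
    (hX : ∀ x : Ext.{w} X (Y t) s, x = 0) : MulInjective h X s t :=
  fun x _ => hX x

theorem HasExtBasis.mulInjective {X : C} {N : ℕ} {ι : Type} {d : ι → ℕ × ℤ}
    (hX : HasExtBasis Y X N d) {s : ℕ} (hs : s < N) {t : ℤ} (hd : ∀ i, d i ≠ (s, t)) :
    MulInjective h X s t :=
  .of_forall_eq_zero (hX.eq_zero hs hd)

variable {S : ShortComplex C}

/-- Restriction is linear over multiplication by `h`: a class killed by `h` restricts to zero if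
multiplication by `h` is injective on the target. -/
theorem restrictsToZero_of_mulInjective {s : ℕ} {t : ℤ}
    (h₂ : ∀ x : Ext.{w} S.X₂ (Y (t + 1)) (s + 1), x = 0) (h₁ : MulInjective h S.X₁ s t) :
    RestrictsToZero.{w} Y S s t := by
  intro x
  refine h₁ _ ?_
  rw [Ext.comp_assoc (a₂₃ := s + 1) _ _ _ (by omega) (by omega) (by omega),
    h₂ (x.comp (h t) rfl), Ext.comp_zero]

variable (hS : S.ShortExact)

include hS

/-- Multiplication by `h` is injective on an extension of two groups on which it is injective. The
restriction in filtration `s` and internal degree `t + 1` has to vanish, in order that the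
connecting map is injective on the multiples of `h`. -/
theorem MulInjective.of_shortExact {s : ℕ} {t : ℤ} (h₂ : MulInjective h S.X₂ s t)
    (h₁ : ∀ s', s = s' + 1 → MulInjective h S.X₁ s' t)
    (h0 : 0 < s → RestrictsToZero.{w} Y S s (t + 1)) :
    MulInjective h S.X₃ s t := by
  intro x hx
  have hg : (Ext.mk₀ S.g).comp x (zero_add s) = 0 := by
    refine h₂ _ ?_
    rw [Ext.comp_assoc (a₂₃ := s + 1) _ _ _ (by omega) (by omega) (by omega), hx, Ext.comp_zero]
  cases s with
  | zero =>
    have := hS.epi_g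
    exact Ext.eq_zero_of_comp_eq_zero S.g x hg
  | succ s =>
    obtain ⟨y, rfl⟩ := Ext.contravariant_sequence_exact₃ hS _ x hg (add_comm 1 s)
    rw [Ext.comp_assoc (a₂₃ := s + 1) _ _ _ (by omega) (by omega) (by omega)] at hx
    obtain ⟨z, hz⟩ := Ext.contravariant_sequence_exact₁ hS _ _ (by omega) hx
    rw [h0 (Nat.succ_pos s) z] at hz
    rw [h₁ s rfl y hz.symm, Ext.comp_zero]

theorem MulInjective.of_retraction (r : S.X₂ ⟶ S.X₁) (hr : S.f ≫ r = 𝟙 _) {s : ℕ} {t : ℤ}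
    (h₁ : MulInjective h S.X₁ s t) (h₃ : MulInjective h S.X₃ s t) :
    MulInjective h S.X₂ s t := by
  intro x hx
  have hf : (Ext.mk₀ S.f).comp x (zero_add s) = 0 := by
    refine h₁ _ ?_
    rw [Ext.comp_assoc (a₂₃ := s + 1) _ _ _ (by omega) (by omega) (by omega), hx, Ext.comp_zero]
  obtain ⟨y, rfl⟩ := Ext.contravariant_sequence_exact₂ hS _ x hf
  rw [Ext.comp_assoc (a₂₃ := s + 1) _ _ _ (by omega) (by omega) (by omega)] at hx
  have hy : y.comp (h t) (rfl : s + 1 = s + 1) = 0 := by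
    obtain ⟨z, hz⟩ := Ext.contravariant_sequence_exact₃ hS _ _ hx (add_comm 1 s)
    have : (Ext.mk₀ S.f).comp ((Ext.mk₀ r).comp z (zero_add s)) (zero_add s) = z := by
      rw [Ext.mk₀_comp_mk₀_assoc, hr, Ext.mk₀_id_comp]
    rw [← hz, ← this, hS.extClass_comp_assoc]
  rw [h₃ y hy, Ext.comp_zero]

end linear

end ExtBasis

/-! ### Presented graded modules -/

namespace SteenrodAlgebra

/-- The projection of `A` to its part of degree `n`, for an integer `n`. -/
noncomputable def intProj (n : ℤ) : SteenrodAlgebra →ₗ[ZMod 2] SteenrodAlgebra :=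
  if 0 ≤ n then proj n.toNat else 0

theorem intProj_mem (n : ℤ) (x : SteenrodAlgebra) : intProj n x ∈ grading n := by
  rw [intProj]
  split_ifs with h
  · have := proj_mem n.toNat x
    rwa [Int.toNat_of_nonneg h] at this
  · exact zero_mem _

theorem intProj_of_mem {n : ℤ} {x : SteenrodAlgebra} (hx : x ∈ grading n) : intProj n x = x := by
  rw [intProj]
  split_ifs with h
  · rw [← Int.toNat_of_nonneg h] at hx
    rw [proj_of_mem hx, if_pos rfl]
  · rw [grading_of_neg (not_le.1 h)] at hx
    rw [(Submodule.mem_bot _).1 hx, map_zero]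

theorem intProj_mul {n m : ℤ} (x : SteenrodAlgebra) {y : SteenrodAlgebra} (hy : y ∈ grading m) :
    intProj n (x * y) = intProj (n - m) x * y := by
  rcases lt_or_ge m 0 with hm | hm
  · rw [grading_of_neg hm] at hy
    rw [(Submodule.mem_bot _).1 hy, mul_zero, mul_zero, map_zero]
  obtain ⟨m, rfl⟩ := Int.eq_ofNat_of_zero_le hm
  rcases lt_or_ge n 0 with hn | hn
  · rw [intProj, intProj, if_neg (by omega), if_neg (by omega), LinearMap.zero_apply,
      LinearMap.zero_apply, zero_mul]
  obtain ⟨n, rfl⟩ := Int.eq_ofNat_of_zero_le hn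
  rcases lt_or_ge n m with h | h
  · rw [intProj, intProj, if_pos (by omega), if_neg (by omega), LinearMap.zero_apply, zero_mul]
    exact proj_mul_of_lt x hy h
  · obtain ⟨k, rfl⟩ := Nat.exists_eq_add_of_le h
    rw [intProj, intProj, if_pos (by omega), if_pos (by omega),
      show ((m + k : ℕ) : ℤ) - m = (k : ℕ) by push_cast; ring]
    have := proj_mul x hy (Nat.le_add_right m k)
    rwa [Nat.add_sub_cancel_left] at this

section Free

variable {g h : ℕ} (D : Fin g → ℤ) (E : Fin h → ℤ)

/-- The homogeneous parts of the free module with basis elements of degrees `D`. -/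
def freeGrading (n : ℤ) : Submodule (ZMod 2) (Fin g → SteenrodAlgebra) :=
  Submodule.pi Set.univ fun i => grading (n - D i)

theorem mem_freeGrading {n : ℤ} {x : Fin g → SteenrodAlgebra} :
    x ∈ freeGrading D n ↔ ∀ i, x i ∈ grading (n - D i) := by
  simp [freeGrading]

/-- The projection of a graded free module to its part of degree `n`. -/
noncomputable def freeProj (n : ℤ) (x : Fin g → SteenrodAlgebra) : Fin g → SteenrodAlgebra :=
  fun i => intProj (n - D i) (x i)

theorem freeProj_mem (n : ℤ) (x : Fin g → SteenrodAlgebra) : freeProj D n x ∈ freeGrading D n :=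
  (mem_freeGrading D).2 fun _ => intProj_mem _ _

theorem freeProj_of_mem {n : ℤ} {x : Fin g → SteenrodAlgebra} (hx : x ∈ freeGrading D n) :
    freeProj D n x = x :=
  funext fun i => intProj_of_mem ((mem_freeGrading D).1 hx i)

theorem freeProj_add (n : ℤ) (x y : Fin g → SteenrodAlgebra) :
    freeProj D n (x + y) = freeProj D n x + freeProj D n y :=
  funext fun _ => map_add _ _ _

/-- A map of free modules that preserves degrees commutes with the projections. -/
theorem freeProj_linearCombination {v : Fin h → Fin g → SteenrodAlgebra}
    (hv : ∀ k, v k ∈ freeGrading D (E k)) (n : ℤ) (y : Fin h → SteenrodAlgebra) :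
    freeProj D n (Fintype.linearCombination SteenrodAlgebra v y) =
      Fintype.linearCombination SteenrodAlgebra v (freeProj E n y) := by
  funext i
  simp only [freeProj, Fintype.linearCombination_apply, Finset.sum_apply, Pi.smul_apply,
    smul_eq_mul, map_sum]
  refine Finset.sum_congr rfl fun k _ => ?_
  rw [intProj_mul _ ((mem_freeGrading D).1 (hv k) i), sub_sub_sub_cancel_right]

/-- A submodule of a graded free module is homogeneous if it contains the homogeneous parts of its
elements. -/
def IsHomogeneousSubmodule (Q : Submodule SteenrodAlgebra (Fin g → SteenrodAlgebra)) : Prop :=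
  ∀ x ∈ Q, ∀ n, freeProj D n x ∈ Q

theorem linearCombination_mem_freeGrading {v : Fin h → Fin g → SteenrodAlgebra}
    (hv : ∀ k, v k ∈ freeGrading D (E k)) {n : ℤ} {y : Fin h → SteenrodAlgebra}
    (hy : y ∈ freeGrading E n) :
    Fintype.linearCombination SteenrodAlgebra v y ∈ freeGrading D n := by
  rw [← freeProj_of_mem E hy, ← freeProj_linearCombination D E hv]
  exact freeProj_mem D _ _

theorem isHomogeneousSubmodule_span {v : Fin h → Fin g → SteenrodAlgebra}
    (hv : ∀ k, v k ∈ freeGrading D (E k)) :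
    IsHomogeneousSubmodule D (Submodule.span SteenrodAlgebra (Set.range v)) := by
  intro x hx n
  rw [← Fintype.range_linearCombination] at hx ⊢
  obtain ⟨y, rfl⟩ := hx
  exact ⟨_, (freeProj_linearCombination D E hv n y).symm⟩

/-- The homogeneous parts of a quotient of a graded free module. -/
def presGrading (Q : Submodule SteenrodAlgebra (Fin g → SteenrodAlgebra)) (n : ℤ) :
    Submodule (ZMod 2) ((Fin g → SteenrodAlgebra) ⧸ Q) :=
  (freeGrading D n).map (Q.mkQ.restrictScalars (ZMod 2))

instance (Q : Submodule SteenrodAlgebra (Fin g → SteenrodAlgebra)) :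
    SetLike.GradedSMul grading (presGrading D Q) where
  smul_mem := by
    rintro i j a _ ha ⟨x, hx, rfl⟩
    refine ⟨a • x, (mem_freeGrading D).2 fun k => ?_, rfl⟩
    have := SetLike.mul_mem_graded ha ((mem_freeGrading D).1 hx k)
    rwa [← add_sub_assoc] at this

/-- The graded module with generators of degrees `D` and relations `Q`. -/
noncomputable def presented (Q : Submodule SteenrodAlgebra (Fin g → SteenrodAlgebra)) :
    GradedModuleCat grading :=
  GradedModuleCat.of grading (presGrading D Q)

/-- A family of homogeneous elements of a presented module, with relations `P`, gives a short exact
sequence: the submodule generated by them is presented by the relations `P`, and the quotient by it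
is presented by adding them to the relations. -/
theorem exists_shortExact_presented {Q : Submodule SteenrodAlgebra (Fin g → SteenrodAlgebra)}
    (hQ : IsHomogeneousSubmodule D Q) {v : Fin h → Fin g → SteenrodAlgebra}
    (hv : ∀ k, v k ∈ freeGrading D (E k)) :
    ∃ (f : presented E (Q.comap (Fintype.linearCombination SteenrodAlgebra v)) ⟶ presented D Q)
      (p : presented D Q ⟶ presented D (Q ⊔ Submodule.span SteenrodAlgebra (Set.range v)))
      (w : f ≫ p = 0), (ShortComplex.mk f p w).ShortExact ∧
      ∀ n (x : (presented E _).obj.obj n) z, x.1 = Submodule.mkQ _ z →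
        (f.hom.app n x).1 = Q.mkQ (Fintype.linearCombination SteenrodAlgebra v z) := by
  rw [← Fintype.range_linearCombination]
  set Φ := Fintype.linearCombination SteenrodAlgebra v with hΦ
  refine ⟨_, _, _, GradedModuleCat.shortExact_homOf (presGrading E (Q.comap Φ)) (presGrading D Q)
    (presGrading D (Q ⊔ LinearMap.range Φ)) (Submodule.mapQ _ Q Φ le_rfl) ?_
    (Submodule.mapQ Q _ LinearMap.id le_sup_left) ?_ ?_ ?_ ?_ ?_,
    fun n x z h => congrArg (Submodule.mapQ _ Q Φ le_rfl) h⟩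
  · rintro n _ ⟨y, hy, rfl⟩
    exact ⟨_, linearCombination_mem_freeGrading D E hv hy, rfl⟩
  · rintro n _ ⟨y, hy, rfl⟩
    exact ⟨y, hy, rfl⟩
  · intro x
    obtain ⟨y, rfl⟩ := Submodule.mkQ_surjective _ x
    exact (Submodule.Quotient.mk_eq_zero _).2 (Submodule.mem_sup_right ⟨y, rfl⟩)
  · rw [← LinearMap.ker_eq_bot, Submodule.ker_mapQ, Submodule.mkQ_map_self]
  · rintro n _ ⟨y, hy, rfl⟩
    exact ⟨_, ⟨y, hy, rfl⟩, rfl⟩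
  · rintro n _ ⟨y, hy, rfl⟩ h0
    have h0 : y ∈ Q ⊔ LinearMap.range Φ := (Submodule.Quotient.mk_eq_zero _).1 h0
    obtain ⟨q, hq, _, ⟨z, rfl⟩, hqz⟩ := Submodule.mem_sup.1 h0
    refine ⟨_, ⟨freeProj E n z, freeProj_mem E n z, rfl⟩, ?_⟩
    change Submodule.Quotient.mk (Φ (freeProj E n z)) = Submodule.Quotient.mk y
    rw [← freeProj_linearCombination D E hv, eq_comm, Submodule.Quotient.eq,
      ← freeProj_of_mem D hy, ← hqz, freeProj_add, add_sub_cancel_right]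
    exact hQ q hq n

end Free

end SteenrodAlgebra

/-! ### Presentations by rows -/

namespace SteenrodAlgebra

/-- The `h` vectors given by the first rows of a list. -/
noncomputable def rowFamily (g h : ℕ) (ψ : List Row) (k : Fin h) : Fin g → SteenrodAlgebra :=
  rowVec g (ψ.getD k [])

/-- The degrees of the generators of the module `n`-fold suspended from one with generators in the
degrees `D`. -/
def shiftDeg (n : ℤ) (D : List ℕ) (i : Fin D.length) : ℤ := n + D.getD i 0

/-- The graded module with generators in the degrees `n + D i` and the relations `L`. -/
noncomputable def pres (n : ℤ) (D : List ℕ) (L : List Row) : GradedModuleCat grading :=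
  presented (shiftDeg n D) (rowSpan D.length L)

/-- All terms of the row have degree `d`, with generators in the degrees `D`. -/
def RowHasDeg (D : List ℕ) (d : ℕ) (r : Row) : Prop := ∀ e ∈ r, D.getD e.1 0 + e.2.sum = d

instance (D : List ℕ) (d : ℕ) (r : Row) : Decidable (RowHasDeg D d r) :=
  inferInstanceAs (Decidable (∀ e ∈ r, D.getD e.1 0 + e.2.sum = d))

theorem wordVal_mem_grading (w : List ℕ) : wordVal w ∈ grading w.sum :=
  Submodule.subset_span ⟨w, rfl, rfl⟩

theorem rowVec_mem_freeGrading (n : ℤ) {D : List ℕ} {d : ℕ} {r : Row} (h : RowHasDeg D d r) :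
    rowVec D.length r ∈ freeGrading (shiftDeg n D) (n + d) := by
  induction r with
  | nil => exact zero_mem _
  | cons e r ih =>
    refine add_mem ((mem_freeGrading _).2 fun i => ?_) (ih fun e he =>
      h e (List.mem_cons_of_mem _ he))
    change (if (i : ℕ) = e.1 then wordVal e.2 else 0) ∈ _
    split_ifs with hi
    · have := h e List.mem_cons_self
      rw [shiftDeg, hi, ← this, Nat.cast_add, add_sub_add_left_eq_sub, add_sub_cancel_left]
      exact wordVal_mem_grading _
    · exact zero_mem _

/-- The rows `ψ` have the degrees `E`, with generators in the degrees `D`. -/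
def RowsHaveDeg (D E : List ℕ) (ψ : List Row) : Prop :=
  ∀ k < E.length, RowHasDeg D (E.getD k 0) (ψ.getD k [])

instance (D E : List ℕ) (ψ : List Row) : Decidable (RowsHaveDeg D E ψ) :=
  inferInstanceAs (Decidable (∀ k < E.length, RowHasDeg D (E.getD k 0) (ψ.getD k [])))

theorem rowFamily_mem_freeGrading (n : ℤ) {D E : List ℕ} {ψ : List Row} (h : RowsHaveDeg D E ψ)
    (k : Fin E.length) :
    rowFamily D.length E.length ψ k ∈ freeGrading (shiftDeg n D) (shiftDeg n E k) :=
  rowVec_mem_freeGrading n (h k k.2)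

/-- A list of relations is homogeneous. -/
def RowsHomogeneous (D : List ℕ) (L : List Row) : Prop :=
  ∀ r ∈ L, RowHasDeg D (D.getD (r.headD (0, [])).1 0 + (r.headD (0, [])).2.sum) r

instance (D : List ℕ) (L : List Row) : Decidable (RowsHomogeneous D L) :=
  inferInstanceAs (Decidable (∀ r ∈ L, RowHasDeg D _ r))

theorem isHomogeneousSubmodule_rowSpan (n : ℤ) {D : List ℕ} {L : List Row}
    (h : RowsHomogeneous D L) :
    IsHomogeneousSubmodule (shiftDeg n D) (rowSpan D.length L) :=
  isHomogeneousSubmodule_span _ (fun _ : Fin L.length => _)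
    fun k => rowVec_mem_freeGrading n (h _ (List.getElem_mem k.2))

theorem rowFamily_eq {g h : ℕ} {φ : List Row} (hlen : φ.length = h) :
    Fintype.linearCombination SteenrodAlgebra (rowFamily g h φ) =
      hlen ▸ rowMap g φ := by
  subst hlen
  refine congrArg (Fintype.linearCombination SteenrodAlgebra) (funext fun k => ?_)
  exact congrArg _ (List.getD_eq_getElem _ _ k.2)

/-- The morphism sends the class of a vector to the class of its image under the map with the
rows `φ`. -/
def ActsBy {n : ℤ} {D E : List ℕ} {P Q : List Row} (f : pres n E P ⟶ pres n D Q)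
    (φ : List Row) : Prop :=
  ∀ m (x : (presented (shiftDeg n E) (rowSpan E.length P)).obj.obj m) z,
    x.1 = (rowSpan E.length P).mkQ z →
      Subtype.val (p := (· ∈ presGrading (shiftDeg n D) (rowSpan D.length Q) m.deg))
        (f.hom.app m x) = (rowSpan D.length Q).mkQ
          (Fintype.linearCombination SteenrodAlgebra (rowFamily D.length E.length φ) z)

theorem ActsBy.ext {n : ℤ} {D E : List ℕ} {P Q : List Row} {f f' : pres n E P ⟶ pres n D Q}
    {φ : List Row} (h : ActsBy f φ) (h' : ActsBy f' φ) : f = f' := by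
  ext m x
  obtain ⟨z, hz⟩ := Submodule.mkQ_surjective _ x.1
  exact Subtype.ext ((h m x z hz.symm).trans (h' m x z hz.symm).symm)

/-- The short exact sequence of a verified presentation. -/
theorem exists_shortExact_pres (n : ℤ) {D E : List ℕ} {φ R S : List Row}
    (hc : checkExact D.length φ R S = true) (hlen : φ.length = E.length)
    (hR : RowsHomogeneous D R) (hφ : RowsHaveDeg D E φ) :
    ∃ (f : pres n E S ⟶ pres n D R) (p : pres n D R ⟶ pres n D (R ++ φ)) (w : f ≫ p = 0),
      (ShortComplex.mk f p w).ShortExact ∧ ActsBy f φ := by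
  have h := exists_shortExact_presented (shiftDeg n D) (shiftDeg n E)
    (isHomogeneousSubmodule_rowSpan n hR) (rowFamily_mem_freeGrading n hφ)
  have h1 : (rowSpan D.length R).comap (Fintype.linearCombination SteenrodAlgebra
      (rowFamily D.length E.length φ)) = rowSpan E.length S := by
    generalize E.length = h at hlen
    subst hlen
    rw [rowFamily_eq rfl]
    exact comap_rowSpan_of_checkExact hc
  have h2 : Submodule.span SteenrodAlgebra (Set.range (rowFamily D.length E.length φ)) =
      rowSpan D.length φ := by
    generalize E.length = h at hlen
    subst hlen
    rw [← Fintype.range_linearCombination, rowFamily_eq rfl]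
    exact range_rowMap _ _
  rw [h1, h2, ← rowSpan_append] at h
  exact h

/-- The image of a row under the map with rows `ψ`. -/
def imageRow (ψ : List Row) (r : Row) : Row :=
  r.flatMap fun e => (ψ.getD e.1 []).map fun e' => (e'.1, e.2 ++ e'.2)

theorem rowVec_append (g : ℕ) (r r' : Row) : rowVec g (r ++ r') = rowVec g r + rowVec g r' := by
  simp [rowVec]

theorem rowVec_cons (g : ℕ) (e : ℕ × List ℕ) (r : Row) :
    rowVec g (e :: r) = (fun i : Fin g => if (i : ℕ) = e.1 then wordVal e.2 else 0) +
      rowVec g r := by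
  simp [rowVec]

theorem rowVec_map_append (g : ℕ) (w : List ℕ) (r : Row) :
    rowVec g (r.map fun e' => (e'.1, w ++ e'.2)) = wordVal w • rowVec g r := by
  induction r with
  | nil => exact (smul_zero _).symm
  | cons e r ih =>
    rw [List.map_cons, rowVec_cons, rowVec_cons, ih, smul_add]
    congr 1
    funext i
    rw [Pi.smul_apply, smul_eq_mul, wordVal_append]
    split_ifs
    · rfl
    · rw [mul_zero]

/-- Every term of the row lies in one of the first `h` coordinates. -/
def RowBelow (h : ℕ) (r : Row) : Prop := ∀ e ∈ r, e.1 < h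

instance (h : ℕ) (r : Row) : Decidable (RowBelow h r) :=
  inferInstanceAs (Decidable (∀ e ∈ r, e.1 < h))

theorem linearCombination_rowFamily {g h : ℕ} (ψ : List Row) {r : Row} (hr : RowBelow h r) :
    Fintype.linearCombination SteenrodAlgebra (rowFamily g h ψ) (rowVec h r) =
      rowVec g (imageRow ψ r) := by
  induction r with
  | nil => exact map_zero _
  | cons e r ih =>
    have he : e.1 < h := hr e List.mem_cons_self
    have hs : (fun i : Fin h => if (i : ℕ) = e.1 then wordVal e.2 else 0) =
        Pi.single (⟨e.1, he⟩ : Fin h) (wordVal e.2) := by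
      funext i
      rw [Pi.single_apply]
      exact if_congr (by rw [Fin.ext_iff]) rfl rfl
    have hi : imageRow ψ (e :: r) =
        (ψ.getD e.1 []).map (fun e' => (e'.1, e.2 ++ e'.2)) ++ imageRow ψ r := rfl
    rw [rowVec_cons, map_add, ih fun e he => hr e (List.mem_cons_of_mem _ he), hs,
      Fintype.linearCombination_apply_single, hi, rowVec_append, rowVec_map_append]
    rfl

/-- The rows `ψ` define a morphism from the module with generators `E` and relations `P` to the one
with generators `D` and relations `Q`, since each relation goes to zero or to a relation. -/
def IsPresHom (D : List ℕ) (Q : List Row) (E : List ℕ) (P ψ : List Row) : Prop :=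
  RowsHaveDeg D E ψ ∧ ∀ r ∈ P, RowBelow E.length r ∧ (imageRow ψ r = [] ∨ imageRow ψ r ∈ Q)

instance (D : List ℕ) (Q : List Row) (E : List ℕ) (P ψ : List Row) :
    Decidable (IsPresHom D Q E P ψ) := inferInstanceAs (Decidable (_ ∧ _))

theorem IsPresHom.le_comap {D E : List ℕ} {Q P ψ : List Row} (h : IsPresHom D Q E P ψ) :
    rowSpan E.length P ≤ (rowSpan D.length Q).comap
      (Fintype.linearCombination SteenrodAlgebra (rowFamily D.length E.length ψ)) := by
  refine rowSpan_le fun r hr => ?_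
  obtain ⟨hb, h0⟩ := h.2 r hr
  rw [Submodule.mem_comap, linearCombination_rowFamily ψ hb]
  rcases h0 with h0 | h0
  · rw [h0]
    exact zero_mem _
  · exact rowVec_mem_rowSpan h0

/-- The linear map of quotients of free modules given by rows. -/
noncomputable def presMap {D E : List ℕ} {Q P ψ : List Row} (h : IsPresHom D Q E P ψ) :
    ((Fin E.length → SteenrodAlgebra) ⧸ rowSpan E.length P) →ₗ[SteenrodAlgebra]
      ((Fin D.length → SteenrodAlgebra) ⧸ rowSpan D.length Q) :=
  Submodule.mapQ _ _ (Fintype.linearCombination SteenrodAlgebra (rowFamily D.length E.length ψ))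
    h.le_comap

theorem presMap_mem (n : ℤ) {D E : List ℕ} {Q P ψ : List Row} (h : IsPresHom D Q E P ψ) (m : ℤ) :
    ∀ x ∈ presGrading (shiftDeg n E) (rowSpan E.length P) m,
      presMap h x ∈ presGrading (shiftDeg n D) (rowSpan D.length Q) m := by
  rintro _ ⟨y, hy, rfl⟩
  exact ⟨_, linearCombination_mem_freeGrading _ _ (rowFamily_mem_freeGrading n h.1) hy, rfl⟩

/-- The morphism of presented modules given by rows. -/
noncomputable def presHom (n : ℤ) {D E : List ℕ} {Q P ψ : List Row} (h : IsPresHom D Q E P ψ) :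
    pres n E P ⟶ pres n D Q :=
  GradedModuleCat.homOf _ _ (presMap h) (presMap_mem n h)

theorem actsBy_presHom (n : ℤ) {D E : List ℕ} {Q P ψ : List Row} (h : IsPresHom D Q E P ψ) :
    ActsBy (presHom n h) ψ :=
  fun _ _ _ hz => congrArg (presMap h) hz

theorem linearCombination_comp {f g h : ℕ} {ψ χ ω : List Row}
    (hψ : ∀ k < h, RowBelow g (ψ.getD k []) ∧ imageRow χ (ψ.getD k []) = ω.getD k [])
    (y : Fin h → SteenrodAlgebra) :
    Fintype.linearCombination SteenrodAlgebra (rowFamily f g χ)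
      (Fintype.linearCombination SteenrodAlgebra (rowFamily g h ψ) y) =
    Fintype.linearCombination SteenrodAlgebra (rowFamily f h ω) y := by
  have e : ∀ {g' : ℕ} (ψ' : List Row), Fintype.linearCombination SteenrodAlgebra
      (rowFamily g' h ψ') y = ∑ k, y k • rowFamily g' h ψ' k := fun _ => rfl
  rw [e, e, map_sum]
  refine Finset.sum_congr rfl fun k _ => ?_
  rw [map_smul, rowFamily, linearCombination_rowFamily χ (hψ k k.2).1, (hψ k k.2).2, rowFamily]

/-- The rows of the identity matrix of size `h`. -/
def idRows (h : ℕ) : List Row := (List.range h).map fun k => [(k, [])]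

theorem linearCombination_idRows (h : ℕ) (y : Fin h → SteenrodAlgebra) :
    Fintype.linearCombination SteenrodAlgebra (rowFamily h h (idRows h)) y = y := by
  have e : ∀ k, rowFamily h h (idRows h) k = Pi.single k 1 := fun k => by
    rw [rowFamily, idRows, List.getD_eq_getElem _ _ (by simp), List.getElem_map,
      List.getElem_range, rowVec_cons]
    funext i
    rw [Pi.single_apply]
    refine (add_zero _).trans ?_
    exact if_congr (by rw [Fin.ext_iff]) rfl rfl
  funext i
  simp [Fintype.linearCombination_apply, e, Pi.single_apply]

theorem linearCombination_rowFamily_add {g h : ℕ} {ψ χ ω : List Row}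
    (hψ : ∀ k < h, ω.getD k [] = ψ.getD k [] ++ χ.getD k []) (y : Fin h → SteenrodAlgebra) :
    Fintype.linearCombination SteenrodAlgebra (rowFamily g h ω) y =
      Fintype.linearCombination SteenrodAlgebra (rowFamily g h ψ) y +
      Fintype.linearCombination SteenrodAlgebra (rowFamily g h χ) y := by
  simp only [Fintype.linearCombination_apply, ← Finset.sum_add_distrib, ← smul_add]
  refine Finset.sum_congr rfl fun k _ => ?_
  rw [rowFamily, hψ k k.2, rowVec_append]
  rfl

/-- The rows of the composite of two maps given by rows. -/
def compRows (ψ χ : List Row) : List Row := ψ.map (imageRow χ)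

theorem getD_compRows {ψ χ : List Row} (k : ℕ) :
    (compRows ψ χ).getD k [] = imageRow χ (ψ.getD k []) := by
  rw [compRows, ← List.getD_map (f := imageRow χ)]
  rfl

theorem ActsBy.comp {n : ℤ} {D D' E : List ℕ} {P Q Q' : List Row} {f : pres n E P ⟶ pres n D Q}
    {f' : pres n D Q ⟶ pres n D' Q'} {φ φ' : List Row} (h : ActsBy f φ) (h' : ActsBy f' φ')
    (hb : ∀ k < E.length, RowBelow D.length (φ.getD k [])) :
    ActsBy (f ≫ f') (compRows φ φ') := by
  intro m x z hz
  refine (h' m (f.hom.app m x) _ (h m x z hz)).trans (congrArg _ ?_)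
  exact linearCombination_comp (fun k hk => ⟨hb k hk, (getD_compRows k).symm⟩) z

theorem eq_id_of_rows {n : ℤ} {D E : List ℕ} {Q P ψ χ : List Row} (h : IsPresHom D Q E P ψ)
    (h' : IsPresHom E P D Q χ) (hb : ∀ k < E.length, RowBelow D.length (ψ.getD k []))
    (hc : compRows ψ χ = idRows E.length) : presHom n h ≫ presHom n h' = 𝟙 _ := by
  refine GradedModuleCat.homOf_comp_eq_id _ _ _ (presMap_mem n h) _ (presMap_mem n h') fun x => ?_
  obtain ⟨y, rfl⟩ := Submodule.mkQ_surjective _ x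
  refine congrArg (Submodule.Quotient.mk (p := rowSpan _ P)) ?_
  refine (linearCombination_comp (f := E.length) (ω := idRows E.length) (fun k hk => ⟨hb k hk, ?_⟩)
    y).trans (linearCombination_idRows _ y)
  rw [← hc, getD_compRows]

/-- Inclusions and projections, given by rows, that exhibit the module `(D, Q)` as the direct sum of
`(E, P)` and `(E', P')`. -/
structure IsDirectSum (D : List ℕ) (Q : List Row) (E : List ℕ) (P : List Row) (E' : List ℕ)
    (P' i r p s : List Row) : Prop where
  inl : IsPresHom D Q E P i
  fst : IsPresHom E P D Q r
  snd : IsPresHom E' P' D Q p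
  inr : IsPresHom D Q E' P' s
  below : (∀ k < E.length, RowBelow D.length (i.getD k [])) ∧
    (∀ k < D.length, RowBelow E.length (r.getD k [])) ∧
    (∀ k < D.length, RowBelow E'.length (p.getD k [])) ∧
    (∀ k < E'.length, RowBelow D.length (s.getD k []))
  inl_fst : compRows i r = idRows E.length
  inr_snd : compRows s p = idRows E'.length
  inl_snd : ∀ k < E.length, imageRow p (i.getD k []) = []
  id : ∀ k < D.length, (idRows D.length).getD k [] =
    imageRow i (r.getD k []) ++ imageRow s (p.getD k [])

theorem IsDirectSum.exists_shortExact {D E E' : List ℕ} {Q P P' i r p s : List Row}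
    (h : IsDirectSum D Q E P E' P' i r p s) (n : ℤ) :
    ∃ (f : pres n E P ⟶ pres n D Q) (w : f ≫ presHom n h.snd = 0)
      (q : pres n D Q ⟶ pres n E P),
      (ShortComplex.mk f (presHom n h.snd) w).ShortExact ∧ f ≫ q = 𝟙 _ := by
  obtain ⟨hi, hr, hp, hs⟩ := h.below
  have w : presHom n h.inl ≫ presHom n h.snd = 0 := by
    refine GradedModuleCat.homOf_comp_eq_zero _ _ _ _ (presMap_mem n h.inl) _
      (presMap_mem n h.snd) fun x => ?_
    obtain ⟨y, rfl⟩ := Submodule.mkQ_surjective _ x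
    refine congrArg (Submodule.Quotient.mk (p := rowSpan _ P')) (a₂ := 0) ?_
    refine (linearCombination_comp (f := E'.length) (ω := []) (fun k hk => ⟨hi k hk, ?_⟩)
      y).trans ?_
    · rw [h.inl_snd k hk]
      rfl
    · rw [Fintype.linearCombination_apply]
      exact Finset.sum_eq_zero fun k _ => smul_zero (y k)
  let S := ShortComplex.mk (presHom n h.inl) (presHom n h.snd) w
  let σ : S.Splitting :=
    { r := presHom n h.fst
      s := presHom n h.inr
      f_r := eq_id_of_rows h.inl h.fst hi h.inl_fst
      s_g := eq_id_of_rows h.inr h.snd hs h.inr_snd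
      id := by
        change presHom n h.fst ≫ presHom n h.inl + presHom n h.snd ≫ presHom n h.inr = 𝟙 _
        refine GradedModuleCat.homOf_comp_add_eq_id _ _ _ _ (presMap_mem n h.fst) _
          (presMap_mem n h.inl) _ (presMap_mem n h.snd) _ (presMap_mem n h.inr) fun x => ?_
        obtain ⟨y, rfl⟩ := Submodule.mkQ_surjective _ x
        refine congrArg (Submodule.Quotient.mk (p := rowSpan _ Q)) ?_
        have h1 := linearCombination_comp (f := D.length) (h := D.length) (ψ := r) (χ := i)
          (ω := compRows r i) (fun k hk => ⟨hr k hk, (getD_compRows k).symm⟩) y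
        have h2 := linearCombination_comp (f := D.length) (h := D.length) (ψ := p) (χ := s)
          (ω := compRows p s) (fun k hk => ⟨hp k hk, (getD_compRows k).symm⟩) y
        have h3 := linearCombination_rowFamily_add (g := D.length) (h := D.length)
          (ω := idRows D.length) (ψ := compRows r i) (χ := compRows p s) (fun k hk => by
            rw [getD_compRows, getD_compRows]
            exact h.id k hk) y
        rw [linearCombination_idRows, ← h1, ← h2] at h3
        exact h3.symm }
  exact ⟨_, w, _, σ.shortExact, σ.f_r⟩

end SteenrodAlgebra

/-! ### Homomorphisms to `Σᵗ ℤ/2` -/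

namespace SteenrodAlgebra

theorem shiftedTrivialModule_id_add_id (t : ℤ) :
    𝟙 (shiftedTrivialModule t) + 𝟙 (shiftedTrivialModule t) = 0 := by
  ext n x
  refine Subtype.ext ?_
  change (x.1 : ZMod 2) + x.1 = 0
  exact CharTwo.add_self_eq_zero (R := ZMod 2) x.1

section Generators

variable {g : ℕ} (D : Fin g → ℤ) (Q : Submodule SteenrodAlgebra (Fin g → SteenrodAlgebra))

/-- A generator of a presented module. -/
noncomputable def presGen (i : Fin g) : (presented D Q).obj.obj ⟨D i⟩ :=
  ⟨Q.mkQ (Pi.single i 1), Pi.single i 1, (mem_freeGrading D).2 fun j => by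
    rcases eq_or_ne j i with rfl | h
    · rw [Pi.single_eq_same, sub_self]
      exact SetLike.one_mem_graded grading
    · rw [Pi.single_eq_of_ne h]
      exact zero_mem _, rfl⟩

/-- A morphism out of a presented module is determined by the images of the generators. -/
theorem hom_eq_zero_of_presGen {X : GradedModuleCat grading} (f : presented D Q ⟶ X)
    (h : ∀ i, f.hom.app ⟨D i⟩ (presGen D Q i) = 0) : f = 0 := by
  ext n x
  obtain ⟨_, y, hy, rfl⟩ := x
  have hy' := (mem_freeGrading D).1 hy
  let a : ∀ i, (⟨D i⟩ : GradedIndex grading) ⟶ n := fun i => ⟨y i, hy' i⟩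
  have hx : (⟨_, y, hy, rfl⟩ : presGrading D Q n.deg) =
      ∑ i, (presented D Q).obj.map (a i) (presGen D Q i) := by
    refine Subtype.ext ?_
    have hsum : ∀ (s : Finset (Fin g)) (z : Fin g → (presented D Q).obj.obj n),
        Subtype.val (p := (· ∈ presGrading D Q n.deg)) (∑ i ∈ s, z i) =
          ∑ i ∈ s, Subtype.val (p := (· ∈ presGrading D Q n.deg)) (z i) := fun s z =>
      map_sum (presGrading D Q n.deg).subtype.toAddMonoidHom z s
    refine Eq.trans ?_ (hsum Finset.univ fun i =>
      (presented D Q).obj.map (a i) (presGen D Q i)).symm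
    have hy0 : y = ∑ i, y i • (Pi.single i 1 : Fin g → SteenrodAlgebra) := by
      funext j
      simp [Finset.sum_apply, Pi.single_apply]
    change Q.mkQ y = ∑ i, y i • Q.mkQ (Pi.single i 1)
    conv_lhs => rw [hy0]
    rw [map_sum]
    simp only [map_smul]
  change f.hom.app n (⟨_, y, hy, rfl⟩ : presGrading D Q n.deg) = 0
  refine (congrArg (f.hom.app n) hx).trans ?_
  rw [map_sum]
  refine Finset.sum_eq_zero fun i _ => ?_
  have := ConcreteCategory.congr_hom (f.hom.naturality (a i)) (presGen D Q i)
  refine this.trans ?_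
  change X.obj.map (a i) (f.hom.app _ (presGen D Q i)) = 0
  rw [h, map_zero]

end Generators

section FreeModule

variable (D : Fin 1 → ℤ) {Q : Submodule SteenrodAlgebra (Fin 1 → SteenrodAlgebra)} (hQ : Q = ⊥)
  {X : GradedModuleCat grading}

theorem eq_of_app_presGen {f f' : presented D Q ⟶ X}
    (h : f.hom.app ⟨D 0⟩ (presGen D Q 0) = f'.hom.app ⟨D 0⟩ (presGen D Q 0)) : f = f' := by
  rw [← sub_eq_zero]
  refine hom_eq_zero_of_presGen D Q _ fun i => ?_
  obtain rfl := Subsingleton.elim i 0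
  change f.hom.app _ _ - f'.hom.app _ _ = 0
  rw [h, sub_self]

include hQ

/-- A module on one generator without relations is free: the generator can be sent anywhere. -/
theorem exists_hom_presGen (x : X.obj.obj ⟨D 0⟩) :
    ∃ f : presented D Q ⟶ X, f.hom.app ⟨D 0⟩ (presGen D Q 0) = x := by
  have hrep : ∀ n : GradedIndex grading, ∀ z : presGrading D Q n.deg,
      ∃ a : (⟨D 0⟩ : GradedIndex grading) ⟶ n, Q.mkQ (fun _ => a.1) = z.1 := by
    rintro n ⟨_, y, hy, rfl⟩
    refine ⟨⟨y 0, (mem_freeGrading D).1 hy 0⟩, congrArg Q.mkQ (funext fun i => ?_)⟩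
    rw [Subsingleton.elim i 0]
  have huniq : ∀ a b : SteenrodAlgebra, Q.mkQ (fun _ => a) = Q.mkQ (fun _ => b) → a = b := by
    intro a b hab
    rw [Submodule.mkQ_apply, Submodule.mkQ_apply, Submodule.Quotient.eq, hQ, Submodule.mem_bot,
      sub_eq_zero] at hab
    exact congrFun hab 0
  choose r hr using hrep
  have hadd : ∀ n z z', r n (z + z') = r n z + r n z' := fun n z z' =>
      Subtype.ext <| huniq _ _ <| by
    rw [hr]
    change z.1 + z'.1 = Q.mkQ ((fun _ => (r n z).1) + (fun _ => (r n z').1))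
    rw [map_add, hr, hr]
  refine ⟨ObjectProperty.homMk
    { app := fun n => AddCommGrpCat.ofHom (AddMonoidHom.mk'
        (fun z : presGrading D Q n.deg => X.obj.map (r n z) x) fun z z' => ?_)
      naturality := fun m n a => ?_ }, ?_⟩
  · have hX : X.obj.Additive := X.property
    rw [hadd, hX.map_add]
    rfl
  · ext z
    change X.obj.map (r n ((presented D Q).obj.map a z)) x = X.obj.map a (X.obj.map (r m z) x)
    have hc : r n ((presented D Q).obj.map a z) = r m z ≫ a := by
      refine Subtype.ext (huniq _ _ ((hr n ((presented D Q).obj.map a z)).trans ?_))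
      change a.1 • Subtype.val z = Q.mkQ (a.1 • fun _ => (r m z).1)
      rw [map_smul]
      exact congrArg _ (hr m z).symm
    rw [hc, X.obj.map_comp]
    rfl
  · change X.obj.map (r ⟨D 0⟩ (presGen D Q 0)) x = x
    have h1 : r ⟨D 0⟩ (presGen D Q 0) = 𝟙 _ := by
      refine Subtype.ext (huniq _ _ ((hr ⟨D 0⟩ (presGen D Q 0)).trans ?_))
      refine congrArg Q.mkQ (funext fun i => ?_)
      rw [Subsingleton.elim i 0, Pi.single_eq_same]
      rfl
    rw [h1, X.obj.map_id]
    rfl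

theorem projective_presented : Projective (presented D Q) where
  factors {E X} f e he := by
    obtain ⟨y, hy⟩ := GradedModuleCat.surjective_of_epi e ⟨D 0⟩ (f.hom.app ⟨D 0⟩ (presGen D Q 0))
    obtain ⟨f', hf'⟩ := exists_hom_presGen D hQ y
    refine ⟨f', eq_of_app_presGen D ?_⟩
    rw [← hy, ← hf']
    rfl

/-- A morphism out of a free module on one generator is given by the image of the generator. -/
noncomputable def homEquivPresGen : (presented D Q ⟶ X) ≃+ X.obj.obj ⟨D 0⟩ :=
  AddEquiv.ofBijective (AddMonoidHom.mk' (fun f => f.hom.app ⟨D 0⟩ (presGen D Q 0))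
    fun _ _ => rfl)
    ⟨fun _ _ h => eq_of_app_presGen D h, fun x => exists_hom_presGen D hQ x⟩

end FreeModule

theorem rowSpan_nil (g : ℕ) : rowSpan g [] = ⊥ := by
  rw [rowSpan, Submodule.span_eq_bot]
  rintro _ ⟨k, -⟩
  exact k.elim0

/-- The elements of degree `m` of `Σᵗ ℤ/2`. -/
theorem nonempty_addEquiv_shiftedTrivialModule (t m : ℤ) :
    Nonempty ((shiftedTrivialModule t).obj.obj ⟨m⟩ ≃+ ({_i : Unit // m = t} →₀ ZMod 2)) := by
  change Nonempty (TrivialModule.grading t m ≃+ _)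
  rcases eq_or_ne m t with rfl | h
  · have e : TrivialModule.grading m m = ⊤ := if_pos rfl
    rw [e]
    have : Unique {_i : Unit // m = m} := ⟨⟨⟨(), rfl⟩⟩, fun _ => rfl⟩
    exact ⟨((Submodule.topEquiv (R := ZMod 2) (M := TrivialModule)).toAddEquiv).trans
      (Finsupp.uniqueLinearEquiv (ZMod 2) (ZMod 2) default).symm.toAddEquiv⟩
  · have e : TrivialModule.grading t m = ⊥ := if_neg h
    rw [e]
    have : IsEmpty {_i : Unit // m = t} := ⟨fun i => h i.2⟩
    exact ⟨⟨Equiv.ofUnique _ _, fun _ _ => Subsingleton.elim _ _⟩⟩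

theorem shiftedTrivialModule_eq_zero {t m : ℤ} (h : m ≠ t)
    (x : (shiftedTrivialModule t).obj.obj ⟨m⟩) : x = 0 := by
  have e : TrivialModule.grading t m = ⊥ := if_neg h
  have hx : ∀ y ∈ TrivialModule.grading t m, y = 0 := by
    rw [e]
    exact fun y hy => (Submodule.mem_bot _).1 hy
  exact Subtype.ext (hx _ x.2)

/-- There are no homomorphisms to `Σᵗ ℤ/2` from a module without generators of degree `t`. -/
theorem ext_zero_eq_zero_of_degrees {n t : ℤ} {D : List ℕ} {L : List Row}
    (h : ∀ i < D.length, n + D.getD i 0 ≠ t) (x : ExtA (pres n D L) 0 t) : x = 0 := by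
  refine Ext.addEquiv₀.injective ?_
  rw [map_zero]
  exact hom_eq_zero_of_presGen _ _ _ fun i => shiftedTrivialModule_eq_zero (h i i.2) _

/-- `Ext` of a free module on one generator is `ℤ/2` in filtration zero. -/
theorem hasExtBasis_free (n : ℤ) (d N : ℕ) :
    HasExtBasis.{1} shiftedTrivialModule (pres n [d] []) N (fun _ : Unit => (0, n + d)) := by
  intro s _ t
  have hQ := rowSpan_nil 1
  cases s with
  | zero =>
    obtain ⟨f⟩ := nonempty_addEquiv_shiftedTrivialModule t (n + d)
    refine ⟨Ext.addEquiv₀.trans ((homEquivPresGen (shiftDeg n [d]) hQ).trans (f.trans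
      (Finsupp.domCongr (Equiv.subtypeEquivRight fun _ => ?_))))⟩
    simp
  | succ s =>
    have := projective_presented (shiftDeg n [d]) hQ
    have h1 : Subsingleton (ExtA (pres n [d] []) (s + 1) t) :=
      Ext.subsingleton_of_projective (presented (shiftDeg n [d]) (rowSpan 1 [])) _ s
    have h2 : IsEmpty {_i : Unit // ((0 : ℕ), n + (d : ℤ)) = (s + 1, t)} :=
      ⟨fun i => absurd (congrArg Prod.fst i.2) (Nat.succ_ne_zero s).symm⟩
    exact ⟨⟨⟨fun _ => 0, fun _ => 0, fun _ => Subsingleton.elim _ _,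
      fun _ => Subsingleton.elim _ _⟩, fun _ _ => Subsingleton.elim _ _⟩⟩

end SteenrodAlgebra

/-! ### The class `h₀` -/

namespace SteenrodAlgebra

open TrivSqZeroExt

/-- The homomorphism to the dual numbers that sends `Sq¹` to `ε` and `Sqⁿ` to zero for `n > 1`. -/
noncomputable def dualHom : SteenrodAlgebra →ₐ[ZMod 2] DualNumber (ZMod 2) :=
  lift (fun n => if n = 0 then 1 else if n = 1 then inr 1 else 0) rfl (by
    intro a b ha hab
    have hb : b ≠ 0 := by omega
    trans 0
    · simp only [if_neg ha.ne', if_neg hb]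
      split_ifs <;> simp
    · refine (Finset.sum_eq_zero fun j hj => ?_).symm
      have := Finset.mem_range.1 hj
      dsimp only
      rw [if_neg (show a + b - j ≠ 0 by omega), if_neg (show a + b - j ≠ 1 by omega), zero_mul,
        smul_zero])

theorem dualHom_Sq (n : ℕ) :
    dualHom (Sq n) = if n = 0 then 1 else if n = 1 then inr 1 else 0 := lift_Sq _ _ _ n

theorem fst_dualHom (x : SteenrodAlgebra) : fst (dualHom x) = augmentation x := by
  induction x using induction_left with
  | h1 => rw [map_one, map_one, fst_one]
  | hadd x y hx hy => rw [map_add, map_add, fst_add, hx, hy]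
  | hmul n x hx =>
    rw [map_mul, map_mul, fst_mul, hx, dualHom_Sq, augmentation_Sq]
    split_ifs <;> simp

/-- The dual numbers as a graded ring, with `ε` in degree `1`. -/
def dualGrading (n : ℤ) : Submodule (ZMod 2) (DualNumber (ZMod 2)) where
  carrier := {x | (n ≠ 0 → fst x = 0) ∧ (n ≠ 1 → snd x = 0)}
  zero_mem' := ⟨fun _ => rfl, fun _ => rfl⟩
  add_mem' {x y} hx hy := ⟨fun h => by rw [fst_add, hx.1 h, hy.1 h, add_zero],
    fun h => by rw [snd_add, hx.2 h, hy.2 h, add_zero]⟩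
  smul_mem' a x hx := ⟨fun h => by rw [fst_smul, hx.1 h, smul_zero],
    fun h => by rw [snd_smul, hx.2 h, smul_zero]⟩

theorem mul_mem_dualGrading {m n : ℤ} {x y : DualNumber (ZMod 2)} (hx : x ∈ dualGrading m)
    (hy : y ∈ dualGrading n) (hm : 0 ≤ m) : x * y ∈ dualGrading (m + n) := by
  refine ⟨fun h => ?_, fun h => ?_⟩
  · rw [fst_mul]
    rcases eq_or_ne m 0 with rfl | hm
    · rw [hy.1 (by omega), mul_zero]
    · rw [hx.1 hm, zero_mul]
  · rw [snd_mul]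
    have h1 : fst x • snd y = 0 := by
      rcases eq_or_ne m 0 with rfl | hm
      · rw [hy.2 (by omega), smul_zero]
      · rw [hx.1 hm, zero_smul]
    have h2 : MulOpposite.op (fst y) • snd x = 0 := by
      rcases eq_or_ne m 1 with rfl | hm
      · rw [hy.1 (by omega), MulOpposite.op_zero, zero_smul]
      · rw [hx.2 hm, smul_zero]
    rw [h1, h2, add_zero]

theorem dualHom_mem {n : ℤ} {x : SteenrodAlgebra} (hx : x ∈ grading n) :
    dualHom x ∈ dualGrading n := by
  suffices grading n ≤ (dualGrading n).comap dualHom.toLinearMap from this hx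
  refine Submodule.span_le.2 ?_
  rintro _ ⟨l, rfl, rfl⟩
  change dualHom _ ∈ dualGrading _
  clear hx
  induction l with
  | nil =>
    rw [List.map_nil, List.prod_nil, map_one]
    exact ⟨fun h => absurd rfl h, fun _ => rfl⟩
  | cons k l ih =>
    rw [List.map_cons, List.prod_cons, map_mul, List.sum_cons, Nat.cast_add]
    refine mul_mem_dualGrading ?_ ih (Nat.cast_nonneg k)
    rw [dualHom_Sq]
    split_ifs with h0 h1
    · subst h0
      exact ⟨fun h => absurd rfl h, fun _ => rfl⟩
    · subst h1
      exact ⟨fun _ => rfl, fun h => absurd rfl h⟩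
    · exact zero_mem _

/-- The dual numbers as an `A`-module: the extension of `ℤ/2` by `Σ ℤ/2` in which `Sq¹` acts
nontrivially. -/
def DualModule : Type := DualNumber (ZMod 2)

namespace DualModule

instance : AddCommGroup DualModule := inferInstanceAs (AddCommGroup (DualNumber (ZMod 2)))

instance : Module (ZMod 2) DualModule := inferInstanceAs (Module (ZMod 2) (DualNumber (ZMod 2)))

noncomputable instance : Module SteenrodAlgebra DualModule :=
  Module.compHom (DualNumber (ZMod 2)) dualHom.toRingHom

/-- The grading of the extension that starts in degree `t`. -/
def grading (t n : ℤ) : Submodule (ZMod 2) DualModule := dualGrading (n - t)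

instance (t : ℤ) : SetLike.GradedSMul SteenrodAlgebra.grading (DualModule.grading t) where
  smul_mem := by
    intro i j a x ha hx
    rw [vadd_eq_add]
    rcases lt_or_ge i 0 with hi | hi
    · rw [grading_of_neg hi, Submodule.mem_bot] at ha
      rw [ha, zero_smul]
      exact Submodule.zero_mem _
    · have := mul_mem_dualGrading (dualHom_mem ha) hx hi
      rwa [← add_sub_assoc] at this

end DualModule

/-- The inclusion of `Σ ℤ/2` in the extension. -/
noncomputable def dualInl : TrivialModule →ₗ[SteenrodAlgebra] DualModule where
  toFun x := (inr (show ZMod 2 from x) : DualNumber (ZMod 2))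
  map_add' x y := inr_add _ (show ZMod 2 from x) y
  map_smul' a x := by
    have h : ∀ z : ZMod 2,
        (inr (augmentation a * z) : DualNumber (ZMod 2)) = dualHom a * inr z := by
      intro z
      refine TrivSqZeroExt.ext ?_ ?_
      · simp
      · simp [fst_dualHom, mul_comm]
    exact h x

/-- The projection of the extension to `ℤ/2`. -/
noncomputable def dualFst : DualModule →ₗ[SteenrodAlgebra] TrivialModule where
  toFun x := fst (show DualNumber (ZMod 2) from x)
  map_add' x y := rfl
  map_smul' a x := by
    have h : ∀ z : DualNumber (ZMod 2), fst (dualHom a * z) = augmentation a * fst z := by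
      intro z
      rw [fst_mul, fst_dualHom]
    exact h x

theorem dualInl_mem (t n : ℤ) : ∀ x ∈ TrivialModule.grading (t + 1) n,
    dualInl x ∈ DualModule.grading t n := by
  intro x hx
  rcases eq_or_ne n (t + 1) with rfl | h
  · exact ⟨fun _ => rfl, fun h => absurd (add_sub_cancel_left t 1) h⟩
  · rw [TrivialModule.grading, if_neg h, Submodule.mem_bot] at hx
    rw [hx, map_zero]
    exact zero_mem _

theorem dualFst_mem (t n : ℤ) : ∀ x ∈ DualModule.grading t n,
    dualFst x ∈ TrivialModule.grading t n := by
  intro x hx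
  rcases eq_or_ne n t with rfl | h
  · rw [TrivialModule.grading, if_pos rfl]
    trivial
  · rw [TrivialModule.grading, if_neg h, Submodule.mem_bot]
    exact hx.1 (sub_ne_zero.2 h)

/-- The extension of `Σᵗ ℤ/2` by `Σᵗ⁺¹ ℤ/2` in which `Sq¹` acts nontrivially. -/
noncomputable def dualComplex (t : ℤ) : ShortComplex (GradedModuleCat grading) :=
  ShortComplex.mk
    (GradedModuleCat.homOf (𝒜 := grading) (TrivialModule.grading (t + 1)) (DualModule.grading t)
      dualInl (dualInl_mem t))
    (GradedModuleCat.homOf (𝒜 := grading) (DualModule.grading t) (TrivialModule.grading t)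
      dualFst (dualFst_mem t))
    (GradedModuleCat.homOf_comp_eq_zero _ _ _ _ _ _ _ fun _ => rfl)

theorem shortExact_dualComplex (t : ℤ) : (dualComplex t).ShortExact := by
  refine GradedModuleCat.shortExact_homOf _ _ _ _ _ _ _ (fun _ => rfl) ?_ ?_ ?_
  · exact fun x y h => inr_injective h
  · intro n z hz
    refine ⟨(inl (show ZMod 2 from z) : DualNumber (ZMod 2)), ⟨fun h => ?_, fun _ => rfl⟩, rfl⟩
    rw [TrivialModule.grading, if_neg (sub_ne_zero.1 h), Submodule.mem_bot] at hz
    exact hz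
  · intro n y hy h0
    refine ⟨snd (show DualNumber (ZMod 2) from y), ?_, TrivSqZeroExt.ext (Eq.symm h0) rfl⟩
    rw [TrivialModule.grading]
    split_ifs with h
    · trivial
    · exact (Submodule.mem_bot _).2 (hy.2 (by omega))

/-- The class `h₀` in `Ext^{1,1}`, as a family of classes in `Ext¹(Σᵗ ℤ/2, Σᵗ⁺¹ ℤ/2)`. -/
noncomputable def hZero (t : ℤ) :
    Ext.{1} (shiftedTrivialModule t) (shiftedTrivialModule (t + 1)) 1 :=
  (shortExact_dualComplex t).extClass

/-- The relation `Sq¹ = 0`. -/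
def sqOneRows : List Row := [[(0, [1])]]

theorem Sq_one_mem_grading : Sq 1 ∈ grading 1 := Submodule.subset_span ⟨[1], rfl, by simp⟩

theorem fst_eq_zero_of_dualHom_mul {x : DualNumber (ZMod 2)} (h : dualHom (Sq 1) * x = 0) :
    fst x = 0 := by
  rw [dualHom_Sq, if_neg one_ne_zero, if_pos rfl] at h
  have := congrArg snd h
  simpa using this

/-- On `A/A Sq¹`, multiplication by `h₀` is injective in filtration `0`: a homomorphism to
`Σᵗ ℤ/2` killed by `h₀` lifts to an extension in which `Sq¹` acts nontrivially, so that it sends the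
generator, which is killed by `Sq¹`, to zero. -/
theorem mulInjective_zero_sqOne (n : ℤ) (d : ℕ) (t : ℤ) :
    MulInjective hZero (pres n [d] sqOneRows) 0 t := by
  intro x hx
  obtain ⟨y, rfl⟩ := Ext.covariant_sequence_exact₃ _ (shortExact_dualComplex t) x rfl hx
  obtain ⟨g, rfl⟩ := (Ext.mk₀_bijective _ _).2 y
  have : Subsingleton (Fin [d].length) := inferInstanceAs (Subsingleton (Fin 1))
  let G := presGen (shiftDeg n [d]) (rowSpan [d].length sqOneRows) 0
  have hsq : Sq 1 • G.1 = 0 := by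
    change Sq 1 • Submodule.Quotient.mk _ = 0
    rw [← Submodule.Quotient.mk_smul, Submodule.Quotient.mk_eq_zero]
    have := rowVec_mem_rowSpan (g := 1) (L := sqOneRows) (r := [(0, [1])]) (by simp [sqOneRows])
    have he : Sq 1 • (Pi.single 0 1 : Fin 1 → SteenrodAlgebra) = rowVec 1 [(0, [1])] := by
      funext i
      rw [Subsingleton.elim i 0]
      simp [rowVec, wordVal]
    exact he ▸ this
  have hzero : g ≫ (dualComplex t).g = 0 := by
    refine hom_eq_zero_of_presGen _ _ _ fun i => ?_
    obtain rfl := Subsingleton.elim i ⟨0, Nat.one_pos⟩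
    let a : (⟨shiftDeg n [d] 0⟩ : GradedIndex grading) ⟶ ⟨shiftDeg n [d] 0 + 1⟩ :=
      ⟨Sq 1, by
        change Sq 1 ∈ grading (shiftDeg n [d] 0 + 1 - shiftDeg n [d] 0)
        rw [add_sub_cancel_left]
        exact Sq_one_mem_grading⟩
    have h1 := ConcreteCategory.congr_hom (g.hom.naturality a) G
    have h2 : (pres n [d] sqOneRows).obj.map a G = 0 := Subtype.ext hsq
    have h3 : (dualComplex t).X₂.obj.map a (g.hom.app _ G) = 0 := by
      refine h1.symm.trans ?_
      change g.hom.app _ ((pres n [d] sqOneRows).obj.map a G) = 0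
      rw [h2, map_zero]
    refine Subtype.ext ?_
    exact fst_eq_zero_of_dualHom_mul (congrArg Subtype.val h3)
  exact (Ext.mk₀_comp_mk₀ _ _).trans ((congrArg Ext.mk₀ hzero).trans (Ext.mk₀_zero _ _))

end SteenrodAlgebra

/-! ### Ext and verified presentations -/

namespace SteenrodAlgebra

/-- Suspending the generators and suspending the module are the same. -/
theorem pres_congr {n m : ℤ} {D E : List ℕ} (L : List Row) (hl : D.length = E.length)
    (h : ∀ i < E.length, n + D.getD i 0 = m + E.getD i 0) : pres n D L = pres m E L := by
  have key : ∀ g g' : ℕ, g = g' → ∀ (a : Fin g → ℤ) (b : Fin g' → ℤ),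
      (∀ i hi hi', a ⟨i, hi⟩ = b ⟨i, hi'⟩) →
        presented a (rowSpan g L) = presented b (rowSpan g' L) := by
    rintro g _ rfl a b hab
    rw [show a = b from funext fun i => hab i i.2 i.2]
  exact key _ _ hl _ _ fun i _ hi => h i hi

theorem pres_single (n : ℤ) (d : ℕ) (L : List Row) : pres n [d] L = pres (n + d) [0] L :=
  pres_congr L rfl fun i hi => by
    obtain rfl : i = 0 := Nat.lt_one_iff.1 hi
    simp

/-- The groups `Ext^{s,t}(X, ℤ/2)` for `s < N` have a basis with the degrees `d`, and
multiplication by `h₀` is injective in the stems `t - s` that satisfy `q`. -/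
structure ExtInfo (X : GradedModuleCat grading) (N : ℕ) {ι : Type} (d : ι → ℕ × ℤ)
    (q : ℤ → Prop) : Prop where
  basis : HasExtBasis.{1} shiftedTrivialModule X N d
  inj : ∀ s < N, ∀ t : ℤ, q (t - s) → MulInjective hZero X s t

theorem ExtInfo.reindex {X : GradedModuleCat grading} {N : ℕ} {ι κ : Type} {d : ι → ℕ × ℤ}
    {q : ℤ → Prop} (h : ExtInfo X N d q) {d' : κ → ℕ × ℤ} (e : ι ≃ κ) (he : ∀ i, d' (e i) = d i) :
    ExtInfo X N d' q :=
  ⟨h.basis.reindex e he, h.inj⟩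

theorem ExtInfo.imp {X : GradedModuleCat grading} {N : ℕ} {ι : Type} {d : ι → ℕ × ℤ}
    {q q' : ℤ → Prop} (h : ExtInfo X N d q) (hq : ∀ x, q' x → q x) : ExtInfo X N d q' :=
  ⟨h.basis, fun s hs t ht => h.inj s hs t (hq _ ht)⟩

theorem ExtInfo.mono {X : GradedModuleCat grading} {N N' : ℕ} {ι : Type} {d : ι → ℕ × ℤ}
    {q : ℤ → Prop} (h : ExtInfo X N d q) (hN : N' ≤ N) : ExtInfo X N' d q :=
  ⟨h.basis.mono hN, fun s hs => h.inj s (hs.trans_le hN)⟩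

section step

variable {S : ShortComplex (GradedModuleCat grading)} {ι κ : Type} {d : ι → ℕ × ℤ}
  {d' : κ → ℕ × ℤ} {q₁ q₂ q : ℤ → Prop} {N : ℕ}

/-- Restriction is zero in bidegrees that are not common to both groups, and on classes killed by
`h₀` for degree reasons in stems in which `h₀` acts injectively on the target. -/
theorem ExtInfo.restrictsToZero (h₂ : ∀ N, ExtInfo S.X₂ N d q₂) (h₁ : ExtInfo S.X₁ N d' q₁) {s : ℕ}
    (hs : s < N) {t : ℤ} (h : ∀ i, d i = (s, t) →
      (∀ k, d' k ≠ (s, t)) ∨ (q₁ (t - s) ∧ ∀ j, d j ≠ (s + 1, t + 1))) :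
    RestrictsToZero.{1} shiftedTrivialModule S s t := by
  by_cases hi : ∃ i, d i = (s, t)
  · obtain ⟨i, hi⟩ := hi
    rcases h i hi with h | ⟨hq, h⟩
    · exact fun x => h₁.basis.eq_zero hs h _
    · exact restrictsToZero_of_mulInjective ((h₂ (s + 2)).basis.eq_zero (by omega) h)
        (h₁.inj s hs t hq)
  · intro x
    rw [(h₂ N).basis.eq_zero hs (fun i h => hi ⟨i, h⟩) x, Ext.comp_zero]

/-- The classes of the quotient are those of the middle term and, one filtration higher, those of
the submodule. The connecting map lowers the stem `t - s` by one, whence `q₁ (x + 1)`. -/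
theorem ExtInfo.of_shortExact (hS : S.ShortExact) (h₂ : ExtInfo S.X₂ N d q₂)
    (h₁ : ExtInfo S.X₁ (N - 1) d' q₁)
    (h0 : ∀ s < N, ∀ t, RestrictsToZero.{1} shiftedTrivialModule S s t)
    (hq : ∀ x, q x → q₂ x ∧ q₁ (x + 1)) : ExtInfo S.X₃ N (extDeg d d') q := by
  refine ⟨hasExtBasis_of_restrictsToZero hS shiftedTrivialModule_id_add_id h₂.basis h₁.basis h0,
    fun s hs t ht => ?_⟩
  refine MulInjective.of_shortExact hS (h₂.inj s hs t (hq _ ht).1) ?_ fun _ => h0 s hs (t + 1)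
  rintro s rfl
  refine h₁.inj s (by omega) t ?_
  convert (hq _ ht).2 using 1
  push_cast
  ring

end step

section presented

variable {ι κ : Type} {d : ι → ℕ × ℤ} {d' : κ → ℕ × ℤ} {q₁ q₂ q : ℤ → Prop} {N : ℕ}

theorem extInfo_free (n : ℤ) (N : ℕ) :
    ExtInfo (pres n [0] []) N (fun _ : Unit => (0, n)) (fun x => x ≠ n) := by
  have h := hasExtBasis_free n 0 N
  simp only [Nat.cast_zero, add_zero] at h
  refine ⟨h, fun s hs t ht => h.mulInjective hs fun _ hd => ht ?_⟩
  obtain ⟨rfl, rfl⟩ := Prod.mk.inj hd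
  exact sub_zero n

theorem IsDirectSum.extInfo {D E E' : List ℕ} {Q P P' i r p s : List Row}
    (h : IsDirectSum D Q E P E' P' i r p s) {n : ℤ} (h₁ : ExtInfo (pres n E P) N d q₁)
    (h₃ : ExtInfo (pres n E' P') N d' q₂) :
    ExtInfo (pres n D Q) N (Sum.elim d d') (fun x => q₁ x ∧ q₂ x) := by
  obtain ⟨f, w, r, hS, hr⟩ := h.exists_shortExact n
  exact ⟨hasExtBasis_of_retraction hS shiftedTrivialModule_id_add_id r hr h₁.basis h₃.basis,
    fun s hs t ht => MulInjective.of_retraction hS r hr (h₁.inj s hs t ht.1) (h₃.inj s hs t ht.2)⟩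

variable {n : ℤ} {D E : List ℕ} {φ R S : List Row}

/-- The step for a verified presentation. -/
theorem ExtInfo.step (hc : checkExact D.length φ R S = true) (hlen : φ.length = E.length)
    (hR : RowsHomogeneous D R) (hφ : RowsHaveDeg D E φ) (h₂ : ∀ N, ExtInfo (pres n D R) N d q₂)
    (h₁ : ExtInfo (pres n E S) N d' q₁)
    (h : ∀ i k, d i = d' k → q₁ ((d i).2 - (d i).1) ∧ ∀ j, d j ≠ ((d i).1 + 1, (d i).2 + 1))
    (hq : ∀ x, q x → q₂ x ∧ q₁ (x + 1)) :
    ExtInfo (pres n D (R ++ φ)) N (extDeg d d') q := by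
  obtain ⟨f, p, w, hS, -⟩ := exists_shortExact_pres n hc hlen hR hφ
  refine ExtInfo.of_shortExact hS (h₂ N) (h₁.mono (Nat.sub_le N 1)) (fun s hs t => ?_) hq
  refine ExtInfo.restrictsToZero (S := ShortComplex.mk f p w) h₂ h₁ hs fun i hi => ?_
  rw [or_iff_not_imp_left]
  intro hk
  obtain ⟨k, hk⟩ := not_forall_not.1 hk
  have := h i k (hi.trans hk.symm)
  rwa [hi] at this

/-- The step for a verified presentation with a free module in the middle. -/
theorem ExtInfo.step_free (hc : checkExact D.length φ R S = true) (hlen : φ.length = E.length)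
    (hR : RowsHomogeneous D R) (hφ : RowsHaveDeg D E φ) (h₂ : ExtInfo (pres n D R) N d q₂)
    (hd : ∀ i, (d i).1 = 0 ∧ ∀ k < E.length, n + E.getD k 0 ≠ (d i).2)
    (h₁ : ExtInfo (pres n E S) (N - 1) d' q₁) (hq : ∀ x, q x → q₂ x ∧ q₁ (x + 1)) :
    ExtInfo (pres n D (R ++ φ)) N (extDeg d d') q := by
  obtain ⟨f, p, w, hS, -⟩ := exists_shortExact_pres n hc hlen hR hφ
  refine ExtInfo.of_shortExact hS h₂ h₁ (fun s hs t x => ?_) hq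
  by_cases hi : ∃ i, d i = (s, t)
  · obtain ⟨i, hi⟩ := hi
    obtain rfl : s = 0 := by rw [← (hd i).1, hi]
    refine ext_zero_eq_zero_of_degrees (fun k hk => ?_) _
    have := (hd i).2 k hk
    rwa [hi] at this
  · rw [h₂.basis.eq_zero hs (fun i h => hi ⟨i, h⟩) x, Ext.comp_zero]

end presented

/-! ### Towers -/

/-- `A Sq¹` is isomorphic to `Σ A/A Sq¹`. -/
theorem exists_shortExact_sqOne (n : ℤ) :
    ∃ (f : pres (n + 1) [0] sqOneRows ⟶ pres n [0] []) (p : pres n [0] [] ⟶ pres n [0] sqOneRows)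
      (w : f ≫ p = 0), (ShortComplex.mk f p w).ShortExact := by
  obtain ⟨f, p, w, hS, -⟩ := exists_shortExact_pres n (D := [0]) (E := [1]) (φ := sqOneRows)
    (R := []) (S := sqOneRows) (by decide +kernel) rfl (by decide) (by decide)
  revert hS w f
  rw [pres_single n 1]
  exact fun f w hS => ⟨f, p, w, hS⟩

/-- Zero and the successors. -/
def unitSumNatEquiv : Unit ⊕ ℕ ≃ ℕ where
  toFun := Sum.elim (fun _ => 0) Nat.succ
  invFun
    | 0 => Sum.inl ()
    | j + 1 => Sum.inr j
  left_inv := by rintro (_ | j) <;> rfl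
  right_inv := by rintro (_ | j) <;> rfl

/-- `Ext` of `A/A Sq¹` is one infinite tower. -/
theorem hasExtBasis_sqOne (N : ℕ) : ∀ n : ℤ,
    HasExtBasis.{1} shiftedTrivialModule (pres n [0] sqOneRows) N (fun j : ℕ => (j, n + j)) := by
  induction N with
  | zero => exact fun n s hs => absurd hs (Nat.not_lt_zero s)
  | succ N ih =>
    intro n
    obtain ⟨f, p, w, hS⟩ := exists_shortExact_sqOne n
    have h₂ := (extInfo_free n (N + 1)).basis
    refine (hasExtBasis_of_restrictsToZero hS shiftedTrivialModule_id_add_id h₂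
      (ih (n + 1)) fun s hs t x => ?_).reindex unitSumNatEquiv ?_
    · cases s with
      | zero =>
        -- The submodule is generated in degree `n + 1`, and the module in degree `n`.
        rcases eq_or_ne n t with rfl | hn
        · exact ext_zero_eq_zero_of_degrees (fun i hi => by
            obtain rfl : i = 0 := Nat.lt_one_iff.1 hi
            simp) _
        · rw [ext_zero_eq_zero_of_degrees (fun i hi => by
            obtain rfl : i = 0 := Nat.lt_one_iff.1 hi
            simpa) x, Ext.comp_zero]
      | succ s => rw [h₂.eq_zero hs (by simp) x, Ext.comp_zero]
    · rintro (_ | j)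
      · simp [extDeg, unitSumNatEquiv]
      · simp [extDeg, unitSumNatEquiv, add_assoc, add_comm (1 : ℤ)]

/-- On the tower of `A/A Sq¹`, multiplication by `h₀` is injective: the connecting maps reduce this
to filtration zero. -/
theorem mulInjective_sqOne (s : ℕ) : ∀ n t : ℤ,
    MulInjective hZero (pres n [0] sqOneRows) s t := by
  induction s with
  | zero => exact fun n t => mulInjective_zero_sqOne n 0 t
  | succ s ih =>
    intro n t
    obtain ⟨f, p, w, hS⟩ := exists_shortExact_sqOne n
    have h₂ := (extInfo_free n (s + 2)).basis
    refine MulInjective.of_shortExact hS (h₂.mulInjective (by omega) (by simp)) ?_ fun _ x => ?_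
    · rintro s' h
      obtain rfl := Nat.succ_injective h
      exact ih (n + 1) t
    · rw [h₂.eq_zero (by omega) (by simp) x, Ext.comp_zero]

theorem extInfo_sqOne (n : ℤ) (N : ℕ) :
    ExtInfo (pres n [0] sqOneRows) N (fun j : ℕ => (j, n + j)) (fun _ => True) :=
  ⟨hasExtBasis_sqOne N n, fun s _ t _ => mulInjective_sqOne s n t⟩

end SteenrodAlgebra

/-! ### Ext of `A/A(Sq¹, Sq²)` and related modules -/

namespace SteenrodAlgebra

/-- The relations `Sq¹ = Sq² = 0`. -/
def boRows : List Row := [[(0, [1])], [(0, [2])]]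

/-- The relations `Sq¹ = Sq² Sq¹ Sq² = 0`. -/
def bspRows : List Row := [[(0, [1])], [(0, [2, 1, 2])]]

/-- The relation `Sq² = 0`. -/
def sqTwoRows : List Row := [[(0, [2])]]

/-- The relation `Sq¹ Sq² = 0`. -/
def sqThreeRows : List Row := [[(0, [1, 2])]]

/-- The relations `Sq¹ x = 0` and `Sq¹ Sq² x = Sq² y` for two generators `x` and `y`. -/
def twoGenRows : List Row := [[(0, [1])], [(0, [1, 2]), (1, [2])]]

/-- The degrees `(s, t)` of the basis of `bo_*`, shifted by `(0, n)`. -/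
def boDeg (n : ℤ) : BoBasis → ℕ × ℤ
  | .tower₀ i j => (4 * i + j, n + (12 * i + j))
  | .eta i => (4 * i + 1, n + (12 * i + 2))
  | .etaSq i => (4 * i + 2, n + (12 * i + 4))
  | .tower₄ i j => (4 * i + 3 + j, n + (12 * i + 7 + j))

/-- The degrees `(s, t)` of the basis of `bsp_*`, shifted by `(0, n)`. -/
def bspDeg (n : ℤ) : BspBasis → ℕ × ℤ
  | .tower₀ i j => (4 * i + j, n + (12 * i + j))
  | .tower₄ i j => (4 * i + 1 + j, n + (12 * i + 5 + j))
  | .eta i => (4 * i + 2, n + (12 * i + 7))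
  | .etaSq i => (4 * i + 3, n + (12 * i + 9))

/-- `bsp_*` is a tower and a shifted copy of `bo_*`. -/
def natSumBoEquiv : ℕ ⊕ BoBasis ≃ BspBasis where
  toFun
    | .inl j => .tower₀ 0 j
    | .inr (.tower₀ i j) => .tower₄ i j
    | .inr (.eta i) => .eta i
    | .inr (.etaSq i) => .etaSq i
    | .inr (.tower₄ i j) => .tower₀ (i + 1) j
  invFun
    | .tower₀ 0 j => .inl j
    | .tower₀ (i + 1) j => .inr (.tower₄ i j)
    | .tower₄ i j => .inr (.tower₀ i j)
    | .eta i => .inr (.eta i)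
    | .etaSq i => .inr (.etaSq i)
  left_inv := by rintro (j | ⟨i, j⟩ | i | i | ⟨i, j⟩) <;> rfl
  right_inv := by rintro (⟨_ | i, j⟩ | ⟨i, j⟩ | i | i) <;> rfl

/-- `bo_*` is a tower, the classes `η` and `η²`, and a shifted copy of `bsp_*`. -/
def natSumBspEquiv : ℕ ⊕ (Unit ⊕ (Unit ⊕ BspBasis)) ≃ BoBasis where
  toFun
    | .inl j => .tower₀ 0 j
    | .inr (.inl _) => .eta 0
    | .inr (.inr (.inl _)) => .etaSq 0
    | .inr (.inr (.inr (.tower₀ i j))) => .tower₄ i j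
    | .inr (.inr (.inr (.tower₄ i j))) => .tower₀ (i + 1) j
    | .inr (.inr (.inr (.eta i))) => .eta (i + 1)
    | .inr (.inr (.inr (.etaSq i))) => .etaSq (i + 1)
  invFun
    | .tower₀ 0 j => .inl j
    | .tower₀ (i + 1) j => .inr (.inr (.inr (.tower₄ i j)))
    | .eta 0 => .inr (.inl ())
    | .eta (i + 1) => .inr (.inr (.inr (.eta i)))
    | .etaSq 0 => .inr (.inr (.inl ()))
    | .etaSq (i + 1) => .inr (.inr (.inr (.etaSq i)))
    | .tower₄ i j => .inr (.inr (.inr (.tower₀ i j)))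
  left_inv := by rintro (j | _ | _ | ⟨i, j⟩ | ⟨i, j⟩ | i | i) <;> rfl
  right_inv := by rintro (⟨_ | i, j⟩ | (_ | i) | (_ | i) | ⟨i, j⟩) <;> rfl

section

variable {n : ℤ} {N : ℕ}

/-- The submodule `A Sq¹ Sq²` of `A` is a suspension of `A/A(Sq¹, Sq² Sq¹ Sq²)`. -/
theorem extInfo_sqThree
    (h : ExtInfo (pres (n + 3) [0] bspRows) (N - 1) (bspDeg (n + 3))
      fun x => (x - (n + 3)) % 4 = 0) :
    ExtInfo (pres n [0] sqThreeRows) N (extDeg (fun _ : Unit => (0, n)) (bspDeg (n + 3)))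
      fun x => (x - n) % 4 = 2 := by
  refine ExtInfo.step_free (D := [0]) (E := [3]) (R := []) (S := bspRows) (φ := sqThreeRows)
    (by decide +kernel) rfl (by decide) (by decide) (extInfo_free n N) (fun _ => ⟨rfl, ?_⟩)
    (pres_single n 3 _ ▸ h) fun x hx => by omega
  intro k hk
  obtain rfl : k = 0 := Nat.lt_one_iff.1 hk
  simp

/-- The submodule `A Sq²` of `A` is a suspension of `A/A Sq¹ Sq²`. -/
theorem extInfo_sqTwo {ι : Type} {d : ι → ℕ × ℤ}
    (h : ExtInfo (pres (n + 2) [0] sqThreeRows) (N - 1) d fun x => (x - (n + 2)) % 4 = 2) :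
    ExtInfo (pres n [0] sqTwoRows) N (extDeg (fun _ : Unit => (0, n)) d)
      fun x => (x - n) % 4 = 3 := by
  refine ExtInfo.step_free (D := [0]) (E := [2]) (R := []) (S := sqThreeRows) (φ := sqTwoRows)
    (by decide +kernel) rfl (by decide) (by decide) (extInfo_free n N) (fun _ => ⟨rfl, ?_⟩)
    (pres_single n 2 _ ▸ h) fun x hx => by omega
  intro k hk
  obtain rfl : k = 0 := Nat.lt_one_iff.1 hk
  simp

/-- The submodule of `A/A Sq¹` generated by `Sq²` is a suspension of `A/A Sq²`. Restriction from
the tower of `A/A Sq¹` vanishes because no stem contains classes of both groups. -/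
theorem extInfo_bo_of_sqTwo (h : ExtInfo (pres (n + 2) [0] sqTwoRows) N
      (extDeg (fun _ : Unit => (0, n + 2)) (extDeg (fun _ : Unit => (0, n + 2 + 2))
        (bspDeg (n + 2 + 2 + 3)))) fun x => (x - (n + 2)) % 4 = 3) :
    ExtInfo (pres n [0] boRows) N (boDeg n) fun x => (x - n) % 4 = 0 := by
  refine ExtInfo.reindex (ExtInfo.step (D := [0]) (E := [2]) (R := sqOneRows) (S := sqTwoRows)
    (φ := sqTwoRows) (by decide +kernel) rfl (by decide) (by decide) (extInfo_sqOne n)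
    (pres_single n 2 _ ▸ h) ?_ fun x hx => ⟨trivial, by omega⟩) natSumBspEquiv ?_
  · rintro i (_ | _ | ⟨j, k⟩ | ⟨j, k⟩ | j | j) h <;>
      simp only [extDeg, bspDeg, Sum.elim_inl, Sum.elim_inr, Prod.mk.injEq] at h <;> omega
  · rintro (i | _ | _ | ⟨j, k⟩ | ⟨j, k⟩ | j | j) <;>
      simp only [natSumBspEquiv, Equiv.coe_fn_mk, boDeg, extDeg, bspDeg, Sum.elim_inl,
        Sum.elim_inr] <;> refine congrArg₂ Prod.mk ?_ ?_ <;> omega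

/-- The submodule of `A/A Sq¹` generated by `Sq² Sq¹ Sq²` is a suspension of `A/A(Sq¹, Sq²)`. -/
theorem extInfo_bsp_of_bo
    (h : ExtInfo (pres (n + 5) [0] boRows) N (boDeg (n + 5)) fun x => (x - (n + 5)) % 4 = 0) :
    ExtInfo (pres n [0] bspRows) N (bspDeg n) fun x => (x - n) % 4 = 0 := by
  refine ExtInfo.reindex (ExtInfo.step (D := [0]) (E := [5]) (R := sqOneRows) (S := boRows)
    (φ := [[(0, [2, 1, 2])]]) (by decide +kernel) rfl (by decide) (by decide) (extInfo_sqOne n)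
    (pres_single n 5 _ ▸ h) ?_ fun x hx => ⟨trivial, by omega⟩) natSumBoEquiv ?_
  · rintro i (⟨j, k⟩ | j | j | ⟨j, k⟩) h <;>
      simp only [boDeg, Prod.mk.injEq] at h <;> omega
  · rintro (i | ⟨j, k⟩ | j | j | ⟨j, k⟩) <;>
      simp only [natSumBoEquiv, Equiv.coe_fn_mk, boDeg, extDeg, bspDeg, Sum.elim_inl,
        Sum.elim_inr] <;> refine congrArg₂ Prod.mk ?_ ?_ <;> omega

end

/-- `Ext` of `A/A(Sq¹, Sq²)` and of `A/A(Sq¹, Sq² Sq¹ Sq²)`, by a common induction: each is a tower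
and a shifted copy of the other, with two more classes in the first case. -/
theorem extInfo_bo_and_bsp (N : ℕ) : ∀ n : ℤ,
    ExtInfo (pres n [0] boRows) N (boDeg n) (fun x => (x - n) % 4 = 0) ∧
      ExtInfo (pres n [0] bspRows) N (bspDeg n) (fun x => (x - n) % 4 = 0) := by
  induction N with
  | zero =>
    exact fun n => ⟨⟨fun s hs => absurd hs s.not_lt_zero, fun s hs => absurd hs s.not_lt_zero⟩,
      ⟨fun s hs => absurd hs s.not_lt_zero, fun s hs => absurd hs s.not_lt_zero⟩⟩
  | succ N ih =>
    have hbo : ∀ n : ℤ, ExtInfo (pres n [0] boRows) (N + 1) (boDeg n) fun x => (x - n) % 4 = 0 :=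
      fun n => extInfo_bo_of_sqTwo (extInfo_sqTwo ((extInfo_sqThree (N := N + 1)
        (ih (n + 2 + 2 + 3)).2).mono (Nat.sub_le _ 1)))
    exact fun n => ⟨hbo n, extInfo_bsp_of_bo (hbo (n + 5))⟩

theorem extInfo_bo (n : ℤ) (N : ℕ) :
    ExtInfo (pres n [0] boRows) N (boDeg n) fun x => (x - n) % 4 = 0 :=
  (extInfo_bo_and_bsp N n).1

theorem extInfo_bsp (n : ℤ) (N : ℕ) :
    ExtInfo (pres n [0] bspRows) N (bspDeg n) fun x => (x - n) % 4 = 0 :=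
  (extInfo_bo_and_bsp N n).2

/-- The basis of `bo_*` without the class in filtration zero of stem zero. -/
def natSumBspEquivNe :
    (ℕ ⊕ Unit) ⊕ (Unit ⊕ BspBasis) ≃ {b : BoBasis // b ≠ .tower₀ 0 0} where
  toFun
    | .inl (.inl j) => ⟨.tower₀ 0 (j + 1), by simp⟩
    | .inl (.inr _) => ⟨.eta 0, by simp⟩
    | .inr (.inl _) => ⟨.etaSq 0, by simp⟩
    | .inr (.inr (.tower₀ i j)) => ⟨.tower₄ i j, by simp⟩
    | .inr (.inr (.tower₄ i j)) => ⟨.tower₀ (i + 1) j, by simp⟩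
    | .inr (.inr (.eta i)) => ⟨.eta (i + 1), by simp⟩
    | .inr (.inr (.etaSq i)) => ⟨.etaSq (i + 1), by simp⟩
  invFun
    | ⟨.tower₀ 0 0, h⟩ => absurd rfl h
    | ⟨.tower₀ 0 (j + 1), _⟩ => .inl (.inl j)
    | ⟨.tower₀ (i + 1) j, _⟩ => .inr (.inr (.tower₄ i j))
    | ⟨.eta 0, _⟩ => .inl (.inr ())
    | ⟨.eta (i + 1), _⟩ => .inr (.inr (.eta i))
    | ⟨.etaSq 0, _⟩ => .inr (.inl ())
    | ⟨.etaSq (i + 1), _⟩ => .inr (.inr (.etaSq i))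
    | ⟨.tower₄ i j, _⟩ => .inr (.inr (.tower₀ i j))
  left_inv := by rintro ((j | _) | _ | ⟨i, j⟩ | ⟨i, j⟩ | i | i) <;> rfl
  right_inv := by
    rintro ⟨⟨_ | i, _ | j⟩ | (_ | i) | (_ | i) | ⟨i, j⟩, h⟩
    · exact absurd rfl h
    all_goals rfl

/-- `Ext` of the module with generators `x` and `y` of degrees `0` and `1` and the relations
`Sq¹ x = 0` and `Sq¹ Sq² x = Sq² y` is that of `A/A(Sq¹, Sq²)` without its class in filtration
zero, up to a shift. -/
theorem extInfo_twoGen (n : ℤ) (N : ℕ) :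
    ExtInfo (pres n [0, 1] twoGenRows) N
      (fun b : {b : BoBasis // b ≠ .tower₀ 0 0} => ((boDeg (n - 1) b).1 - 1, (boDeg (n - 1) b).2))
      fun x => (x - n) % 4 = 0 := by
  have hD : IsDirectSum [0, 1] sqOneRows [0] sqOneRows [1] [] [[(0, [])]] [[(0, [])], []]
      [[], [(0, [])]] [[(1, [])]] := by
    constructor <;> decide
  have hC : ∀ N, ExtInfo (pres n [0, 1] sqOneRows) N _ _ := fun N =>
    hD.extInfo (extInfo_sqOne n N) (pres_single n 1 _ ▸ extInfo_free (n + (1 : ℕ)) N)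
  have hK := extInfo_sqThree (n := n + 3) (N := N) ((extInfo_bsp _ _))
  refine ExtInfo.reindex (ExtInfo.step (D := [0, 1]) (E := [3]) (R := sqOneRows) (S := sqThreeRows)
    (φ := [[(0, [1, 2]), (1, [2])]]) (by decide +kernel) rfl (by decide) (by decide) hC
    (pres_single n 3 _ ▸ hK) ?_ fun x hx => ⟨⟨trivial, ?_⟩, by omega⟩) natSumBspEquivNe ?_
  · rintro (i | _) (_ | ⟨j, k⟩ | ⟨j, k⟩ | j | j) h <;>
      simp only [extDeg, bspDeg, Sum.elim_inl, Sum.elim_inr, Prod.mk.injEq] at h <;> omega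
  · omega
  · rintro ((i | _) | _ | ⟨j, k⟩ | ⟨j, k⟩ | j | j) <;>
      simp only [natSumBspEquivNe, Equiv.coe_fn_mk, boDeg, extDeg, bspDeg, Sum.elim_inl,
        Sum.elim_inr] <;> refine congrArg₂ Prod.mk ?_ ?_ <;> omega

end SteenrodAlgebra

/-! ### The classes of the answer -/

namespace SteenrodAlgebra

/-- The basis of the answer, by the module of the resolution that contributes the class: `free m r`
is `v₂^{8m}` times the `r`th generator of the first summand, `bo k b` is `v₂^{4k} a_{5,1} b`,
`boOdd m b` and `boEven m b` are `v₂^{8m+4} a_{21,3} b` and `v₂^{8m} a_{21,3} b`, and `bsp k b` and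
`bsp' k b` are `v₂^{4k} a_{9,2} b` and `v₂^{4k} a_{17,4} b`. -/
inductive Class
  | free (m : ℕ) (r : Fin 8)
  | bo (k : ℕ) (b : BoBasis)
  | boOdd (m : ℕ) (b : BoBasis)
  | boEven (m : ℕ) (b : {b : BoBasis // b ≠ .tower₀ 0 0})
  | bsp (k : ℕ) (b : BspBasis)
  | bsp' (k : ℕ) (b : BspBasis)

/-- The levels of the generators of the first summand. -/
def freeLevel : Fin 8 → ℕ
  | 0 => 0 | 1 => 1 | 2 => 2 | 3 => 3 | 4 => 3 | 5 => 5 | 6 => 6 | 7 => 7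

/-- The internal degrees of the generators of the first summand. -/
def freeDegree : Fin 8 → ℤ
  | 0 => 0 | 1 => 4 | 2 => 16 | 3 => 18 | 4 => 20 | 5 => 36 | 6 => 40 | 7 => 46

/-- The position in the resolution of the module that contributes the class. -/
def Class.level : Class → ℕ
  | free m r => 8 * m + freeLevel r
  | bo k _ => 4 * k + 1
  | boOdd m _ => 8 * m + 7
  | boEven m _ => 8 * m + 4
  | bsp k _ => 4 * k + 2
  | bsp' k _ => 4 * k + 4

/-- The degree `(s, t)` of a class in `Ext` of the module that contributes it. -/
def Class.deg : Class → ℕ × ℤ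
  | free m r => (0, 56 * m + freeDegree r)
  | bo k b => boDeg (28 * k + 6) b
  | boOdd m b => boDeg (56 * m + 52) b
  | boEven m b => ((boDeg (56 * m + 24) b).1 - 1, (boDeg (56 * m + 24) b).2)
  | bsp k b => bspDeg (28 * k + 11) b
  | bsp' k b => bspDeg (28 * k + 21) b

/-- The stem of a class. -/
def Class.stem (x : Class) : ℤ := x.deg.2 - (x.level + x.deg.1)

/-- The stems of the generators of the first summand modulo `8`. -/
def freeResidue : Fin 8 → ℤ
  | 0 => 0 | 1 => 3 | 2 => 6 | 3 => 7 | 4 => 1 | 5 => 7 | 6 => 2 | 7 => 7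

/-- The stem of a class modulo `8`. -/
def Class.residue : Class → ℤ
  | free _ r => freeResidue r
  | bo _ b | boOdd _ b | boEven _ ⟨b, _⟩ =>
    match b with
    | .tower₀ _ _ => 5
    | .eta _ => 6
    | .etaSq _ => 7
    | .tower₄ _ _ => 1
  | bsp _ b | bsp' _ b =>
    match b with
    | .tower₀ _ _ => 1
    | .tower₄ _ _ => 5
    | .eta _ => 6
    | .etaSq _ => 7

/-- The periodicities of the families preserve the stem modulo `8`. -/
theorem Class.stem_emod (x : Class) : x.stem % 8 = x.residue := by
  unfold Class.stem
  rcases x with ⟨m, r⟩ | ⟨m, ⟨i, j⟩ | i | i | ⟨i, j⟩⟩ | ⟨m, ⟨i, j⟩ | i | i | ⟨i, j⟩⟩ |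
    ⟨m, ⟨⟨_ | i, _ | j⟩ | i | i | ⟨i, j⟩, hb⟩⟩ | ⟨m, ⟨i, j⟩ | ⟨i, j⟩ | i | i⟩ |
    ⟨m, ⟨i, j⟩ | ⟨i, j⟩ | i | i⟩
  all_goals try fin_cases r
  all_goals try exact absurd rfl hb
  all_goals
    simp only [Class.level, Class.deg, boDeg, bspDeg, freeLevel, freeDegree, Class.residue,
      freeResidue]
  all_goals omega

/-- Classes of adjacent bidegrees on different levels lie in the stems `6` and `5` modulo `8`, with
one exception. -/
theorem Class.residue_eq_of_lt {x y : Class} (hl : x.level < y.level)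
    (hs : x.level + x.deg.1 + 1 = y.level + y.deg.1) (ht : x.deg.2 = y.deg.2)
    (hx : ∀ m i, x ≠ boOdd m (.etaSq i)) : x.residue = 6 := by
  have hr : (y.residue + 1) % 8 = x.residue := by
    rw [← x.stem_emod, ← y.stem_emod, Class.stem, Class.stem]
    omega
  rcases x with ⟨m, r⟩ | ⟨m, ⟨i, j⟩ | i | i | ⟨i, j⟩⟩ | ⟨m, ⟨i, j⟩ | i | i | ⟨i, j⟩⟩ |
    ⟨m, ⟨⟨_ | i, _ | j⟩ | i | i | ⟨i, j⟩, hb⟩⟩ | ⟨m, ⟨i, j⟩ | ⟨i, j⟩ | i | i⟩ |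
    ⟨m, ⟨i, j⟩ | ⟨i, j⟩ | i | i⟩
  all_goals try fin_cases r
  all_goals first | rfl | exact absurd rfl hb | exact absurd rfl (hx _ _) | clear hx
  all_goals
    rcases y with ⟨n, r'⟩ | ⟨n, ⟨k, l⟩ | k | k | ⟨k, l⟩⟩ | ⟨n, ⟨k, l⟩ | k | k | ⟨k, l⟩⟩ |
      ⟨n, ⟨⟨_ | k, _ | l⟩ | k | k | ⟨k, l⟩, hb'⟩⟩ | ⟨n, ⟨k, l⟩ | ⟨k, l⟩ | k | k⟩ |
      ⟨n, ⟨k, l⟩ | ⟨k, l⟩ | k | k⟩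
  all_goals try fin_cases r'
  all_goals first
    | exact absurd hr (by simp only [Class.residue]; decide)
    | exact absurd rfl hb'
    | simp only [Class.level, Class.deg, boDeg, bspDeg, freeLevel, freeDegree] at hl hs ht
      omega

/-- A class of a stem congruent to `6` modulo `8` is not a multiple of `h₀`. -/
theorem Class.not_of_residue {x z : Class} (hx : x.residue = 6) (hl : z.level = x.level)
    (hs : z.deg.1 = x.deg.1 + 1) (ht : z.deg.2 = x.deg.2 + 1) : False := by
  have hr : z.residue = 6 := by
    rw [← hx, ← x.stem_emod, ← z.stem_emod, Class.stem, Class.stem]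
    omega
  rcases x with ⟨m, r⟩ | ⟨m, ⟨i, j⟩ | i | i | ⟨i, j⟩⟩ | ⟨m, ⟨i, j⟩ | i | i | ⟨i, j⟩⟩ |
    ⟨m, ⟨⟨_ | i, _ | j⟩ | i | i | ⟨i, j⟩, hb⟩⟩ | ⟨m, ⟨i, j⟩ | ⟨i, j⟩ | i | i⟩ |
    ⟨m, ⟨i, j⟩ | ⟨i, j⟩ | i | i⟩
  all_goals try fin_cases r
  all_goals first
    | exact absurd hx (by simp only [Class.residue]; decide)
    | rcases z with ⟨n, r'⟩ | ⟨n, ⟨k, l⟩ | k | k | ⟨k, l⟩⟩ | ⟨n, ⟨k, l⟩ | k | k | ⟨k, l⟩⟩ |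
        ⟨n, ⟨⟨_ | k, _ | l⟩ | k | k | ⟨k, l⟩, hb'⟩⟩ | ⟨n, ⟨k, l⟩ | ⟨k, l⟩ | k | k⟩ |
        ⟨n, ⟨k, l⟩ | ⟨k, l⟩ | k | k⟩
  all_goals try fin_cases r'
  all_goals first
    | exact absurd hr (by simp only [Class.residue]; decide)
    | exact absurd rfl hb'
    | simp only [Class.level, Class.deg, boDeg, bspDeg, freeLevel, freeDegree] at hl hs ht
      omega

end SteenrodAlgebra

/-! ### The resolution -/

namespace SteenrodAlgebra

/-- The degrees of the generators of the `i`th module of the resolution. -/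
def resGens : ℕ → List ℕ
  | 1 => [4, 6]
  | 2 => [11, 16]
  | 3 => [18, 20]
  | 4 => [21, 25, 26]
  | 5 => [34, 36]
  | 6 => [39, 40]
  | 7 => [46, 52]
  | 8 => [49, 56]
  | 9 => [60, 62]
  | _ => [0]

/-- The relations of the `i`th module of the resolution. -/
def resMid : ℕ → List Row
  | 1 => [[(1, [1])], [(1, [2])]]
  | 2 => [[(0, [1])], [(0, [2, 1, 2])]]
  | 4 => [[(0, [1])], [(0, [2, 1, 2])], [(1, [1])], [(1, [1, 2]), (2, [2])]]
  | 5 => [[(0, [1])], [(0, [2])]]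
  | 6 => [[(0, [1])], [(0, [2, 1, 2])]]
  | 7 => [[(1, [1])], [(1, [2])]]
  | 8 => [[(0, [1])], [(0, [2, 1, 2])]]
  | 9 => [[(1, [1])], [(1, [2])]]
  | _ => []

/-- The images of the generators of the `i`th module of the resolution in the module before it. -/
def resMap : ℕ → List Row
  | 1 => [[(0, [4])], [(0, [1, 2, 1, 2])]]
  | 2 => [[(0, [1, 2, 4])],
      [(0, [1, 2, 1, 2, 4, 2]), (0, [2, 1, 2, 4, 2, 1]), (0, [2, 4, 2, 4]), (1, [4, 2, 4])]]
  | 3 => [[(0, [1, 2, 4]), (1, [2])], [(0, [2, 1, 4, 2]), (1, [4])]]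
  | 4 => [[(0, [1, 2])], [(0, [1, 2, 4]), (1, [1, 4])],
      [(0, [1, 2, 1, 4]), (1, [1, 2, 1, 2]), (1, [2, 4])]]
  | 5 => [[(0, [2, 1, 4, 2, 4]), (0, [4, 2, 1, 4, 2]), (1, [2, 1, 2, 4])],
      [(0, [2, 1, 2, 4, 2, 4]), (1, [1, 4, 2, 4]), (1, [2, 1, 2, 4, 2]), (2, [4, 2, 4])]]
  | 6 => [[(1, [1, 2])], [(0, [2, 4]), (1, [4])]]
  | 7 => [[(0, [1, 2, 4]), (1, [1, 2, 1, 2]), (1, [2, 4])],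
      [(0, [2, 1, 4, 2, 4]), (0, [4, 2, 1, 4, 2]), (1, [1, 2, 1, 2, 4, 2])]]
  | 8 => [[(0, [1, 2])], [(0, [2, 1, 4, 2, 1]), (0, [4, 2, 4]), (1, [4])]]
  | 9 => [[(0, [1, 4, 2, 4]), (1, [4])],
      [(0, [2, 1, 4, 2, 4]), (0, [4, 2, 1, 4, 2]), (1, [1, 2, 1, 2])]]
  | 10 => [[(0, [1, 2, 4])],
      [(0, [1, 2, 1, 2, 4, 2]), (0, [2, 1, 2, 4, 2, 1]), (0, [2, 4, 2, 4]), (1, [4, 2, 4])]]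
  | _ => []

/-- The kernel of the map from the `i+1`st to the `i`th module is the image of the next map. -/
theorem checkExact_res : ∀ i < 9, checkExact (resGens i).length (resMap (i + 1)) (resMid i)
    (resMid (i + 1) ++ resMap (i + 2)) = true := by
  decide +kernel

theorem length_resMap : ∀ i < 9, (resMap (i + 1)).length = (resGens (i + 1)).length := by
  decide

theorem rowsHomogeneous_resMid : ∀ i < 9, RowsHomogeneous (resGens i) (resMid i) := by
  decide

theorem rowsHaveDeg_resMap : ∀ i < 9,
    RowsHaveDeg (resGens i) (resGens (i + 1)) (resMap (i + 1)) := by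
  decide

/-- The `n`-fold suspension of the cokernel of the map from the `i+1`st to the `i`th module of the
resolution. -/
noncomputable def coker (n : ℤ) (i : ℕ) : GradedModuleCat grading :=
  pres n (resGens i) (resMid i ++ resMap (i + 1))

/-- The resolution is periodic of period `8`, up to the suspension by `56`. -/
theorem coker_nine (n : ℤ) : coker n 9 = coker (n + 56) 1 := by
  refine pres_congr (D := [60, 62]) (E := [4, 6]) _ rfl fun i hi => ?_
  change i < 2 at hi
  interval_cases i <;> simp [add_assoc]

/-- The submodule of `A/A(Sq¹, Sq²)` generated by `Sq⁴` has the relations `Sq⁴ = Sq¹ = 0`, of which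
`Sq¹ Sq² Sq¹ Sq² = 0` is a consequence. -/
theorem exists_hom_sqFour (n : ℤ) :
    ∃ f : pres n [56] [[(0, [4])], [(0, [1, 2, 1, 2])], [(0, [1])]] ⟶ pres n [52] boRows,
      ActsBy f [[(0, [4])]] := by
  obtain ⟨f, p, w, hS, hf⟩ := exists_shortExact_pres n (D := [52]) (E := [56])
    (φ := [[(0, [4])]]) (R := boRows) (S := [[(0, [4])], [(0, [1, 2, 1, 2])], [(0, [1])]])
    (by decide +kernel) rfl (by decide) (by decide)
  exact ⟨f, hf⟩

/-- The map from the eighth module to the second summand of the seventh factors through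
`A/A(Sq⁴, Sq⁵ Sq¹)`. -/
theorem exists_factorization {n : ℤ} {i r s : List Row} (h : IsDirectSum (resGens 7) (resMid 7)
      [46] [] [52] boRows i r [[], [(0, [])]] s)
    {f : coker n 8 ⟶ pres n (resGens 7) (resMid 7)} (hf : ActsBy f (resMap 8)) :
    ∃ (q : coker n 8 ⟶ pres n [56] (resMap 1)) (u : pres n [56] (resMap 1) ⟶ pres n [52] boRows),
      f ≫ presHom n h.snd = q ≫ u := by
  obtain ⟨u, hu⟩ := exists_hom_sqFour n
  have hq : IsPresHom [56] (resMap 1) (resGens 8) (resMid 8 ++ resMap 9) [[], [(0, [])]] := by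
    decide
  have hj : IsPresHom [56] [[(0, [4])], [(0, [1, 2, 1, 2])], [(0, [1])]] [56] (resMap 1)
    [[(0, [])]] := by decide
  refine ⟨presHom n hq, presHom n hj ≫ u, ?_⟩
  have h1 := hf.comp (actsBy_presHom n h.snd) (by decide)
  have h2 := (actsBy_presHom n hq).comp ((actsBy_presHom n hj).comp hu (by decide)) (by decide)
  exact h1.ext (by exact h2)

end SteenrodAlgebra

/-! ### Ext of the modules of the resolution -/

namespace SteenrodAlgebra

/-- The degrees in `Ext` of the `i`th module of the resolution. -/
def levelDeg (i : ℕ) (x : {x : Class // x.level = i}) : ℕ × ℤ := x.1.deg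

/-- The degrees in `Ext` of the `i`th cokernel of the resolution. -/
def cokerDeg (i : ℕ) (x : {x : Class // i ≤ x.level}) : ℕ × ℤ :=
  (x.1.level - i + x.1.deg.1, x.1.deg.2)

/-- A class of level at least `i` has level `i` or at least `i + 1`. -/
def levelSumEquiv (i : ℕ) :
    {x : Class // x.level = i} ⊕ {x : Class // i + 1 ≤ x.level} ≃ {x : Class // i ≤ x.level} where
  toFun := Sum.elim (fun x => ⟨x.1, x.2.ge⟩) fun x => ⟨x.1, (Nat.le_succ i).trans x.2⟩
  invFun x := if h : x.1.level = i then .inl ⟨x.1, h⟩ else .inr ⟨x.1, by have := x.2; omega⟩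
  left_inv := by
    rintro (⟨x, h⟩ | ⟨x, h⟩)
    · exact dif_pos h
    · exact dif_neg (show x.level ≠ i by omega)
  right_inv x := by
    dsimp only
    split_ifs <;> rfl

theorem cokerDeg_levelSumEquiv (i : ℕ) (x) :
    cokerDeg i (levelSumEquiv i x) = extDeg (levelDeg i) (cokerDeg (i + 1)) x := by
  rcases x with ⟨x, h⟩ | ⟨x, h⟩
  · refine Prod.ext ?_ rfl
    change x.level - i + x.deg.1 = x.deg.1
    omega
  · refine Prod.ext ?_ rfl
    change x.level - i + x.deg.1 = x.level - (i + 1) + x.deg.1 + 1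
    omega

/-- A basis that consists of two families of classes, which together are the classes of level
`i`. -/
theorem ExtInfo.level {X : GradedModuleCat grading} {N i : ℕ} {ι κ : Type} {d : ι → ℕ × ℤ}
    {d' : κ → ℕ × ℤ} {q : ℤ → Prop} (h : ExtInfo X N (Sum.elim d d') q) (f : ι → Class)
    (g : κ → Class) (hf : Function.Injective f) (hg : Function.Injective g)
    (hfg : ∀ a b, f a ≠ g b) (hl : ∀ x : Class, x.level = i ↔ (∃ a, f a = x) ∨ ∃ b, g b = x)
    (hd : ∀ a, (f a).deg = d a) (hd' : ∀ b, (g b).deg = d' b) {q' : ℤ → Prop}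
    (hq : ∀ x, q' x → q x) : ExtInfo X N (levelDeg i) q' := by
  let F : ι ⊕ κ → {x : Class // x.level = i} := Sum.elim
    (fun a => ⟨f a, (hl _).2 (.inl ⟨a, rfl⟩)⟩) fun b => ⟨g b, (hl _).2 (.inr ⟨b, rfl⟩)⟩
  have hF : Function.Bijective F := by
    constructor
    · rintro (a | b) (a' | b') h
      · exact congrArg _ (hf (congrArg Subtype.val h))
      · exact absurd (congrArg Subtype.val h) (hfg a b')
      · exact absurd (congrArg Subtype.val h).symm (hfg a' b)
      · exact congrArg _ (hg (congrArg Subtype.val h))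
    · rintro ⟨x, hx⟩
      rcases (hl x).1 hx with ⟨a, rfl⟩ | ⟨b, rfl⟩
      · exact ⟨.inl a, rfl⟩
      · exact ⟨.inr b, rfl⟩
  refine (h.reindex (Equiv.ofBijective F hF) ?_).imp hq
  rintro (a | b)
  · exact hd a
  · exact hd' b

/-! ### Splittings of the modules of the resolution -/

theorem isDirectSum_one : IsDirectSum (resGens 1) (resMid 1) [4] [] [6] boRows
    [[(0, [])]] [[(0, [])], []] [[], [(0, [])]] [[(1, [])]] := by
  constructor <;> decide

theorem isDirectSum_two : IsDirectSum (resGens 2) (resMid 2) [11] bspRows [16] []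
    [[(0, [])]] [[(0, [])], []] [[], [(0, [])]] [[(1, [])]] := by
  constructor <;> decide

theorem isDirectSum_three : IsDirectSum (resGens 3) (resMid 3) [18] [] [20] []
    [[(0, [])]] [[(0, [])], []] [[], [(0, [])]] [[(1, [])]] := by
  constructor <;> decide

theorem isDirectSum_four : IsDirectSum (resGens 4) (resMid 4) [21] bspRows [25, 26] twoGenRows
    [[(0, [])]] [[(0, [])], [], []] [[], [(0, [])], [(1, [])]] [[(1, [])], [(2, [])]] := by
  constructor <;> decide

theorem isDirectSum_five : IsDirectSum (resGens 5) (resMid 5) [34] boRows [36] []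
    [[(0, [])]] [[(0, [])], []] [[], [(0, [])]] [[(1, [])]] := by
  constructor <;> decide

theorem isDirectSum_six : IsDirectSum (resGens 6) (resMid 6) [39] bspRows [40] []
    [[(0, [])]] [[(0, [])], []] [[], [(0, [])]] [[(1, [])]] := by
  constructor <;> decide

theorem isDirectSum_seven : IsDirectSum (resGens 7) (resMid 7) [46] [] [52] boRows
    [[(0, [])]] [[(0, [])], []] [[], [(0, [])]] [[(1, [])]] := by
  constructor <;> decide

theorem isDirectSum_eight : IsDirectSum (resGens 8) (resMid 8) [49] bspRows [56] []
    [[(0, [])]] [[(0, [])], []] [[], [(0, [])]] [[(1, [])]] := by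
  constructor <;> decide

section

variable (n : ℤ) (d : ℕ) (N : ℕ)

theorem extInfo_free_single : ExtInfo (pres n [d] []) N (fun _ : Unit => (0, n + d))
    fun x => x ≠ n + d :=
  pres_single n d _ ▸ extInfo_free (n + d) N

theorem extInfo_bo_single :
    ExtInfo (pres n [d] boRows) N (boDeg (n + d)) fun x => (x - (n + d)) % 4 = 0 :=
  pres_single n d _ ▸ extInfo_bo (n + d) N

theorem extInfo_bsp_single :
    ExtInfo (pres n [d] bspRows) N (bspDeg (n + d)) fun x => (x - (n + d)) % 4 = 0 :=
  pres_single n d _ ▸ extInfo_bsp (n + d) N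

end

theorem unit_injective {α : Type} (f : Unit → α) : Function.Injective f :=
  fun _ _ _ => rfl

theorem extInfo_twoGen_pair (n : ℤ) (N : ℕ) : ExtInfo (pres n [25, 26] twoGenRows) N
    (fun b : {b : BoBasis // b ≠ .tower₀ 0 0} => ((boDeg (n + 24) b).1 - 1, (boDeg (n + 24) b).2))
      fun x => (x - (n + 25)) % 4 = 0 := by
  have e : pres n [25, 26] twoGenRows = pres (n + 25) [0, 1] twoGenRows :=
    pres_congr _ rfl fun i hi => by
      change i < 2 at hi
      interval_cases i <;> simp [add_assoc]
  have h := extInfo_twoGen (n + 25) N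
  rwa [← e, show n + 25 - 1 = n + 24 by ring] at h

/-! ### The classes contributed by each module -/

theorem extInfo_mid_one (m N : ℕ) :
    ExtInfo (pres (56 * m : ℕ) (resGens 1) (resMid 1)) N (levelDeg (8 * m + 1))
      fun x => (x - (8 * m + 1 : ℕ)) % 8 = 5 := by
  refine (isDirectSum_one.extInfo (extInfo_free_single _ 4 N) (extInfo_bo_single _ 6 N)).level
    (fun _ => .free m 1) (fun b => .bo (2 * m) b) (unit_injective _) (fun b b' h => by cases h; rfl)
    (fun a b => Class.noConfusion) ?_ ?_ ?_ fun x hx => ?_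
  · rintro (⟨m', r⟩ | _ | _ | _ | _ | _)
    · fin_cases r <;> simp [Class.level, freeLevel] <;> omega
    all_goals simp [Class.level]; try omega
  · intro _
    refine congrArg (Prod.mk 0) ?_
    simp only [freeDegree]
    push_cast
    ring
  · intro b
    simp only [Class.deg]
    congr 1
    push_cast
    ring
  · constructor <;> push_cast <;> first | trivial | omega

theorem extInfo_mid_two (m N : ℕ) :
    ExtInfo (pres (56 * m : ℕ) (resGens 2) (resMid 2)) N (levelDeg (8 * m + 2))
      fun x => (x - (8 * m + 2 : ℕ)) % 8 = 5 := by
  refine (isDirectSum_two.extInfo (extInfo_bsp_single _ 11 N) (extInfo_free_single _ 16 N)).level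
    (fun b => .bsp (2 * m) b) (fun _ => .free m 2) (fun b b' h => by cases h; rfl)
    (unit_injective _) (fun a b => Class.noConfusion) ?_ ?_ ?_ fun x hx => ?_
  · rintro (⟨m', r⟩ | _ | _ | _ | _ | _)
    · fin_cases r <;> simp [Class.level, freeLevel] <;> omega
    all_goals simp [Class.level]; try omega
  · intro b
    simp only [Class.deg]
    congr 1
    push_cast
    ring
  · intro _
    refine congrArg (Prod.mk 0) ?_
    simp only [freeDegree]
    push_cast
    ring
  · constructor <;> push_cast <;> first | trivial | omega

theorem extInfo_mid_three (m N : ℕ) :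
    ExtInfo (pres (56 * m : ℕ) (resGens 3) (resMid 3)) N (levelDeg (8 * m + 3))
      fun x => (x - (8 * m + 3 : ℕ)) % 8 = 5 := by
  refine (isDirectSum_three.extInfo (extInfo_free_single _ 18 N) (extInfo_free_single _ 20 N)).level
    (fun _ => .free m 3) (fun _ => .free m 4) (unit_injective _) (unit_injective _)
    (fun a b h => by cases h) ?_ ?_ ?_ fun x hx => ?_
  · rintro (⟨m', r⟩ | _ | _ | _ | _ | _)
    · fin_cases r <;> simp [Class.level, freeLevel] <;> omega
    all_goals simp [Class.level]; try omega
  · intro _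
    refine congrArg (Prod.mk 0) ?_
    simp only [freeDegree]
    push_cast
    ring
  · intro _
    refine congrArg (Prod.mk 0) ?_
    simp only [freeDegree]
    push_cast
    ring
  · constructor <;> push_cast <;> first | trivial | omega

theorem extInfo_mid_four (m N : ℕ) :
    ExtInfo (pres (56 * m : ℕ) (resGens 4) (resMid 4)) N (levelDeg (8 * m + 4))
      fun x => (x - (8 * m + 4 : ℕ)) % 8 = 5 := by
  refine (isDirectSum_four.extInfo (extInfo_bsp_single _ 21 N) (extInfo_twoGen_pair _ N)).level
    (fun b => .bsp' (2 * m) b) (fun b => .boEven m b) (fun b b' h => by cases h; rfl)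
    (fun b b' h => by cases h; rfl)
    (fun a b => Class.noConfusion) ?_ ?_ ?_ fun x hx => ?_
  · rintro (⟨m', r⟩ | _ | _ | _ | _ | _)
    · fin_cases r <;> simp [Class.level, freeLevel] <;> omega
    all_goals simp [Class.level]; try omega
  · intro b
    simp only [Class.deg]
    congr 1
    push_cast
    ring
  · intro b
    simp only [Class.deg]
    push_cast
    rfl
  · constructor <;> push_cast <;> first | trivial | omega

theorem extInfo_mid_five (m N : ℕ) :
    ExtInfo (pres (56 * m : ℕ) (resGens 5) (resMid 5)) N (levelDeg (8 * m + 5))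
      fun x => (x - (8 * m + 5 : ℕ)) % 8 = 5 := by
  refine (isDirectSum_five.extInfo (extInfo_bo_single _ 34 N) (extInfo_free_single _ 36 N)).level
    (fun b => .bo (2 * m + 1) b) (fun _ => .free m 5) (fun b b' h => by cases h; rfl)
    (unit_injective _) (fun a b => Class.noConfusion) ?_ ?_ ?_ fun x hx => ?_
  · rintro (⟨m', r⟩ | _ | _ | _ | _ | _)
    · fin_cases r <;> simp [Class.level, freeLevel] <;> omega
    all_goals simp [Class.level]; try omega
  · intro b
    simp only [Class.deg]
    congr 1
    push_cast
    ring
  · intro _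
    refine congrArg (Prod.mk 0) ?_
    simp only [freeDegree]
    push_cast
    ring
  · constructor <;> push_cast <;> first | trivial | omega

theorem extInfo_mid_six (m N : ℕ) :
    ExtInfo (pres (56 * m : ℕ) (resGens 6) (resMid 6)) N (levelDeg (8 * m + 6))
      fun x => (x - (8 * m + 6 : ℕ)) % 8 = 5 := by
  refine (isDirectSum_six.extInfo (extInfo_bsp_single _ 39 N) (extInfo_free_single _ 40 N)).level
    (fun b => .bsp (2 * m + 1) b) (fun _ => .free m 6) (fun b b' h => by cases h; rfl)
    (unit_injective _) (fun a b => Class.noConfusion) ?_ ?_ ?_ fun x hx => ?_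
  · rintro (⟨m', r⟩ | _ | _ | _ | _ | _)
    · fin_cases r <;> simp [Class.level, freeLevel] <;> omega
    all_goals simp [Class.level]; try omega
  · intro b
    simp only [Class.deg]
    congr 1
    push_cast
    ring
  · intro _
    refine congrArg (Prod.mk 0) ?_
    simp only [freeDegree]
    push_cast
    ring
  · constructor <;> push_cast <;> first | trivial | omega

theorem extInfo_mid_seven (m N : ℕ) :
    ExtInfo (pres (56 * m : ℕ) (resGens 7) (resMid 7)) N (levelDeg (8 * m + 7))
      fun x => (x - (8 * m + 7 : ℕ)) % 8 = 5 := by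
  refine (isDirectSum_seven.extInfo (extInfo_free_single _ 46 N) (extInfo_bo_single _ 52 N)).level
    (fun _ => .free m 7) (fun b => .boOdd m b) (unit_injective _) (fun b b' h => by cases h; rfl)
    (fun a b => Class.noConfusion) ?_ ?_ ?_ fun x hx => ?_
  · rintro (⟨m', r⟩ | _ | _ | _ | _ | _)
    · fin_cases r <;> simp [Class.level, freeLevel] <;> omega
    all_goals simp [Class.level]; try omega
  · intro _
    refine congrArg (Prod.mk 0) ?_
    simp only [freeDegree]
    push_cast
    ring
  · intro b
    simp only [Class.deg]
    push_cast
    rfl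
  · constructor <;> push_cast <;> first | trivial | omega

theorem extInfo_mid_eight (m N : ℕ) :
    ExtInfo (pres (56 * m : ℕ) (resGens 8) (resMid 8)) N (levelDeg (8 * m + 8))
      fun x => (x - (8 * m + 8 : ℕ)) % 8 = 5 := by
  refine (isDirectSum_eight.extInfo (extInfo_bsp_single _ 49 N) (extInfo_free_single _ 56 N)).level
    (fun b => .bsp' (2 * m + 1) b) (fun _ => .free (m + 1) 0) (fun b b' h => by cases h; rfl)
    (unit_injective _) (fun a b => Class.noConfusion) ?_ ?_ ?_ fun x hx => ?_
  · rintro (⟨m', r⟩ | _ | _ | _ | _ | _)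
    · fin_cases r <;> simp [Class.level, freeLevel] <;> omega
    all_goals simp [Class.level]; try omega
  · intro b
    simp only [Class.deg]
    congr 1
    push_cast
    ring
  · intro _
    refine congrArg (Prod.mk 0) ?_
    simp only [freeDegree]
    push_cast
    ring
  · constructor <;> push_cast <;> first | trivial | omega

end SteenrodAlgebra

/-! ### Ext of the cokernels of the resolution -/

namespace SteenrodAlgebra

/-- The claim on `Ext^s` of the `i`th cokernel and its suspensions by multiples of `56`, for
`s < N`. A class of stem `t - s` in this group has the stem `t - s - (8 m + i)` in the answer, and
multiplication by `h₀` is claimed to be injective where the latter is `5` modulo `8`. -/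
def CokerInfo (i N : ℕ) : Prop :=
  ∀ m : ℕ, ExtInfo (coker (56 * m : ℕ) i) N (cokerDeg (8 * m + i))
    fun x => (x - (8 * m + i : ℕ)) % 8 = 5

theorem CokerInfo.nine {N : ℕ} (h : CokerInfo 1 N) : CokerInfo 9 N := by
  intro m
  have := h (m + 1)
  rw [coker_nine, show ((56 * m : ℕ) : ℤ) + 56 = (56 * (m + 1) : ℕ) by push_cast; ring]
  exact this

/-- `Ext` of `A/A(Sq⁴, Sq⁵ Sq¹)`, suspended by `56 (m + 1)`, is zero in the bidegrees of the classes
`v₂^{8m+4} a_{21,3} η²`. -/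
theorem Class.not_of_etaSq {z : Class} {m j : ℕ} (hl : 8 * m + 9 ≤ z.level)
    (hs : z.level + z.deg.1 = 8 * m + 4 * j + 10) (ht : z.deg.2 = 56 * m + 12 * j + 56) :
    False := by
  have hr : z.residue = 6 := by
    rw [← z.stem_emod, Class.stem]
    omega
  rcases z with ⟨n, r'⟩ | ⟨n, ⟨k, l⟩ | k | k | ⟨k, l⟩⟩ | ⟨n, ⟨k, l⟩ | k | k | ⟨k, l⟩⟩ |
    ⟨n, ⟨⟨_ | k, _ | l⟩ | k | k | ⟨k, l⟩, hb'⟩⟩ | ⟨n, ⟨k, l⟩ | ⟨k, l⟩ | k | k⟩ |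
    ⟨n, ⟨k, l⟩ | ⟨k, l⟩ | k | k⟩
  all_goals try fin_cases r'
  all_goals first
    | exact absurd hr (by simp only [Class.residue]; decide)
    | exact absurd rfl hb'
    | simp only [Class.level, Class.deg, boDeg, bspDeg, freeLevel, freeDegree] at hl hs ht
      omega

/-- Restriction to the next cokernel is zero in all bidegrees, except possibly those of the classes
`η²` in the seventh module of a period. -/
theorem restrictsToZero_of_level {i : ℕ} {S : ShortComplex (GradedModuleCat grading)} {N : ℕ}
    {q : ℤ → Prop} (h₂ : ∀ N, ExtInfo S.X₂ N (levelDeg i) q)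
    (h₁ : ExtInfo S.X₁ N (cokerDeg (i + 1)) fun x => (x - (i + 1 : ℕ)) % 8 = 5) {s : ℕ}
    (hs : s < N) {t : ℤ} (h : ∀ x : {x : Class // x.level = i}, levelDeg i x = (s, t) →
      ∀ m j, x.1 ≠ .boOdd m (.etaSq j)) : RestrictsToZero.{1} shiftedTrivialModule S s t := by
  refine ExtInfo.restrictsToZero h₂ h₁ hs fun x hx => ?_
  rw [or_iff_not_imp_left]
  intro hk
  obtain ⟨⟨y, hy⟩, hk⟩ := not_forall_not.1 hk
  have h1 := h x hx
  obtain ⟨x, rfl⟩ := x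
  have hs' : x.deg.1 = s := congrArg Prod.fst hx
  have ht' : x.deg.2 = t := congrArg Prod.snd hx
  have hs'' : y.level - (x.level + 1) + y.deg.1 = s := congrArg Prod.fst hk
  have ht'' : y.deg.2 = t := congrArg Prod.snd hk
  have hr := Class.residue_eq_of_lt (x := x) (y := y) (by omega) (by omega) (by omega) h1
  have hst := x.stem_emod
  rw [hr, Class.stem, hs', ht'] at hst
  refine ⟨by push_cast; omega, fun z hz => ?_⟩
  have hz1 : z.1.deg.1 = s + 1 := congrArg Prod.fst hz
  have hz2 : z.1.deg.2 = t + 1 := congrArg Prod.snd hz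
  exact Class.not_of_residue hr z.2 (by omega) (by omega)

section

variable {i N : ℕ}

/-- Except for the modules `0` and `7`, the enumeration of bidegrees shows that restriction
vanishes. -/
theorem CokerInfo.step (hi : i < 9)
    (h₂ : ∀ m N, ExtInfo (pres (56 * m : ℕ) (resGens i) (resMid i)) N (levelDeg (8 * m + i))
      fun x => (x - (8 * m + i : ℕ)) % 8 = 5)
    (h₁ : CokerInfo (i + 1) N) (h7 : i ≠ 7) (hi' : i ≠ 0) : CokerInfo i N := by
  intro m
  obtain ⟨f, p, w, hS, -⟩ := exists_shortExact_pres (56 * m : ℕ) (checkExact_res i hi)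
    (length_resMap i hi) (rowsHomogeneous_resMid i hi) (rowsHaveDeg_resMap i hi)
  refine (ExtInfo.of_shortExact hS (h₂ m N) ((h₁ m).mono (Nat.sub_le N 1)) (fun s hs t => ?_)
    fun x hx => ⟨hx, by push_cast at hx ⊢; omega⟩).reindex (levelSumEquiv _)
    (cokerDeg_levelSumEquiv _)
  refine restrictsToZero_of_level (S := ShortComplex.mk f p w) (h₂ m) (h₁ m) hs ?_
  rintro ⟨x, hx⟩ - m' j rfl
  simp only [Class.level] at hx
  omega

/-- The third module is free, and `K₄` has no generators in the degrees of its generators, so that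
restriction vanishes without a hypothesis on `Ext^N` of `K₄`. This is what gains a filtration in the
induction. -/
theorem CokerInfo.three (h₁ : CokerInfo 4 N) : CokerInfo 3 (N + 1) := by
  intro m
  refine (ExtInfo.step_free (checkExact_res 3 (by decide)) (length_resMap 3 (by decide))
    (rowsHomogeneous_resMid 3 (by decide)) (rowsHaveDeg_resMap 3 (by decide))
    (extInfo_mid_three m (N + 1)) ?_
    (show ExtInfo (coker (56 * m : ℕ) 4) (N + 1 - 1) (cokerDeg (8 * m + 4)) _ from h₁ m)
    fun x hx => ⟨hx, by push_cast at hx ⊢; omega⟩).reindex (levelSumEquiv _)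
    (cokerDeg_levelSumEquiv _)
  rintro ⟨⟨m', r⟩ | _ | _ | _ | _ | _, hx⟩
  · have hr : freeLevel r = 3 ∧ (freeDegree r = 18 ∨ freeDegree r = 20) := by
      fin_cases r <;> simp only [Class.level, freeLevel, freeDegree] at hx ⊢ <;>
        first | decide | omega
    refine ⟨rfl, fun k hk => ?_⟩
    change k < 3 at hk
    simp only [levelDeg, Class.deg]
    interval_cases k <;> simp [resGens] <;> omega
  all_goals
    simp only [Class.level] at hx
    omega

/-- `Ext` of the suspensions of `A/A(Sq⁴, Sq⁵ Sq¹)`. -/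
theorem CokerInfo.zero (h₁ : CokerInfo 1 N) (m : ℕ) :
    ExtInfo (coker (56 * m : ℕ) 0) N (extDeg (fun _ : Unit => (0, ((56 * m : ℕ) : ℤ)))
      (cokerDeg (8 * m + 1))) fun _ => False := by
  refine ExtInfo.step_free (checkExact_res 0 (by decide)) (length_resMap 0 (by decide))
    (rowsHomogeneous_resMid 0 (by decide)) (rowsHaveDeg_resMap 0 (by decide))
    (extInfo_free _ N) (fun _ => ⟨rfl, fun k hk => ?_⟩) ((h₁ m).mono (Nat.sub_le N 1))
    fun x hx => hx.elim
  change k < 2 at hk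
  interval_cases k <;> simp [resGens]

/-- The step for the seventh module, where the classes `η²` of its second summand are restricted to
`K₈` through the suspension of `K₀` by `56 (m + 1)`. -/
theorem CokerInfo.seven (h₀ : CokerInfo 1 N) (h₁ : CokerInfo 8 N) : CokerInfo 7 N := by
  intro m
  have hi : 7 < 9 := by decide
  obtain ⟨f, p, w, hS, hf⟩ := exists_shortExact_pres (56 * m : ℕ) (checkExact_res 7 hi)
    (length_resMap 7 hi) (rowsHomogeneous_resMid 7 hi) (rowsHaveDeg_resMap 7 hi)
  refine (ExtInfo.of_shortExact hS (extInfo_mid_seven m N) ((h₁ m).mono (Nat.sub_le N 1))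
    (fun s hs t => ?_)
    fun x hx => ⟨hx, by push_cast at hx ⊢; omega⟩).reindex (levelSumEquiv _)
    (cokerDeg_levelSumEquiv _)
  by_cases hx : ∃ j, (s, t) = Class.deg (.boOdd m (.etaSq j))
  · obtain ⟨j, hj⟩ := hx
    obtain ⟨rfl, rfl⟩ := Prod.mk.inj hj
    intro x
    obtain ⟨q, u, hqu⟩ := exists_factorization isDirectSum_seven hf
    obtain ⟨f', w', r, hS', -⟩ := isDirectSum_seven.exists_shortExact (56 * m : ℕ)
    -- The class `x` comes from the summand `A/A(Sq¹, Sq²)`: the free summand has no `Ext` here.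
    obtain ⟨y, rfl⟩ := Ext.contravariant_sequence_exact₂ hS' _ x
      ((extInfo_free_single _ 46 N).basis.eq_zero hs (by simp) _)
    have e : coker (56 * (m + 1) : ℕ) 0 = pres (56 * m : ℕ) [56] (resMap 1) :=
      pres_congr _ rfl fun k hk => by
        obtain rfl : k = 0 := Nat.lt_one_iff.1 hk
        simp [resGens, mul_add]
    have h0 := ((h₀.zero (m + 1)).basis.eq_zero hs (t := (Class.deg (.boOdd m (.etaSq j))).2) (by
      rintro (_ | ⟨z, hz⟩) h
      · exact absurd (congrArg Prod.fst h) (by simp [extDeg])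
      · have h1 : z.level - (8 * (m + 1) + 1) + z.deg.1 + 1 = 4 * j + 2 := congrArg Prod.fst h
        have h2 : z.deg.2 = 56 * m + 52 + (12 * j + 4) := congrArg Prod.snd h
        exact Class.not_of_etaSq (z := z) (m := m) (j := j) (by omega) (by omega) (by omega)))
    rw [e] at h0
    change (Ext.mk₀ f).comp ((Ext.mk₀ (presHom _ isDirectSum_seven.snd)).comp y _) _ = 0
    rw [Ext.mk₀_comp_mk₀_assoc]
    refine (congrArg (fun z => (Ext.mk₀ z).comp y (zero_add _)) hqu).trans ?_
    rw [← Ext.mk₀_comp_mk₀_assoc]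
    exact (congrArg (fun z => (Ext.mk₀ q).comp z (zero_add _))
      (h0 ((Ext.mk₀ u).comp y (zero_add _)))).trans (Ext.comp_zero _ _ _ _ (zero_add _))
  · refine restrictsToZero_of_level (S := ShortComplex.mk f p w) (extInfo_mid_seven m) (h₁ m) hs ?_
    rintro ⟨x, hx'⟩ hd m' j rfl
    simp only [Class.level] at hx'
    obtain rfl : m' = m := by omega
    exact hx ⟨j, hd.symm⟩

end

end SteenrodAlgebra

/-! ### Ext of `A/A(Sq⁴, Sq⁵ Sq¹)` -/

namespace SteenrodAlgebra

/-- The induction on the filtration. From `K₄` below filtration `N` one gets `K₃`, `K₂`, `K₁` below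
filtration `N + 1`, then `K₈` by periodicity, and so on down to `K₄` again. -/
theorem cokerInfo_four_and_one (N : ℕ) : CokerInfo 4 N ∧ CokerInfo 1 N := by
  induction N with
  | zero =>
    exact ⟨fun m => ⟨fun s hs => absurd hs s.not_lt_zero, fun s hs => absurd hs s.not_lt_zero⟩,
      fun m => ⟨fun s hs => absurd hs s.not_lt_zero, fun s hs => absurd hs s.not_lt_zero⟩⟩
  | succ N ih =>
    have h3 : CokerInfo 3 (N + 1) := ih.1.three
    have h2 : CokerInfo 2 (N + 1) :=
      .step (by decide) extInfo_mid_two h3 (by decide) (by decide)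
    have h1 : CokerInfo 1 (N + 1) :=
      .step (by decide) extInfo_mid_one h2 (by decide) (by decide)
    have h8 : CokerInfo 8 (N + 1) :=
      .step (by decide) extInfo_mid_eight h1.nine (by decide) (by decide)
    have h7 : CokerInfo 7 (N + 1) := .seven h1 h8
    have h6 : CokerInfo 6 (N + 1) :=
      .step (by decide) extInfo_mid_six h7 (by decide) (by decide)
    have h5 : CokerInfo 5 (N + 1) :=
      .step (by decide) extInfo_mid_five h6 (by decide) (by decide)
    exact ⟨.step (by decide) extInfo_mid_four h5 (by decide) (by decide), h1⟩

/-! ### The module -/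

theorem Sq_five_mul_Sq_one : Sq 5 * Sq 1 = wordVal [1, 2, 1, 2] := by
  have h14 : Sq 1 * Sq 4 = Sq 5 := by
    have hadem : Sq 1 * Sq 4 = ademSum (fun i j => Sq i * Sq j) 1 4 :=
      adem one_pos (by norm_num)
    rw [hadem]
    simp [ademSum, Sq_zero, show (3 : ZMod 2) = 1 from rfl]
  have h41 : Sq 4 * Sq 1 = Sq 1 * Sq 4 + Sq 2 * Sq 1 * Sq 2 := by
    have := wordVal_of_mem_rules ([4, 1], [[1, 4], [2, 1, 2]]) (by simp [rules])
    simpa [wordVal, sumVal, mul_assoc] using this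
  have h11 : Sq 1 * Sq 1 = 0 := by
    have := wordVal_of_mem_rules ([1, 1], []) (by simp [rules])
    simpa [wordVal, sumVal] using this
  rw [← h14, mul_assoc, h41, mul_add, ← mul_assoc, h11, zero_mul, zero_add]
  simp [wordVal, mul_assoc]

/-- In words, `Sq⁵ Sq¹` is `Sq¹ Sq² Sq¹ Sq²`. -/
theorem rowSpan_eq_map : (Submodule.span SteenrodAlgebra {Sq 4, Sq 5 * Sq 1}).map
    (LinearEquiv.funUnique (Fin 1) SteenrodAlgebra SteenrodAlgebra).symm.toLinearMap =
      rowSpan 1 (resMap 1) := by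
  have h4 : rowVec 1 [(0, [4])] = fun _ => Sq 4 := by
    funext i
    rw [Subsingleton.elim i 0]
    simp [rowVec, wordVal]
  have h51 : rowVec 1 [(0, [1, 2, 1, 2])] = fun _ => Sq 5 * Sq 1 := by
    funext i
    rw [Subsingleton.elim i 0, Sq_five_mul_Sq_one]
    simp [rowVec]
  rw [Submodule.map_span, Set.image_pair]
  refine le_antisymm (Submodule.span_le.2 ?_) (rowSpan_le ?_)
  · rintro _ (rfl | rfl)
    · change (fun _ => Sq 4) ∈ _
      exact h4 ▸ rowVec_mem_rowSpan (by simp [resMap])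
    · change (fun _ => Sq 5 * Sq 1) ∈ _
      exact h51 ▸ rowVec_mem_rowSpan (by simp [resMap])
  · intro r hr
    simp only [resMap, List.mem_cons, List.not_mem_nil, or_false] at hr
    rcases hr with rfl | rfl
    · rw [h4]
      exact Submodule.subset_span (Set.mem_insert _ _)
    · rw [h51]
      exact Submodule.subset_span (Set.mem_insert_of_mem _ rfl)

/-- The module `A/A(Sq⁴, Sq⁵ Sq¹)` as a presented module. -/
theorem nonempty_iso_moduleL : Nonempty (coker 0 0 ≅ moduleL) := by
  let e := Submodule.Quotient.equiv _ _
    (LinearEquiv.funUnique (Fin 1) SteenrodAlgebra SteenrodAlgebra).symm rowSpan_eq_map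
  have h1 : ∀ n, ∀ x ∈ presGrading (shiftDeg 0 [0]) (rowSpan 1 (resMap 1)) n,
      e.symm x ∈ quotientGrading (Submodule.span SteenrodAlgebra {Sq 4, Sq 5 * Sq 1}) n := by
    rintro n _ ⟨y, hy, rfl⟩
    have := (mem_freeGrading _).1 hy 0
    rw [shiftDeg, show n - (0 + (([0] : List ℕ).getD (0 : Fin 1) 0 : ℕ)) = n by simp] at this
    exact ⟨y 0, this, rfl⟩
  have h2 : ∀ n, ∀ x ∈ quotientGrading (Submodule.span SteenrodAlgebra {Sq 4, Sq 5 * Sq 1}) n,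
      e x ∈ presGrading (shiftDeg 0 [0]) (rowSpan 1 (resMap 1)) n := by
    rintro n _ ⟨y, hy, rfl⟩
    refine ⟨fun _ => y, (mem_freeGrading _).2 fun i => ?_, rfl⟩
    obtain rfl : i = (0 : Fin 1) := Subsingleton.elim (α := Fin 1) i 0
    rw [shiftDeg,
      show n - (0 + (([0] : List ℕ).getD (0 : Fin 1) 0 : ℕ)) = n by simp]
    exact hy
  exact ⟨{
    hom := GradedModuleCat.homOf (𝒜 := grading) _ _ e.symm.toLinearMap h1
    inv := GradedModuleCat.homOf (𝒜 := grading) _ _ e.toLinearMap h2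
    hom_inv_id := GradedModuleCat.homOf_comp_eq_id _ _ _ h1 _ h2 e.apply_symm_apply
    inv_hom_id := GradedModuleCat.homOf_comp_eq_id _ _ _ h2 _ h1 e.symm_apply_apply }⟩

/-- The degree `(s, t)` of a class in `Ext` of `A/A(Sq⁴, Sq⁵ Sq¹)`. -/
def Class.extDegree (x : Class) : ℕ × ℤ := (x.level + x.deg.1, x.deg.2)

theorem Class.level_eq_zero {x : Class} (h : x.level = 0) : x = .free 0 0 := by
  rcases x with ⟨m, r⟩ | _ | _ | _ | _ | _
  · obtain rfl : m = 0 := by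
      simp only [Class.level] at h
      omega
    fin_cases r
    · rfl
    all_goals simp [Class.level, freeLevel] at h
  all_goals simp [Class.level] at h

/-- A class is the generator of the module, or it has positive level. -/
def unitSumClassEquiv : Unit ⊕ {x : Class // 1 ≤ x.level} ≃ Class where
  toFun := Sum.elim (fun _ => .free 0 0) Subtype.val
  invFun x := if h : x.level = 0 then .inl () else .inr ⟨x, Nat.one_le_iff_ne_zero.2 h⟩
  left_inv := by
    rintro (_ | ⟨x, h⟩)
    · exact dif_pos rfl
    · exact dif_neg (show x.level ≠ 0 by omega)
  right_inv x := by
    dsimp only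
    split_ifs with h
    · exact (Class.level_eq_zero h).symm
    · rfl

theorem hasExtBasis_moduleL (N : ℕ) :
    HasExtBasis.{1} shiftedTrivialModule moduleL N Class.extDegree := by
  obtain ⟨e⟩ := nonempty_iso_moduleL
  refine HasExtBasis.of_iso (HasExtBasis.reindex
    ((cokerInfo_four_and_one N).2.zero 0).basis unitSumClassEquiv ?_) e
  rintro (_ | ⟨x, hx⟩)
  · rfl
  · refine Prod.ext ?_ rfl
    change x.level + x.deg.1 = x.level - 1 + x.deg.1 + 1
    omega

end SteenrodAlgebra

/-! ### The basis of the answer -/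

/-- The basis elements `v₂^{8m} a_{21,3}` of `bo_*[v₂⁴]⟨a_{5,1}, a_{21,3}⟩`, which the kernel
omits. -/
def IsOmitted (e : BoBasis × ℕ × Fin 2) : Prop :=
  e.1 = .tower₀ 0 0 ∧ Even e.2.1 ∧ e.2.2 = 1

theorem boProjection_apply (x : BoBasis × ℕ × Fin 2 →₀ ZMod 2) (m : ℕ) :
    boProjection x ((), m, 0) = x (.tower₀ 0 0, 2 * m, 1) := by
  classical
  induction x using Finsupp.induction_linear with
  | zero => simp
  | add x y hx hy => rw [map_add, Finsupp.add_apply, Finsupp.add_apply, hx, hy]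
  | single e c =>
    obtain ⟨b, k, r⟩ := e
    rw [boProjection, Finsupp.linearCombination_single, Finsupp.smul_apply, Finsupp.single_apply]
    dsimp only
    split_ifs with h h' h'
    · obtain ⟨-, -, rfl⟩ := h'
      simp
    · obtain ⟨rfl, ⟨j, rfl⟩, rfl⟩ := h
      rw [Finsupp.single_apply, if_neg, smul_zero]
      rintro h
      obtain rfl : (j + j) / 2 = m := by simpa using h
      exact h' (by rw [show 2 * ((j + j) / 2) = j + j by omega])
    · obtain ⟨rfl, rfl, rfl⟩ := h'
      exact absurd ⟨rfl, even_two_mul m, rfl⟩ h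
    · rw [Finsupp.zero_apply, smul_zero]

theorem ker_boProjection :
    LinearMap.ker boProjection = Finsupp.supported (ZMod 2) (ZMod 2) {e | ¬ IsOmitted e} := by
  ext x
  rw [LinearMap.mem_ker, Finsupp.mem_supported']
  constructor
  · rintro h ⟨b, k, r⟩ he
    obtain ⟨rfl, ⟨j, rfl⟩, rfl⟩ := not_not.1 he
    rw [← two_mul, ← boProjection_apply, h]
    rfl
  · intro h
    ext ⟨_, m, r⟩
    rw [Subsingleton.elim r 0]
    exact (boProjection_apply x m).trans (h _ (not_not.2 ⟨rfl, even_two_mul m, rfl⟩))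

theorem nonempty_boKernelPart_addEquiv (p : ℤ × ℤ) :
    Nonempty (({e : {e : BoBasis × ℕ × Fin 2 // ¬ IsOmitted e} //
      polyFreeBideg BoBasis.bideg (24, 4) ![(5, 1), (21, 3)] e.1 = p} →₀ ZMod 2) ≃+
        boKernelPart p) := by
  have h : boKernelPart p = Finsupp.supported (ZMod 2) (ZMod 2) ({e | ¬ IsOmitted e} ∩
      {e | polyFreeBideg BoBasis.bideg (24, 4) ![(5, 1), (21, 3)] e = p}) := by
    rw [Finsupp.supported_inter, ← ker_boProjection]
    rfl
  rw [h]
  exact ⟨(Finsupp.domCongr (Equiv.subtypeSubtypeEquivSubtypeInter (fun e => ¬ IsOmitted e)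
    fun e => polyFreeBideg BoBasis.bideg (24, 4) ![(5, 1), (21, 3)] e = p)).trans
    (Finsupp.supportedEquivFinsupp _).symm.toAddEquiv⟩

namespace SteenrodAlgebra

/-- The basis of the answer. -/
abbrev AnswerBasis : Type :=
  (Unit × ℕ × Fin 8) ⊕ {e : BoBasis × ℕ × Fin 2 // ¬ IsOmitted e} ⊕ (BspBasis × ℕ × Fin 2)

/-- The bidegrees `(t - s, s)` of the basis of the answer. -/
def answerBideg : AnswerBasis → ℤ × ℤ :=
  Sum.elim (polyFreeBideg unitBideg (48, 8)
    ![(0, 0), (0, 0) + (3, 1), (14, 2), (14, 2) + (1, 1), (14, 2) + (3, 1), (31, 5),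
      (31, 5) + (3, 1), (39, 7)])
    (Sum.elim (fun e => polyFreeBideg BoBasis.bideg (24, 4) ![(5, 1), (21, 3)] e.1)
      (polyFreeBideg BspBasis.bideg (24, 4) ![(9, 2), (17, 4)]))

/-- The classes as elements of the basis of the answer. -/
def Class.toAnswer : Class → AnswerBasis
  | free m r => .inl ((), m, r)
  | bo k b => .inr (.inl ⟨(b, k, 0), fun h => zero_ne_one (α := Fin 2) h.2.2⟩)
  | boOdd m b => .inr (.inl ⟨(b, 2 * m + 1, 1), fun h =>
      Nat.not_even_iff_odd.2 (odd_two_mul_add_one m) h.2.1⟩)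
  | boEven m b => .inr (.inl ⟨(b, 2 * m, 1), fun h => b.2 h.1⟩)
  | bsp k b => .inr (.inr (b, k, 0))
  | bsp' k b => .inr (.inr (b, k, 1))

theorem Class.bijective_toAnswer : Function.Bijective Class.toAnswer := by
  constructor
  · rintro (⟨m, r⟩ | ⟨k, b⟩ | ⟨m, b⟩ | ⟨m, b⟩ | ⟨k, b⟩ | ⟨k, b⟩)
      (⟨m', r'⟩ | ⟨k', b'⟩ | ⟨m', b'⟩ | ⟨m', b'⟩ | ⟨k', b'⟩ | ⟨k', b'⟩) h <;>
    simp [Class.toAnswer, Subtype.ext_iff] at h ⊢ <;> first | tauto | omega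
  · rintro (⟨_, m, r⟩ | ⟨⟨b, k, r⟩, h⟩ | ⟨b, k, r⟩)
    · exact ⟨.free m r, rfl⟩
    · fin_cases r
      · exact ⟨.bo k b, rfl⟩
      · rcases Nat.even_or_odd' k with ⟨m, rfl | rfl⟩
        · exact ⟨.boEven m ⟨b, fun hb => h ⟨hb, even_two_mul m, rfl⟩⟩, rfl⟩
        · exact ⟨.boOdd m b, rfl⟩
    · fin_cases r
      · exact ⟨.bsp k b, rfl⟩
      · exact ⟨.bsp' k b, rfl⟩

theorem Class.answerBideg_toAnswer (x : Class) :
    answerBideg x.toAnswer = (x.extDegree.2 - x.extDegree.1, (x.extDegree.1 : ℤ)) := by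
  rcases x with ⟨m, r⟩ | ⟨m, ⟨i, j⟩ | i | i | ⟨i, j⟩⟩ | ⟨m, ⟨i, j⟩ | i | i | ⟨i, j⟩⟩ |
    ⟨m, ⟨⟨_ | i, _ | j⟩ | i | i | ⟨i, j⟩, hb⟩⟩ | ⟨m, ⟨i, j⟩ | ⟨i, j⟩ | i | i⟩ |
    ⟨m, ⟨i, j⟩ | ⟨i, j⟩ | i | i⟩
  all_goals try fin_cases r
  all_goals try exact absurd rfl hb
  all_goals
    simp [answerBideg, Class.toAnswer, polyFreeBideg, unitBideg, BoBasis.bideg, BspBasis.bideg,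
      Class.extDegree, Class.level, Class.deg, boDeg, bspDeg, freeLevel, freeDegree]
    try omega

theorem nonempty_addEquiv_answer (s : ℕ) (t : ℤ) :
    Nonempty (ExtA moduleL s t ≃+ ({x // answerBideg x = (t - s, (s : ℤ))} →₀ ZMod 2)) := by
  obtain ⟨f⟩ := hasExtBasis_moduleL (s + 1) s (Nat.lt_succ_self s) t
  refine ⟨f.trans (Finsupp.domCongr
    ((Equiv.ofBijective _ Class.bijective_toAnswer).subtypeEquiv fun x => ?_))⟩
  rw [Equiv.ofBijective_apply, x.answerBideg_toAnswer, Prod.ext_iff, Prod.ext_iff]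
  dsimp only
  omega

end SteenrodAlgebra

theorem mainTheorem5 (s : ℕ) (t : ℤ) :
    Nonempty (SteenrodAlgebra.ExtA SteenrodAlgebra.moduleL s t ≃+
      (v28Part (t - s, (s : ℤ)) × boKernelPart (t - s, (s : ℤ)) × bspPart (t - s, (s : ℤ)))) := by
  obtain ⟨f⟩ := SteenrodAlgebra.nonempty_addEquiv_answer s t
  obtain ⟨g⟩ := nonempty_boKernelPart_addEquiv (t - s, (s : ℤ))
  refine ⟨f.trans ((Finsupp.domCongr Equiv.subtypeSum).trans
    (Finsupp.sumFinsuppAddEquivProdFinsupp.trans (AddEquiv.prodCongr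
      (Finsupp.supportedEquivFinsupp _).symm.toAddEquiv
      ((Finsupp.domCongr Equiv.subtypeSum).trans (Finsupp.sumFinsuppAddEquivProdFinsupp.trans
        (AddEquiv.prodCongr g (Finsupp.supportedEquivFinsupp _).symm.toAddEquiv))))))⟩
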